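/- Let $d_+,d_-\in\mathbb R$ and $0<t_+<1$, and let $d$ be the $1$-periodic function with $d(t)=d_+$ for $0\le t<t_+$ and $d(t)=-d_-$ for $t_+<t<1$. Assume that the average $d_{\mathrm{av}}=\int_0^1 d(t)\,dt$ equals $1$, and set $D(\tau)=\int_0^\tau (d(\sigma)-d_{\mathrm{av}})\,d\sigma$. Consider, in one space dimension, the averaged dispersion-managed cubic nonlinear Schrödinger equation $$ i\partial_t u+\partial_{xx}u=\mathcal N(u),\qquad \mathcal N(u)=\int_0^1 e^{-iD(\tau)\Delta}\bigl\{|e^{iD(\tau)\Delta}u|^2e^{iD(\tau)\Delta}u\bigr\}\,d\tau. \qquad(*)$$ Let $H^{1,1}$ be the space of all $u\in L^2(\mathbb R)$ with $\|u\|_{H^{1,1}}=\|\langle\partial_x\rangle u\|_{L^2}+\|xu\|_{L^2}<\infty$, where $\langle\partial_x\rangle$ is the Fourier multiplier with symbol $(1+\xi^2)^{1/2}$. A solution of $(*)$ in $C_tH^{1,1}_x([0,\infty)\times\mathbb R)$ with $u|_{t=0}=u_0$ is a function $u\in C([0,\infty);H^{1,1})$ such that $$u(t)=e^{it\Delta}u_0-i\int_0^t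 e^{i(t-s)\Delta}\mathcal N(u(s))\,ds\qquad\text{for all }t\ge 0.$$ There are constants $\varepsilon_0>0$ and $C>0$, depending only on $d_\pm$ and $t_+$, such that the following holds for every $u_0\in H^{1,1}$ with $0<\varepsilon:=\|u_0\|_{H^{1,1}}\le\varepsilon_0$. There exists a unique solution $u\in C_tH^{1,1}_x([0,\infty)\times\mathbb R)$ of $(*)$ with $u|_{t=0}=u_0$. It obeys $$\|u(t)\|_{L^\infty}\le C\varepsilon(1+|t|)^{-1/2}\qquad\text{for all }t\ge 0,$$ and there exists $W\in L^\infty(\mathbb R)$ such that $$u(t,x)=(2it)^{-1/2}e^{ix^2/4t}\exp\bigl\{-\tfrac i2|W(\tfrac x{2t})|^2\log t\bigr\}W(\tfrac x{2t})+\mathcal O\bigl(t^{-\frac12-\frac1{20}}\bigr)\quad\text{in }L^\infty\text{ as }t\to\infty .$$ -/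

import Mathlib

open MeasureTheory FourierTransform
open scoped ENNReal

noncomputable section

namespace DMNLS

/-- The complex space `L²(ℝ)` (classes of functions modulo equality almost everywhere). -/
abbrev L2 : Type := Lp ℂ 2 (volume : Measure ℝ)

/-! ### The piecewise constant dispersion -/

/-- The `1`-periodic dispersion map `d`, equal to `dp` on `[0, tp)` and to `-dm` on `[tp, 1)`. -/
def dispersion (dp dm tp t : ℝ) : ℝ :=
  if Int.fract t < tp then dp else -dm

/-- The average dispersion, the mean of `d` over one period. -/
def avgDispersion (dp dm tp : ℝ) : ℝ :=
  ∫ t in (0 : ℝ)..1, dispersion dp dm tp t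

/-- `D(τ) = ∫₀^τ d₀(σ) dσ`, where `d₀ = d - d_av` is the mean-zero part of `d`. -/
def cumDispersion (dp dm tp τ : ℝ) : ℝ :=
  ∫ σ in (0 : ℝ)..τ, (dispersion dp dm tp σ - avgDispersion dp dm tp)

/-! ### The free propagator

The Fourier transform `𝓕` of Mathlib is unitary on `L²` and uses the character `exp (-2πi x ξ)`, so
that `-i∂ₓ` is multiplication by `2πξ` on the Fourier side. -/

theorem memLp_propagator (t : ℝ) (f : L2) :
    MemLp (fun ξ : ℝ => Complex.exp (-Complex.I * (t * (2 * Real.pi * ξ) ^ 2 : ℝ)) * f ξ) 2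
      volume := by
  refine (Lp.memLp f).of_le (AEStronglyMeasurable.mul
    (Continuous.aestronglyMeasurable (by fun_prop)) (Lp.aestronglyMeasurable f)) ?_
  refine Filter.Eventually.of_forall fun ξ => ?_
  have h : -Complex.I * ((t * (2 * Real.pi * ξ) ^ 2 : ℝ) : ℂ)
      = ((-(t * (2 * Real.pi * ξ) ^ 2) : ℝ) : ℂ) * Complex.I := by
    rw [Complex.ofReal_neg]; ring
  rw [norm_mul, h, Complex.norm_exp_ofReal_mul_I, one_mul]

/-- The free Schrödinger propagator `e^{itΔ}` on `L²(ℝ)`, the Fourier multiplier with symbol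
`exp (-i t |2πξ|²)`. -/
def propagator (t : ℝ) (v : L2) : L2 :=
  𝓕⁻ ((memLp_propagator t (𝓕 v)).toLp _)

/-! ### The space `H^{1,1}` -/

/-- The norm `‖u‖_{H^{1,1}} = ‖⟨∂ₓ⟩ u‖_{L²} + ‖x u‖_{L²}`, infinite if `u` is not in `H^{1,1}`. -/
def normH11 (u : L2) : ℝ≥0∞ :=
  eLpNorm (fun ξ : ℝ => (Real.sqrt (1 + (2 * Real.pi * ξ) ^ 2) : ℂ) * (𝓕 u : L2) ξ) 2 volume
    + eLpNorm (fun x : ℝ => (x : ℂ) * u x) 2 volume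

/-- `u ∈ C([0, ∞); H^{1,1})` (only the values of `u` at times `t ≥ 0` matter). -/
def ContinuousH11 (u : ℝ → L2) : Prop :=
  ∀ t : ℝ, 0 ≤ t → normH11 (u t) < ∞ ∧
    Filter.Tendsto (fun s : ℝ => normH11 (u s - u t)) (nhdsWithin t (Set.Ici 0)) (nhds 0)

/-! ### The averaged equation -/

open Classical in
/-- The cubic nonlinearity `|v|² v` as an element of `L²`. The second branch is never used for
`v ∈ H¹`, since then `v` is bounded and `|v|² v ∈ L²`. -/
def cubic (v : L2) : L2 :=
  if h : MemLp (fun x : ℝ => (‖v x‖ ^ 2 : ℂ) * v x) 2 volume then h.toLp _ else 0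

/-- The integrand `e^{-iD(τ)Δ} { |e^{iD(τ)Δ} v|² e^{iD(τ)Δ} v }`. -/
def integrand (dp dm tp : ℝ) (v : L2) (τ : ℝ) : L2 :=
  propagator (-cumDispersion dp dm tp τ) (cubic (propagator (cumDispersion dp dm tp τ) v))

/-- The averaged nonlinearity `∫₀¹ e^{-iD(τ)Δ} { |e^{iD(τ)Δ} v|² e^{iD(τ)Δ} v } dτ`. -/
def nonlinearity (dp dm tp : ℝ) (v : L2) : L2 :=
  ∫ τ in (0 : ℝ)..1, integrand dp dm tp v τ

/-- `u` is a forward-global solution in `C([0, ∞); H^{1,1})` of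
`i ∂ₜu + ∂ₓₓu = ∫₀¹ e^{-iD(τ)Δ} { |e^{iD(τ)Δ} u|² e^{iD(τ)Δ} u } dτ` with `u(0) = u₀`, in the sense of
the Duhamel formula. -/
structure IsSolution (dp dm tp : ℝ) (u₀ : L2) (u : ℝ → L2) : Prop where
  continuousH11 : ContinuousH11 u
  duhamel : ∀ t : ℝ, 0 ≤ t →
    u t = propagator t u₀
      - Complex.I • ∫ s in (0 : ℝ)..t, propagator (t - s) (nonlinearity dp dm tp (u s))

/-- All the objects in the Duhamel formula are well defined for `u`: the cubic expressions belong to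
`L²`, and both integrals converge (as Bochner integrals in `L²`). -/
structure DuhamelWellDefined (dp dm tp : ℝ) (u : ℝ → L2) : Prop where
  cubic_memLp : ∀ s : ℝ, 0 ≤ s → ∀ τ ∈ Set.Icc (0 : ℝ) 1,
    MemLp (fun x : ℝ => (‖(propagator (cumDispersion dp dm tp τ) (u s)) x‖ ^ 2 : ℂ)
      * (propagator (cumDispersion dp dm tp τ) (u s)) x) 2 volume
  integrable_tau : ∀ s : ℝ, 0 ≤ s → IntervalIntegrable (integrand dp dm tp (u s)) volume 0 1
  integrable_time : ∀ t : ℝ, 0 ≤ t → IntervalIntegrable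
    (fun s : ℝ => propagator (t - s) (nonlinearity dp dm tp (u s))) volume 0 t

/-- The asymptotic profile
`(2it)^{-1/2} e^{ix²/4t} exp {-(i/2) |W(x/2t)|² log t} W(x/2t)`. -/
def profile (W : ℝ → ℂ) (t x : ℝ) : ℂ :=
  (2 * Complex.I * t) ^ (-(1 / 2) : ℂ) * Complex.exp (Complex.I * (x ^ 2 / (4 * t) : ℝ))
    * (Complex.exp (-(Complex.I / 2) * (‖W (x / (2 * t))‖ ^ 2 * Real.log t : ℝ))
      * W (x / (2 * t)))

end DMNLS

end

noncomputable section

namespace DMNLS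

open Filter Topology
open scoped BoundedContinuousFunction

/-! ### Multiplication by a unimodular function -/

/-! Write u(t) = e^{itΔ} f(t). Then f' = -i ∫₀¹ N_{t+D(τ)}(f) dτ with N_r(f) = e^{-irΔ}(|e^{irΔ}f|²
e^{irΔ}f). This is an ordinary differential equation in H^{1,1} with a locally Lipschitz right-hand
side (`field`, `norm_field_sub_le`), and two facts about N_r carry the proof.

Energy: N_r commutes with translations and with boosts. Differentiating along these orbits gives
Leibniz rules for ∂ₓ and for x, hence ‖N_r(f)‖ ≤ 3 ‖e^{irΔ}f‖_∞² ‖f‖ in H^{1,1}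
(`norm_cubicField_le`).

Resonance: let A = 𝓕(e^{ix²/4r} f). The kernel factorisation (`evol_eq_chirp`) turns N_r into
exactly (4πr)⁻¹|A|²A (`chirp_cubicField`), and the weight x keeps A within O(r^{-1/8}‖f‖) of f̂
(`norm_chirp_sub_le`). As D is bounded, replacing t + D(τ) by t changes the coefficient only by
O(t⁻²). So the averaged equation has the leading dynamics of cubic NLS: ∂ₜf̂ = -i(4πt)⁻¹|f̂|²f̂ +
O(t^{-9/8}‖f‖³) (`norm_chirp_field_add_le`).

The leading term is orthogonal to f̂, so |f̂| stays O(ε) while ‖f‖ ≤ 2ε(1+t)^{1/100}. This gives the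
t^{-1/2} decay, and the energy bound then improves the growth bound to ε(1+t)^{1/100}. In place of a
continuity argument, the field is cut off at radius 2ε(1+t)^{1/100}: the cut-off equation is
globally solvable, and the estimates show that the cutoff is never active (`exists_global_curve`).
Multiplying f̂ by exp(i(4π)⁻¹|f̂|² log t) removes the leading term and leaves an integrable
derivative; the limit is the scattering profile (`exists_scattering_limit`). Uniqueness is Grönwall
in H^{1,1}, once every Duhamel solution is seen to solve the profile equation
(`eqOn_of_isSolution`). -/

theorem tendsto_eLpNorm_of_dominated {ι : Type*} {l : Filter ι} [l.IsCountablyGenerated]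
    {q : ℝ≥0∞} (hq0 : q ≠ 0) (hq : q ≠ ∞) {F : ι → ℝ → ℂ} {g : ℝ → ℂ} (hg : MemLp g q volume)
    (hF : ∀ n, AEStronglyMeasurable (F n) volume)
    (hb : ∀ᶠ n in l, ∀ᵐ x, ‖F n x‖ ≤ ‖g x‖)
    (hlim : ∀ᵐ x, Tendsto (fun n => F n x) l (𝓝 0)) :
    Tendsto (fun n => eLpNorm (F n) q volume) l (𝓝 0) := by
  have hq' : 0 < q.toReal := ENNReal.toReal_pos hq0 hq
  simp only [eLpNorm_eq_lintegral_rpow_enorm_toReal hq0 hq]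
  have h0 : (𝓝 (0 : ℝ≥0∞)) = 𝓝 ((0 : ℝ≥0∞) ^ (1 / q.toReal)) := by
    rw [ENNReal.zero_rpow_of_pos (by positivity)]
  rw [h0]
  refine Tendsto.ennrpow_const _ ?_
  have h1 : (0 : ℝ≥0∞) = ∫⁻ _ : ℝ, 0 := by simp
  rw [h1]
  refine tendsto_lintegral_filter_of_dominated_convergence' (fun x => ‖g x‖ₑ ^ q.toReal) ?_ ?_ ?_ ?_
  · exact Eventually.of_forall fun n => ((hF n).enorm.pow_const _)
  · filter_upwards [hb] with n hn
    filter_upwards [hn] with x hx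
    gcongr
    exact enorm_le_iff_norm_le.mpr hx
  · exact (lintegral_rpow_enorm_lt_top_of_eLpNorm_lt_top hq0 hq hg.2).ne
  · filter_upwards [hlim] with x hx
    have : Tendsto (fun n => ‖F n x‖ₑ) l (𝓝 0) := by
      simpa [Function.comp_def] using (continuous_enorm.tendsto (0 : ℂ)).comp hx
    have h2 := this.ennrpow_const q.toReal
    rwa [ENNReal.zero_rpow_of_pos hq'] at h2

/-- The function `x ↦ exp (i p(x))`. -/
def phase (p : C(ℝ, ℝ)) (x : ℝ) : ℂ := Complex.exp (p x * Complex.I)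

theorem continuous_phase (p : C(ℝ, ℝ)) : Continuous (phase p) := by
  unfold phase; fun_prop

@[simp] theorem norm_phase (p : C(ℝ, ℝ)) (x : ℝ) : ‖phase p x‖ = 1 :=
  Complex.norm_exp_ofReal_mul_I _

theorem phase_add (p q : C(ℝ, ℝ)) (x : ℝ) : phase (p + q) x = phase p x * phase q x := by
  simp [phase, add_mul, Complex.exp_add]

@[simp] theorem phase_zero (x : ℝ) : phase 0 x = 1 := by simp [phase]

variable {q : ℝ≥0∞}

theorem memLp_phase_mul (p : C(ℝ, ℝ)) {f : ℝ → ℂ} (hf : MemLp f q volume) :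
    MemLp (fun x => phase p x * f x) q volume :=
  hf.of_le ((continuous_phase p).aestronglyMeasurable.mul hf.1)
    (Eventually.of_forall fun x => by simp)

variable [Fact (1 ≤ q)]

/-- Multiplication by `exp (i p(x))` on `L^q`. -/
def phaseMul (p : C(ℝ, ℝ)) : Lp ℂ q (volume : Measure ℝ) →ₗᵢ[ℂ] Lp ℂ q (volume : Measure ℝ) where
  toFun f := (memLp_phase_mul p (Lp.memLp f)).toLp _
  map_add' f g := by
    rw [← MemLp.toLp_add]
    refine MemLp.toLp_congr _ _ ?_
    filter_upwards [Lp.coeFn_add f g] with x hx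
    simp only [Pi.add_apply] at hx ⊢
    rw [hx, mul_add]
  map_smul' c f := by
    rw [RingHom.id_apply, ← MemLp.toLp_const_smul]
    refine MemLp.toLp_congr _ _ ?_
    filter_upwards [Lp.coeFn_smul c f] with x hx
    simp only [Pi.smul_apply, smul_eq_mul] at hx ⊢
    rw [hx]; ring
  norm_map' f := by
    simp only [LinearMap.coe_mk, AddHom.coe_mk, Lp.norm_toLp]
    rw [Lp.norm_def]
    congr 1
    exact eLpNorm_congr_norm_ae (Eventually.of_forall fun x => by simp)

theorem coeFn_phaseMul (p : C(ℝ, ℝ)) (f : Lp ℂ q (volume : Measure ℝ)) :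
    phaseMul p f =ᵐ[volume] fun x => phase p x * f x :=
  MemLp.coeFn_toLp (memLp_phase_mul p (Lp.memLp f))

theorem phaseMul_add (p r : C(ℝ, ℝ)) (f : Lp ℂ q (volume : Measure ℝ)) :
    phaseMul (p + r) f = phaseMul p (phaseMul r f) := by
  refine Lp.ext ?_
  filter_upwards [coeFn_phaseMul (p + r) f, coeFn_phaseMul p (phaseMul r f), coeFn_phaseMul r f]
    with x h1 h2 h3
  rw [h1, h2, h3, phase_add]; ring

@[simp] theorem phaseMul_zero (f : Lp ℂ q (volume : Measure ℝ)) : phaseMul 0 f = f := by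
  refine Lp.ext ?_
  filter_upwards [coeFn_phaseMul 0 f] with x h1
  simp [h1]

theorem phaseMul_zero_smul (p : C(ℝ, ℝ)) (f : Lp ℂ q (volume : Measure ℝ)) :
    phaseMul ((0 : ℝ) • p) f = f := by simp

theorem phaseMul_comm (p r : C(ℝ, ℝ)) (f : Lp ℂ q (volume : Measure ℝ)) :
    phaseMul p (phaseMul r f) = phaseMul r (phaseMul p f) := by
  rw [← phaseMul_add, add_comm, phaseMul_add]

theorem continuous_phaseMul (hq : q ≠ ∞) (p : C(ℝ, ℝ)) (f : Lp ℂ q (volume : Measure ℝ)) :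
    Continuous fun t : ℝ => phaseMul (t • p) f := by
  have hq0 : q ≠ 0 := (zero_lt_one.trans_le (Fact.out : 1 ≤ q)).ne'
  rw [continuous_iff_continuousAt]
  intro t
  rw [ContinuousAt, Lp.tendsto_Lp_iff_tendsto_eLpNorm']
  have : ∀ s : ℝ, eLpNorm (⇑(phaseMul (s • p) f) - ⇑(phaseMul (t • p) f)) q volume
      = eLpNorm (fun x => (phase (s • p) x - phase (t • p) x) * f x) q volume := fun s =>
    eLpNorm_congr_ae (by
      filter_upwards [coeFn_phaseMul (s • p) f, coeFn_phaseMul (t • p) f] with x h1 h2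
      simp [h1, h2, sub_mul])
  simp only [this]
  refine tendsto_eLpNorm_of_dominated (g := fun x => 2 * f x) hq0 hq ((Lp.memLp f).const_mul 2)
    (fun s => ?_) (Eventually.of_forall fun s => Eventually.of_forall fun x => ?_)
    (Eventually.of_forall fun x => ?_)
  · exact ((continuous_phase _).sub (continuous_phase _)).aestronglyMeasurable.mul
      (Lp.aestronglyMeasurable f)
  · rw [norm_mul, norm_mul]
    gcongr
    refine (norm_sub_le _ _).trans ?_
    simp; norm_num
  · have h : Continuous fun s : ℝ => (phase (s • p) x - phase (t • p) x) * f x := by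
      simp only [phase, ContinuousMap.smul_apply, smul_eq_mul, Complex.ofReal_mul]
      fun_prop
    simpa using h.tendsto t

/-- Separate continuity suffices because every `phaseMul` is an isometry, hence 1-Lipschitz
uniformly in the parameter. -/
theorem continuous_phaseMul_uncurry (hq : q ≠ ∞) (p : C(ℝ, ℝ)) :
    Continuous fun z : ℝ × Lp ℂ q (volume : Measure ℝ) => phaseMul (z.1 • p) z.2 := by
  have h := continuous_prod_of_continuous_lipschitzWith'
    (fun z : ℝ × Lp ℂ q (volume : Measure ℝ) => phaseMul (z.1 • p) z.2) 1
    (fun a => (phaseMul (a • p)).lipschitz) (fun b => ?_)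
  · exact h
  · exact continuous_phaseMul hq p b

theorem hasDerivAt_phase (p : C(ℝ, ℝ)) (x : ℝ) :
    HasDerivAt (fun t : ℝ => phase (t • p) x) (Complex.I * p x) 0 := by
  have h1 : HasDerivAt (fun t : ℝ => ((t : ℂ) * p x) * Complex.I) ((1 * p x) * Complex.I) 0 :=
    ((HasDerivAt.ofReal_comp (hasDerivAt_id (0 : ℝ))).mul_const _).mul_const _
  have h2 := h1.cexp
  simp only [phase, ContinuousMap.smul_apply, smul_eq_mul, Complex.ofReal_mul]
  convert h2 using 1
  simp [mul_comm]

theorem norm_phase_sub_one_le (p : C(ℝ, ℝ)) (t x : ℝ) :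
    ‖phase (t • p) x - 1‖ ≤ |t| * |p x| := by
  have := Real.norm_exp_I_mul_ofReal_sub_one_le (x := t * p x)
  simp only [phase, ContinuousMap.smul_apply, smul_eq_mul]
  rw [mul_comm]
  simpa [abs_mul] using this

theorem tendsto_phase_slope (p : C(ℝ, ℝ)) (x : ℝ) :
    Tendsto (fun t : ℝ => (t : ℂ)⁻¹ * (phase (t • p) x - 1)) (𝓝[≠] 0) (𝓝 (Complex.I * p x)) := by
  have := (hasDerivAt_phase p x).tendsto_slope_zero
  simpa using this

theorem coeFn_slope_phaseMul (p : C(ℝ, ℝ)) (f : Lp ℂ q (volume : Measure ℝ)) (t : ℝ) :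
    ⇑(t⁻¹ • (phaseMul ((0 + t) • p) f - phaseMul ((0 : ℝ) • p) f)) =ᵐ[volume]
      fun x => ((t : ℂ)⁻¹ * (phase (t • p) x - 1)) * f x := by
  rw [zero_add, phaseMul_zero_smul]
  filter_upwards [Lp.coeFn_smul t⁻¹ (phaseMul (t • p) f - f), Lp.coeFn_sub (phaseMul (t • p) f) f,
    coeFn_phaseMul (t • p) f] with x h1 h2 h3
  rw [h1, Pi.smul_apply, h2, Pi.sub_apply, h3, Complex.real_smul]
  push_cast
  ring

/-- Dominated convergence: |e^{itp} - 1| ≤ |t||p| bounds the error of the difference quotient by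
2|h|. Together with the converse `ae_eq_of_hasDerivAt_phaseMul`, this describes multiplication by ip
as the generator of a unitary group. -/
theorem hasDerivAt_phaseMul (hq : q ≠ ∞) (p : C(ℝ, ℝ)) {f h : Lp ℂ q (volume : Measure ℝ)}
    (hfh : h =ᵐ[volume] fun x => Complex.I * p x * f x) :
    HasDerivAt (fun t : ℝ => phaseMul (t • p) f) h 0 := by
  have hq0 : q ≠ 0 := (zero_lt_one.trans_le (Fact.out : 1 ≤ q)).ne'
  rw [hasDerivAt_iff_tendsto_slope_zero, Lp.tendsto_Lp_iff_tendsto_eLpNorm']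
  have : ∀ t : ℝ, eLpNorm (⇑(t⁻¹ • (phaseMul ((0 + t) • p) f - phaseMul ((0 : ℝ) • p) f)) - ⇑h) q
      volume = eLpNorm (fun x => ((t : ℂ)⁻¹ * (phase (t • p) x - 1) - Complex.I * p x) * f x) q
      volume := fun t =>
    eLpNorm_congr_ae (by
      filter_upwards [coeFn_slope_phaseMul p f t, hfh] with x h1 h2
      rw [Pi.sub_apply, h1, h2, sub_mul])
  simp only [this]
  refine tendsto_eLpNorm_of_dominated (g := fun x => 2 * h x) hq0 hq ((Lp.memLp h).const_mul 2)
    (fun s => ?_) ?_ (Eventually.of_forall fun x => ?_)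
  · refine AEStronglyMeasurable.mul (Continuous.aestronglyMeasurable ?_) (Lp.aestronglyMeasurable f)
    have := continuous_phase (s • p)
    fun_prop
  · filter_upwards [self_mem_nhdsWithin] with t ht
    filter_upwards [hfh] with x hx
    rw [hx, norm_mul, norm_mul, norm_mul, norm_mul, Complex.norm_I, ← mul_assoc]
    gcongr
    refine (norm_sub_le _ _).trans ?_
    have ht' : 0 < |t| := abs_pos.mpr ht
    have h1 : ‖(t : ℂ)⁻¹ * (phase (t • p) x - 1)‖ ≤ |p x| := by
      rw [norm_mul, norm_inv, Complex.norm_real, Real.norm_eq_abs, inv_mul_le_iff₀ ht']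
      exact norm_phase_sub_one_le p t x
    have h2 : ‖Complex.I * (p x : ℂ)‖ = |p x| := by simp
    rw [h2]
    simp only [Complex.norm_ofNat, one_mul, Complex.norm_real, Real.norm_eq_abs]
    linarith
  · have := ((tendsto_phase_slope p x).sub_const (Complex.I * p x)).mul_const (f x)
    simpa using this

/-- A subsequence of the difference quotients converges almost everywhere, and its pointwise limit
can only be ipf. This is how ipf is shown to lie in the space: it is enough to differentiate the
orbit. -/
theorem ae_eq_of_hasDerivAt_phaseMul (p : C(ℝ, ℝ)) {f h : Lp ℂ q (volume : Measure ℝ)}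
    (hd : HasDerivAt (fun t : ℝ => phaseMul (t • p) f) h 0) :
    h =ᵐ[volume] fun x => Complex.I * p x * f x := by
  rw [hasDerivAt_iff_tendsto_slope_zero] at hd
  let s : ℕ → ℝ := fun n => 1 / ((n : ℝ) + 1)
  have hs : Tendsto s atTop (𝓝[≠] 0) := by
    refine tendsto_nhdsWithin_iff.mpr ⟨tendsto_one_div_add_atTop_nhds_zero_nat, ?_⟩
    exact Eventually.of_forall fun n => (by positivity : (0 : ℝ) < 1 / ((n : ℝ) + 1)).ne'
  have h1 := tendstoInMeasure_of_tendsto_Lp (hd.comp hs)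
  obtain ⟨ns, hns, hae⟩ := h1.exists_seq_tendsto_ae
  have h3 : ∀ᵐ x, ∀ n : ℕ, ⇑((s n)⁻¹ • (phaseMul ((0 + s n) • p) f - phaseMul ((0 : ℝ) • p) f)) x
      = (((s n : ℝ) : ℂ)⁻¹ * (phase (s n • p) x - 1)) * f x :=
    ae_all_iff.mpr fun n => coeFn_slope_phaseMul p f (s n)
  filter_upwards [hae, h3] with x hx h3x
  refine tendsto_nhds_unique hx ?_
  have h4 := ((tendsto_phase_slope p x).comp (hs.comp hns.tendsto_atTop)).mul_const (f x)
  refine h4.congr fun n => ?_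
  simp only [Function.comp_apply]
  rw [h3x]

/-! ### Translations -/

/-- Translation `f ↦ f(· + a)` on `L²`. -/
def shift (a : ℝ) : L2 →+ L2 :=
  Lp.compMeasurePreserving (fun x => x + a) (measurePreserving_add_right volume a)

theorem coeFn_shift (a : ℝ) (f : L2) : shift a f =ᵐ[volume] fun x => f (x + a) :=
  Lp.coeFn_compMeasurePreserving f _

theorem continuous_shift (a : ℝ) : Continuous (shift a) :=
  (Lp.isometry_compMeasurePreserving _).continuous

theorem ae_shift {P : ℝ → Prop} (h : ∀ᵐ x, P x) (a : ℝ) : ∀ᵐ x : ℝ, P (x + a) :=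
  (measurePreserving_add_right volume a).quasiMeasurePreserving.ae h

@[simp] theorem shift_zero (f : L2) : shift 0 f = f := by
  refine Lp.ext ?_
  filter_upwards [coeFn_shift 0 f] with x h1
  rw [h1, add_zero]

theorem phaseMul_shift (p : C(ℝ, ℝ)) (a : ℝ) (f : L2) :
    phaseMul (p.comp ((ContinuousMap.id ℝ) + ContinuousMap.const ℝ a)) (shift a f)
      = shift a (phaseMul p f) := by
  refine Lp.ext ?_
  filter_upwards [coeFn_phaseMul (p.comp ((ContinuousMap.id ℝ) + ContinuousMap.const ℝ a))
    (shift a f), coeFn_shift a f, coeFn_shift a (phaseMul p f), ae_shift (coeFn_phaseMul p f) a]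
    with x h1 h2 h3 h4
  rw [h1, h2, h3, h4]
  simp [phase]

end DMNLS

namespace DMNLS

open Filter Topology
open scoped BoundedContinuousFunction SchwartzMap ContDiff

/-! ### The Fourier transform on `L²` -/

theorem integral_fourier_mul_eq {f g : ℝ → ℂ} (hf : Integrable f) (hg : Integrable g) :
    ∫ ξ, 𝓕 f ξ * g ξ = ∫ x, f x * 𝓕 g x := by
  have := VectorFourier.integral_fourierIntegral_smul_eq_flip (μ := (volume : Measure ℝ))
    (ν := (volume : Measure ℝ)) (L := innerₗ ℝ) Real.continuous_fourierChar
    (innerSL ℝ).continuous₂ hf hg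
  simpa [flip_innerₗ] using! this

theorem continuous_fourier_of_integrable {f : ℝ → ℂ} (hf : Integrable f) : Continuous (𝓕 f) :=
  VectorFourier.fourierIntegral_continuous Real.continuous_fourierChar
    (innerSL ℝ).continuous₂ hf

/-- The Fourier transform on `L²` is given by the Fourier integral on `L¹ ∩ L²`. -/
theorem coeFn_fourier_of_integrable (f : L2) (hf : Integrable f) :
    (𝓕 f : L2) =ᵐ[volume] 𝓕 (f : ℝ → ℂ) := by
  have hcont := continuous_fourier_of_integrable hf
  refine ae_eq_of_integral_contDiff_smul_eq ((Lp.memLp (𝓕 f : L2)).locallyIntegrable (by norm_num))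
    hcont.locallyIntegrable fun g hg hc => ?_
  have hg₁ : HasCompactSupport (Complex.ofRealCLM ∘ g) := hc.comp_left rfl
  have hg₂ : ContDiff ℝ ∞ (Complex.ofRealCLM ∘ g) := by fun_prop
  set φ : 𝓢(ℝ, ℂ) := hg₁.toSchwartzMap hg₂ with hφ
  have e1 : ∀ x, φ x = (g x : ℂ) := fun x => rfl
  have h1 := congrArg (fun T => T φ) (Lp.fourier_toTemperedDistribution_eq f)
  simp only [TemperedDistribution.fourier_apply, Lp.toTemperedDistribution_apply] at h1
  calc ∫ x, g x • (𝓕 f : L2) x = ∫ x, φ x • (𝓕 f : L2) x := by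
        simp only [e1, Complex.real_smul, smul_eq_mul]
    _ = ∫ x, (𝓕 φ) x • f x := h1.symm
    _ = ∫ x, 𝓕 (φ : ℝ → ℂ) x * f x := by simp [SchwartzMap.fourier_coe]
    _ = ∫ x, φ x * 𝓕 (f : ℝ → ℂ) x := integral_fourier_mul_eq φ.integrable hf
    _ = ∫ x, g x • 𝓕 (f : ℝ → ℂ) x := by simp only [e1, Complex.real_smul]

theorem coeFn_fourierInv_of_integrable (f : L2) (hf : Integrable f) :
    (𝓕⁻ f : L2) =ᵐ[volume] 𝓕⁻ (f : ℝ → ℂ) := by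
  have hcont : Continuous (𝓕⁻ (f : ℝ → ℂ)) := by
    rw [Real.fourierInv_eq_fourier_comp_neg]
    exact continuous_fourier_of_integrable hf.comp_neg
  refine ae_eq_of_integral_contDiff_smul_eq
    ((Lp.memLp (𝓕⁻ f : L2)).locallyIntegrable (by norm_num))
    hcont.locallyIntegrable fun g hg hc => ?_
  have hg₁ : HasCompactSupport (Complex.ofRealCLM ∘ g) := hc.comp_left rfl
  have hg₂ : ContDiff ℝ ∞ (Complex.ofRealCLM ∘ g) := by fun_prop
  set φ : 𝓢(ℝ, ℂ) := hg₁.toSchwartzMap hg₂ with hφ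
  have e1 : ∀ x, φ x = (g x : ℂ) := fun x => rfl
  have h1 := congrArg (fun T => T φ) (Lp.fourierInv_toTemperedDistribution_eq f)
  simp only [TemperedDistribution.fourierInv_apply, Lp.toTemperedDistribution_apply] at h1
  have h2 : ∀ x, 𝓕⁻ (f : ℝ → ℂ) x = 𝓕 (fun y => f (-y)) x := fun x => by
    rw [Real.fourierInv_eq_fourier_comp_neg]
  have h3 : ∀ x, (𝓕⁻ φ) x = 𝓕 (φ : ℝ → ℂ) (-x) := fun x => by
    rw [SchwartzMap.fourierInv_coe, Real.fourierInv_eq_fourier_neg]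
  calc ∫ x, g x • (𝓕⁻ f : L2) x = ∫ x, φ x • (𝓕⁻ f : L2) x := by
        simp only [e1, Complex.real_smul, smul_eq_mul]
    _ = ∫ x, (𝓕⁻ φ) x • f x := h1.symm
    _ = ∫ x, 𝓕 (φ : ℝ → ℂ) (-x) * f x := by simp only [h3, smul_eq_mul]
    _ = ∫ x, 𝓕 (φ : ℝ → ℂ) x * f (-x) := by
        rw [← integral_neg_eq_self (fun x => 𝓕 (φ : ℝ → ℂ) x * f (-x))]
        simp
    _ = ∫ x, φ x * 𝓕 (fun y => f (-y)) x := integral_fourier_mul_eq φ.integrable hf.comp_neg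
    _ = ∫ x, g x • 𝓕⁻ (f : ℝ → ℂ) x := by simp only [e1, h2, Complex.real_smul]

theorem dense_integrable_L2 : Dense {f : L2 | Integrable f} := by
  have h := SchwartzMap.denseRange_toLpCLM (E := ℝ) (F := ℂ) (p := 2) (μ := (volume : Measure ℝ))
    ENNReal.ofNat_ne_top
  refine h.mono ?_
  rintro _ ⟨φ, rfl⟩
  exact φ.integrable.congr (φ.coeFn_toLp 2 volume).symm

theorem integrable_phase_mul (p : C(ℝ, ℝ)) {f : ℝ → ℂ} (hf : Integrable f) :
    Integrable (fun x => phase p x * f x) :=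
  memLp_one_iff_integrable.mp (memLp_phase_mul p (memLp_one_iff_integrable.mpr hf))

/-- The identity function `x ↦ x`. -/
def idMap : C(ℝ, ℝ) := ContinuousMap.id ℝ

@[simp] theorem idMap_apply (x : ℝ) : idMap x = x := rfl

theorem fourierChar_eq_phase (x y : ℝ) :
    (Real.fourierChar (x * y) : ℂ) = phase ((2 * Real.pi * x) • idMap) y := by
  simp only [Real.fourierChar_apply, phase, ContinuousMap.smul_apply, smul_eq_mul, idMap_apply]
  congr 1
  push_cast
  ring

/-- Both sides are continuous in f for the L² norm, so it is enough to treat integrable f, where the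
transform is an actual integral. The same density argument gives `fourier_phaseMul`. -/
theorem fourier_shift (a : ℝ) (f : L2) :
    (𝓕 (shift a f) : L2) = phaseMul ((2 * Real.pi * a) • idMap) (𝓕 f) := by
  have hd := dense_integrable_L2
  have h := Continuous.ext_on (f := fun f : L2 => (𝓕 (shift a f) : L2))
    (g := fun f : L2 => phaseMul ((2 * Real.pi * a) • idMap) (𝓕 f : L2)) hd
    ((Lp.fourierTransformₗᵢ ℝ ℂ).continuous.comp (continuous_shift a))
    ((phaseMul _).continuous.comp (Lp.fourierTransformₗᵢ ℝ ℂ).continuous) (fun f hf => ?_)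
  · exact congrFun h f
  · have hf' : Integrable f := hf
    have hs : Integrable (shift a f) := by
      refine Integrable.congr ?_ (coeFn_shift a f).symm
      exact hf'.comp_add_right a
    refine Lp.ext ?_
    filter_upwards [coeFn_fourier_of_integrable _ hs, coeFn_fourier_of_integrable _ hf',
      coeFn_phaseMul ((2 * Real.pi * a) • idMap) (𝓕 f : L2)] with ξ h1 h2 h3
    rw [h1, h3, h2, Real.fourier_congr_ae (coeFn_shift a f)]
    have := congrFun (VectorFourier.fourierIntegral_comp_add_right Real.fourierChar
      (volume : Measure ℝ) (innerₗ ℝ) (f : ℝ → ℂ) a) ξ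
    rw [← fourierChar_eq_phase]
    have e : (innerₗ ℝ a) ξ = a * ξ := by simp [mul_comm]
    rw [e, Circle.smul_def, smul_eq_mul] at this
    exact this

theorem fourier_phaseMul (a : ℝ) (f : L2) :
    (𝓕 (phaseMul ((2 * Real.pi * a) • idMap) f) : L2) = shift (-a) (𝓕 f) := by
  have hd := dense_integrable_L2
  have h := Continuous.ext_on
    (f := fun f : L2 => (𝓕 (phaseMul ((2 * Real.pi * a) • idMap) f) : L2))
    (g := fun f : L2 => shift (-a) (𝓕 f : L2)) hd
    ((Lp.fourierTransformₗᵢ ℝ ℂ).continuous.comp (phaseMul _).continuous)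
    ((continuous_shift (-a)).comp (Lp.fourierTransformₗᵢ ℝ ℂ).continuous) (fun f hf => ?_)
  · exact congrFun h f
  · have hf' : Integrable f := hf
    have hs : Integrable (phaseMul ((2 * Real.pi * a) • idMap) f) :=
      (integrable_phase_mul _ hf').congr (coeFn_phaseMul _ f).symm
    refine Lp.ext ?_
    filter_upwards [coeFn_fourier_of_integrable _ hs,
      ae_shift (coeFn_fourier_of_integrable _ hf') (-a), coeFn_shift (-a) (𝓕 f : L2)] with ξ h1 h2 h3
    rw [h1, h3, h2, Real.fourier_congr_ae (coeFn_phaseMul _ f), Real.fourier_real_eq,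
      Real.fourier_real_eq]
    refine integral_congr_ae (Eventually.of_forall fun x => ?_)
    simp only [Circle.smul_def, smul_eq_mul]
    rw [← fourierChar_eq_phase, ← mul_assoc, ← Circle.coe_mul, ← AddChar.map_add_eq_mul]
    congr 3
    ring

theorem fourierInv_shift (a : ℝ) (f : L2) :
    (𝓕⁻ (shift (-a) f) : L2) = phaseMul ((2 * Real.pi * a) • idMap) (𝓕⁻ f) := by
  have h := fourier_phaseMul a (𝓕⁻ f)
  rw [FourierTransform.fourier_fourierInv_eq] at h
  rw [← h, FourierTransform.fourierInv_fourier_eq]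

theorem fourierInv_phaseMul (a : ℝ) (f : L2) :
    (𝓕⁻ (phaseMul ((2 * Real.pi * a) • idMap) f) : L2) = shift a (𝓕⁻ f) := by
  have h := fourier_shift a (𝓕⁻ f)
  rw [FourierTransform.fourier_fourierInv_eq] at h
  rw [← h, FourierTransform.fourierInv_fourier_eq]

/-! ### The propagator -/

/-- The symbol `-(2πξ)²` of the Laplacian. -/
def lapSymbol : C(ℝ, ℝ) := ⟨fun ξ => -(2 * Real.pi * ξ) ^ 2, by fun_prop⟩

@[simp] theorem lapSymbol_apply (ξ : ℝ) : lapSymbol ξ = -(2 * Real.pi * ξ) ^ 2 := rfl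

theorem propagator_eq (t : ℝ) (v : L2) :
    propagator t v = 𝓕⁻ (phaseMul (t • lapSymbol) (𝓕 v) : L2) := by
  unfold propagator
  congr 1
  refine MemLp.toLp_congr _ (memLp_phase_mul _ (Lp.memLp _)) (Eventually.of_forall fun ξ => ?_)
  simp only [phase, ContinuousMap.smul_apply, lapSymbol_apply, smul_eq_mul]
  congr 2
  push_cast
  ring

/-- The free propagator as a linear isometry. -/
def prop (t : ℝ) : L2 →ₗᵢ[ℂ] L2 :=
  ((Lp.fourierTransformₗᵢ ℝ ℂ).symm.toLinearIsometry.comp (phaseMul (t • lapSymbol))).comp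
    (Lp.fourierTransformₗᵢ ℝ ℂ).toLinearIsometry

theorem prop_apply (t : ℝ) (v : L2) : prop t v = 𝓕⁻ (phaseMul (t • lapSymbol) (𝓕 v) : L2) := rfl

theorem propagator_eq_prop (t : ℝ) (v : L2) : propagator t v = prop t v := propagator_eq t v

theorem fourier_prop (t : ℝ) (v : L2) : (𝓕 (prop t v) : L2) = phaseMul (t • lapSymbol) (𝓕 v) := by
  rw [prop_apply, FourierTransform.fourier_fourierInv_eq]

theorem prop_add (s t : ℝ) (v : L2) : prop (s + t) v = prop s (prop t v) := by
  rw [prop_apply, prop_apply s, fourier_prop, add_smul, phaseMul_add]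

@[simp] theorem prop_zero (v : L2) : prop 0 v = v := by
  rw [prop_apply, phaseMul_zero_smul, FourierTransform.fourierInv_fourier_eq]

@[simp] theorem prop_neg_prop (t : ℝ) (v : L2) : prop (-t) (prop t v) = v := by
  rw [← prop_add]; simp

@[simp] theorem prop_prop_neg (t : ℝ) (v : L2) : prop t (prop (-t) v) = v := by
  rw [← prop_add]; simp

theorem continuous_prop_uncurry : Continuous fun z : ℝ × L2 => prop z.1 z.2 := by
  have h := continuous_phaseMul_uncurry (q := 2) (by norm_num) lapSymbol
  exact (Lp.fourierTransformₗᵢ ℝ ℂ).symm.continuous.comp (h.comp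
    (continuous_fst.prodMk ((Lp.fourierTransformₗᵢ ℝ ℂ).continuous.comp continuous_snd)))

theorem prop_shift (r a : ℝ) (f : L2) : prop r (shift a f) = shift a (prop r f) := by
  rw [prop_apply, fourier_shift, phaseMul_comm, fourierInv_phaseMul, ← prop_apply]

/-- The propagator intertwines boosts and Galilean transformations. -/
theorem prop_phaseMul (r a : ℝ) (f : L2) :
    prop r (phaseMul ((2 * Real.pi * a) • idMap) f)
      = phaseMul ((2 * Real.pi * a) • idMap + ContinuousMap.const ℝ (-(r * (2 * Real.pi * a) ^ 2)))
          (shift (-(4 * Real.pi * r * a)) (prop r f)) := by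
  -- The quadratic symbol is expanded about the shifted frequency ξ - a. The constant term becomes a
  -- phase, and the linear term becomes a translation by -4πra after inversion.
  have key : r • lapSymbol
      = ((ContinuousMap.const ℝ (-(r * (2 * Real.pi * a) ^ 2))
        + (2 * Real.pi * (-(4 * Real.pi * r * a))) • idMap + r • lapSymbol : C(ℝ, ℝ)).comp
          (ContinuousMap.id ℝ + ContinuousMap.const ℝ (-a))) := by
    ext ξ
    simp
    ring
  have hconst : ∀ (c : ℝ) (g : L2), (𝓕⁻ (phaseMul (ContinuousMap.const ℝ c) g) : L2)
      = phaseMul (ContinuousMap.const ℝ c) (𝓕⁻ g) := by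
    intro c g
    have e : ∀ g : L2, phaseMul (ContinuousMap.const ℝ c) g = Complex.exp (c * Complex.I) • g := by
      intro g
      refine Lp.ext ?_
      filter_upwards [coeFn_phaseMul (ContinuousMap.const ℝ c) g,
        Lp.coeFn_smul (Complex.exp (c * Complex.I)) g] with x h1 h2
      rw [h1, h2]
      simp [phase]
    rw [e, e]
    exact (Lp.fourierTransformₗᵢ ℝ ℂ).symm.map_smul _ _
  rw [prop_apply, fourier_phaseMul]
  nth_rewrite 1 [key]
  rw [phaseMul_shift, phaseMul_add, phaseMul_add, fourierInv_shift, hconst, fourierInv_phaseMul,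
    ← prop_apply, ← phaseMul_add]

end DMNLS

namespace DMNLS

open Filter Topology
open scoped BoundedContinuousFunction

/-! ### The Banach space `H^{1,1}` -/

/-- `ψ = i x φ`. -/
def IsMul (φ ψ : L2) : Prop := ψ =ᵐ[volume] fun x => Complex.I * x * φ x

theorem IsMul.hasDerivAt {φ ψ : L2} (h : IsMul φ ψ) :
    HasDerivAt (fun t : ℝ => phaseMul (t • idMap) φ) ψ 0 :=
  hasDerivAt_phaseMul (by norm_num) idMap h

theorem isMul_of_hasDerivAt {φ ψ : L2}
    (h : HasDerivAt (fun t : ℝ => phaseMul (t • idMap) φ) ψ 0) : IsMul φ ψ :=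
  ae_eq_of_hasDerivAt_phaseMul idMap h

theorem IsMul.add {φ ψ φ' ψ' : L2} (h : IsMul φ ψ) (h' : IsMul φ' ψ') :
    IsMul (φ + φ') (ψ + ψ') := by
  filter_upwards [h, h', Lp.coeFn_add φ φ', Lp.coeFn_add ψ ψ'] with x h1 h2 h3 h4
  rw [h4, h3, Pi.add_apply, Pi.add_apply, h1, h2]; ring

theorem IsMul.smul {φ ψ : L2} (c : ℂ) (h : IsMul φ ψ) : IsMul (c • φ) (c • ψ) := by
  filter_upwards [h, Lp.coeFn_smul c φ, Lp.coeFn_smul c ψ] with x h1 h2 h3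
  rw [h3, h2, Pi.smul_apply, Pi.smul_apply, h1]; simp only [smul_eq_mul]; ring

theorem isMul_zero : IsMul 0 0 := by
  filter_upwards [Lp.coeFn_zero ℂ 2 (volume : Measure ℝ)] with x h1
  rw [h1]; simp

/-- L² convergence gives almost everywhere convergence along a subsequence, taken here for both
components in turn. This closedness makes `H11` complete. -/
theorem isClosed_isMul : IsClosed {z : L2 × L2 | IsMul z.1 z.2} := by
  refine IsSeqClosed.isClosed fun z w hz hw => ?_
  have h1 : Tendsto (fun n => (z n).1) atTop (𝓝 w.1) := (continuous_fst.tendsto w).comp hw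
  have h2 : Tendsto (fun n => (z n).2) atTop (𝓝 w.2) := (continuous_snd.tendsto w).comp hw
  obtain ⟨ns, hns, h3⟩ := (tendstoInMeasure_of_tendsto_Lp h1).exists_seq_tendsto_ae
  obtain ⟨ms, hms, h4⟩ := (tendstoInMeasure_of_tendsto_Lp
    (h2.comp hns.tendsto_atTop)).exists_seq_tendsto_ae
  have h5 : ∀ᵐ x, ∀ n, (z n).2 x = Complex.I * x * (z n).1 x := ae_all_iff.mpr hz
  show w.2 =ᵐ[volume] fun x => Complex.I * x * w.1 x
  filter_upwards [h3, h4, h5] with x h3 h4 h5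
  refine tendsto_nhds_unique h4 ?_
  refine ((h3.comp hms.tendsto_atTop).const_mul (Complex.I * x)).congr fun n => ?_
  simp [h5]

/-- The space `H^{1,1}`, as the space of triples `(f, (2π)⁻¹ ∂ₓ f, i x f)` in `L²`. -/
def H11 : Submodule ℂ (L2 × L2 × L2) where
  carrier := {z | IsMul (𝓕 z.1) (𝓕 z.2.1) ∧ IsMul z.1 z.2.2}
  zero_mem' := by
    refine ⟨?_, isMul_zero⟩
    have : (𝓕 (0 : L2) : L2) = 0 := (Lp.fourierTransformₗᵢ ℝ ℂ).map_zero
    simpa only [Prod.fst_zero, Prod.snd_zero, this] using isMul_zero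
  add_mem' := by
    rintro a b ⟨h1, h2⟩ ⟨h3, h4⟩
    refine ⟨?_, h2.add h4⟩
    simpa only [Prod.fst_add, Prod.snd_add, FourierTransform.fourier_add] using h1.add h3
  smul_mem' := by
    rintro c a ⟨h1, h2⟩
    refine ⟨?_, h2.smul c⟩
    simpa only [Prod.smul_fst, Prod.smul_snd, FourierTransform.fourier_smul] using h1.smul c

theorem isClosed_H11 : IsClosed (H11 : Set (L2 × L2 × L2)) := by
  have hF : Continuous (fun v : L2 => (𝓕 v : L2)) := (Lp.fourierTransformₗᵢ ℝ ℂ).continuous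
  have h1 : Continuous fun z : L2 × L2 × L2 => ((𝓕 z.1 : L2), (𝓕 z.2.1 : L2)) :=
    (hF.comp continuous_fst).prodMk (hF.comp (continuous_fst.comp continuous_snd))
  have h2 : Continuous fun z : L2 × L2 × L2 => (z.1, z.2.2) := by fun_prop
  exact (isClosed_isMul.preimage h1).inter (isClosed_isMul.preimage h2)

instance : CompleteSpace H11 := isClosed_H11.completeSpace_coe

namespace H11

/-- The underlying function of an element of `H^{1,1}`. -/
def fn : H11 →L[ℂ] L2 := (ContinuousLinearMap.fst ℂ L2 (L2 × L2)).comp H11.subtypeL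

/-- The derivative (up to the factor `2π`). -/
def dx : H11 →L[ℂ] L2 :=
  ((ContinuousLinearMap.fst ℂ L2 L2).comp (ContinuousLinearMap.snd ℂ L2 (L2 × L2))).comp
    H11.subtypeL

/-- The function `i x f`. -/
def mx : H11 →L[ℂ] L2 :=
  ((ContinuousLinearMap.snd ℂ L2 L2).comp (ContinuousLinearMap.snd ℂ L2 (L2 × L2))).comp
    H11.subtypeL

theorem isMul_fourier (f : H11) : IsMul (𝓕 (fn f)) (𝓕 (dx f)) := f.2.1

theorem isMul_mx (f : H11) : IsMul (fn f) (mx f) := f.2.2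

theorem norm_fn_le (f : H11) : ‖fn f‖ ≤ ‖f‖ := norm_fst_le (f : L2 × L2 × L2)

theorem norm_dx_le (f : H11) : ‖dx f‖ ≤ ‖f‖ :=
  (norm_fst_le (f : L2 × L2 × L2).2).trans (norm_snd_le (f : L2 × L2 × L2))

theorem norm_mx_le (f : H11) : ‖mx f‖ ≤ ‖f‖ :=
  (norm_snd_le (f : L2 × L2 × L2).2).trans (norm_snd_le (f : L2 × L2 × L2))

theorem norm_le {f : H11} {C : ℝ} (h1 : ‖fn f‖ ≤ C) (h2 : ‖dx f‖ ≤ C) (h3 : ‖mx f‖ ≤ C) :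
    ‖f‖ ≤ C :=
  norm_prod_le_iff.mpr ⟨h1, norm_prod_le_iff.mpr ⟨h2, h3⟩⟩

/-- Constructor for elements of `H^{1,1}`. -/
def mk (f g h : L2) (h1 : IsMul (𝓕 f) (𝓕 g)) (h2 : IsMul f h) : H11 := ⟨(f, g, h), h1, h2⟩

/-- The derivative and the weighted function are determined by the function itself, so identities in
`H11` may be checked in L². -/
theorem ext_fn {a b : H11} (hab : fn a = fn b) : a = b := by
  have h1 : mx a = mx b := by
    refine Lp.ext ?_
    filter_upwards [isMul_mx a, isMul_mx b] with x h1 h2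
    rw [h1, h2, hab]
  have h2 : dx a = dx b := by
    have : (𝓕 (dx a) : L2) = 𝓕 (dx b) := by
      refine Lp.ext ?_
      filter_upwards [isMul_fourier a, isMul_fourier b] with x h1 h2
      rw [h1, h2, hab]
    exact (Lp.fourierTransformₗᵢ ℝ ℂ).injective this
  exact Subtype.ext (Prod.ext hab (Prod.ext h2 h1))

theorem continuous_mk {T : Type*} [TopologicalSpace T] {F : T → H11}
    (h1 : Continuous fun t => fn (F t)) (h2 : Continuous fun t => dx (F t))
    (h3 : Continuous fun t => mx (F t)) : Continuous F :=
  Continuous.subtype_mk (h1.prodMk (h2.prodMk h3)) fun t => (F t).2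

end H11

/-! ### Embeddings into `L¹` -/

theorem one_add_I_mul_ne_zero (x : ℝ) : (1 + Complex.I * x : ℂ) ≠ 0 := by
  intro h
  have := congrArg Complex.re h
  simp at this

theorem norm_one_add_I_mul_sq (x : ℝ) : ‖(1 + Complex.I * x : ℂ)‖ ^ 2 = 1 + x ^ 2 := by
  rw [Complex.sq_norm, Complex.normSq_apply]
  simp
  ring

theorem continuous_weight : Continuous fun x : ℝ => (1 + Complex.I * x : ℂ)⁻¹ :=
  Continuous.inv₀ (by fun_prop) one_add_I_mul_ne_zero

/-- The square is at most (1 + x²)^{-3/4}, which is integrable since 3/2 > 1. The quarter power is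
what a factor |sx²|^{1/8} costs in `norm_chirp_sub_le`. -/
theorem memLp_rpow_mul_weight :
    MemLp (fun x : ℝ => ((|x| ^ (1 / 4 : ℝ) : ℝ) : ℂ) * (1 + Complex.I * x : ℂ)⁻¹) 2 volume := by
  have hm : Continuous fun x : ℝ => ((|x| ^ (1 / 4 : ℝ) : ℝ) : ℂ) * (1 + Complex.I * x : ℂ)⁻¹ := by
    refine (Complex.continuous_ofReal.comp ?_).mul continuous_weight
    exact continuous_abs.rpow_const fun x => Or.inr (by norm_num)
  rw [memLp_two_iff_integrable_sq_norm hm.aestronglyMeasurable]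
  have hi := integrable_rpow_neg_one_add_norm_sq (E := ℝ) (μ := volume) (r := 3 / 2)
    (by simp; norm_num)
  refine hi.mono' (by fun_prop) (Eventually.of_forall fun x => ?_)
  have hpos : 0 < 1 + x ^ 2 := by positivity
  have e1 : ‖x‖ ^ 2 = x ^ 2 := by simp
  rw [norm_mul, mul_pow, norm_inv, inv_pow, norm_one_add_I_mul_sq, Complex.norm_real,
    Real.norm_eq_abs, Real.norm_eq_abs, e1, abs_of_nonneg (by positivity),
    abs_of_nonneg (by positivity)]
  have e2 : (|x| ^ (1 / 4 : ℝ)) ^ 2 = (x ^ 2) ^ (1 / 4 : ℝ) := by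
    rw [← sq_abs x, Real.rpow_pow_comm (abs_nonneg x)]
  rw [e2, show (-(3 / 2) / 2 : ℝ) = 1 / 4 + -1 by norm_num, Real.rpow_add hpos,
    Real.rpow_neg_one]
  gcongr
  linarith

theorem memLp_weight : MemLp (fun x : ℝ => (1 + Complex.I * x : ℂ)⁻¹) 2 volume := by
  rw [memLp_two_iff_integrable_sq_norm continuous_weight.aestronglyMeasurable]
  refine integrable_inv_one_add_sq.congr (Eventually.of_forall fun x => ?_)
  simp only [norm_inv, inv_pow, norm_one_add_I_mul_sq]

/-- The function `(1 + i x)⁻¹` in `L²`. -/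
def weight : L2 := memLp_weight.toLp _

/-- The function `|x|^{1/4} (1 + i x)⁻¹` in `L²`. -/
def rpowWeight : L2 := memLp_rpow_mul_weight.toLp _

/-- The product of two `L²` functions, in `L¹`. -/
def mulL1 : L2 →L[ℂ] L2 →L[ℂ] Lp ℂ 1 (volume : Measure ℝ) :=
  (ContinuousLinearMap.mul ℂ ℂ).holderL volume 2 2 1

theorem coeFn_mulL1 (f g : L2) : mulL1 f g =ᵐ[volume] fun x => f x * g x :=
  (ContinuousLinearMap.mul ℂ ℂ).coeFn_holder f g

theorem norm_mulL1_le (f g : L2) : ‖mulL1 f g‖ ≤ ‖f‖ * ‖g‖ := by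
  refine ((ContinuousLinearMap.mul ℂ ℂ).norm_holder_apply_apply_le f g).trans ?_
  gcongr
  exact mul_le_of_le_one_left (norm_nonneg _) (ContinuousLinearMap.opNorm_mul_le ℂ ℂ)

/-- φ + ψ = (1 + ix)φ, so φ is the product of the two L² functions (1 + ix)⁻¹ and φ + ψ. On the
physical side this gives integrability of f, on the Fourier side integrability of its transform. -/
theorem IsMul.coeFn_mulL1_weight {φ ψ : L2} (h : IsMul φ ψ) :
    mulL1 weight (φ + ψ) =ᵐ[volume] φ := by
  filter_upwards [coeFn_mulL1 weight (φ + ψ), memLp_weight.coeFn_toLp, h, Lp.coeFn_add φ ψ]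
    with x h1 h2 h3 h4
  rw [h1, weight, h2, h4, Pi.add_apply, h3]
  field_simp [one_add_I_mul_ne_zero x]

namespace H11

/-- The embedding of `H^{1,1}` into `L¹`. -/
def posL1 : H11 →L[ℂ] Lp ℂ 1 (volume : Measure ℝ) := (mulL1 weight).comp (fn + mx)

/-- The Fourier transform `H^{1,1} → L¹`. -/
def freqL1 : H11 →L[ℂ] Lp ℂ 1 (volume : Measure ℝ) :=
  (mulL1 weight).comp (((Lp.fourierTransformₗᵢ ℝ ℂ).toContinuousLinearEquiv :
    L2 →L[ℂ] L2).comp (fn + dx))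

theorem freqL1_apply (f : H11) : freqL1 f = mulL1 weight (𝓕 (fn f) + 𝓕 (dx f)) := by
  rw [← FourierTransform.fourier_add]; rfl

theorem coeFn_posL1 (f : H11) : posL1 f =ᵐ[volume] fn f := (isMul_mx f).coeFn_mulL1_weight

theorem coeFn_freqL1 (f : H11) : freqL1 f =ᵐ[volume] (𝓕 (fn f) : L2) := by
  rw [freqL1_apply]
  exact (isMul_fourier f).coeFn_mulL1_weight

theorem integrable_fn (f : H11) : Integrable (fn f) :=
  (L1.integrable_coeFn (posL1 f)).congr (coeFn_posL1 f)

theorem integrable_fourier_fn (f : H11) : Integrable (𝓕 (fn f) : L2) :=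
  (L1.integrable_coeFn (freqL1 f)).congr (coeFn_freqL1 f)

theorem norm_posL1_le (f : H11) : ‖posL1 f‖ ≤ 2 * ‖weight‖ * ‖f‖ := by
  refine (norm_mulL1_le _ _).trans ?_
  have : ‖fn f + mx f‖ ≤ 2 * ‖f‖ := by
    refine (norm_add_le _ _).trans ?_
    linarith [norm_fn_le f, norm_mx_le f]
  calc ‖weight‖ * ‖fn f + mx f‖ ≤ ‖weight‖ * (2 * ‖f‖) := by gcongr
    _ = _ := by ring

theorem norm_freqL1_le (f : H11) : ‖freqL1 f‖ ≤ 2 * ‖weight‖ * ‖f‖ := by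
  rw [freqL1_apply]
  refine (norm_mulL1_le _ _).trans ?_
  have : ‖(𝓕 (fn f) + 𝓕 (dx f) : L2)‖ ≤ 2 * ‖f‖ := by
    refine (norm_add_le _ _).trans ?_
    rw [Lp.norm_fourier_eq, Lp.norm_fourier_eq]
    linarith [norm_fn_le f, norm_dx_le f]
  calc ‖weight‖ * ‖(𝓕 (fn f) + 𝓕 (dx f) : L2)‖ ≤ ‖weight‖ * (2 * ‖f‖) := by gcongr
    _ = _ := by ring

/-- The bounded continuous representative of `e^{irΔ} f`. -/
def evol (r : ℝ) : H11 →L[ℂ] (ℝ →ᵇ ℂ) :=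
  (Real.Lp.fourierTransformInvCLM ℝ ℂ).comp
    ((phaseMul (r • lapSymbol)).toContinuousLinearMap.comp freqL1)

/-- The function `x ↦ x²`. -/
def sqMap : C(ℝ, ℝ) := ⟨fun x => x ^ 2, by fun_prop⟩

@[simp] theorem sqMap_apply (x : ℝ) : sqMap x = x ^ 2 := rfl

/-- The Fourier transform of `e^{isx²} f`, as a bounded continuous function. -/
def chirp (s : ℝ) : H11 →L[ℂ] (ℝ →ᵇ ℂ) :=
  (Real.Lp.fourierTransformCLM ℝ ℂ).comp
    ((phaseMul (s • sqMap)).toContinuousLinearMap.comp posL1)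

theorem norm_fourierTransform_le (u : Lp ℂ 1 (volume : Measure ℝ)) :
    ‖Real.Lp.fourierTransformCLM ℝ ℂ u‖ ≤ ‖u‖ := by
  refine (BoundedContinuousFunction.norm_le (norm_nonneg _)).mpr fun x => ?_
  rw [Real.Lp.fourierTransformCLM_apply, Real.Lp.fourierTransform_apply, Real.fourier_eq]
  refine (norm_integral_le_integral_norm _).trans ?_
  simp_rw [Circle.norm_smul]
  exact (L1.norm_eq_integral_norm u).symm.le

theorem norm_fourierTransformInv_le (u : Lp ℂ 1 (volume : Measure ℝ)) :
    ‖Real.Lp.fourierTransformInvCLM ℝ ℂ u‖ ≤ ‖u‖ := by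
  refine (BoundedContinuousFunction.norm_le (norm_nonneg _)).mpr fun x => ?_
  rw [Real.Lp.fourierTransformInvCLM_apply, Real.Lp.fourierTransformInv_apply, Real.fourierInv_eq]
  refine (norm_integral_le_integral_norm _).trans ?_
  simp_rw [Circle.norm_smul]
  exact (L1.norm_eq_integral_norm u).symm.le

theorem norm_evol_le (r : ℝ) (f : H11) : ‖evol r f‖ ≤ 2 * ‖weight‖ * ‖f‖ :=
  (norm_fourierTransformInv_le _).trans
    (((phaseMul (r • lapSymbol)).norm_map _).le.trans (norm_freqL1_le f))

theorem norm_chirp_le (s : ℝ) (f : H11) : ‖chirp s f‖ ≤ 2 * ‖weight‖ * ‖f‖ :=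
  (norm_fourierTransform_le _).trans
    (((phaseMul (s • sqMap)).norm_map _).le.trans (norm_posL1_le f))

theorem continuous_evol_uncurry : Continuous fun z : ℝ × H11 => evol z.1 z.2 := by
  have h1 : Continuous fun z : ℝ × H11 => (z.1, freqL1 z.2) :=
    continuous_fst.prodMk (freqL1.continuous.comp continuous_snd)
  have h3 := continuous_phaseMul_uncurry (q := 1) (by norm_num) lapSymbol
  have h2 : Continuous ((fun z : ℝ × Lp ℂ 1 (volume : Measure ℝ) =>
      phaseMul (z.1 • lapSymbol) z.2) ∘ fun z : ℝ × H11 => (z.1, freqL1 z.2)) := h3.comp h1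
  exact (Real.Lp.fourierTransformInvCLM ℝ ℂ).continuous.comp h2

theorem coeFn_phaseMul_freqL1 (r : ℝ) (f : H11) :
    phaseMul (r • lapSymbol) (freqL1 f) =ᵐ[volume]
      (phaseMul (r • lapSymbol) (𝓕 (fn f)) : L2) := by
  filter_upwards [coeFn_phaseMul (r • lapSymbol) (freqL1 f), coeFn_freqL1 f,
    coeFn_phaseMul (r • lapSymbol) (𝓕 (fn f) : L2)] with x h1 h2 h3
  rw [h1, h2, h3]

theorem coeFn_evol (r : ℝ) (f : H11) : evol r f =ᵐ[volume] prop r (fn f) := by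
  have hi : Integrable (phaseMul (r • lapSymbol) (𝓕 (fn f)) : L2) :=
    (L1.integrable_coeFn (phaseMul (r • lapSymbol) (freqL1 f))).congr (coeFn_phaseMul_freqL1 r f)
  rw [prop_apply]
  filter_upwards [coeFn_fourierInv_of_integrable _ hi] with x hx
  rw [hx]
  show Real.Lp.fourierTransformInvCLM ℝ ℂ (phaseMul (r • lapSymbol) (freqL1 f)) x = _
  rw [Real.Lp.fourierTransformInvCLM_apply, Real.Lp.fourierTransformInv_apply]
  exact Real.fourierInv_congr_ae (coeFn_phaseMul_freqL1 r f) x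

theorem chirp_apply (s : ℝ) (f : H11) (ξ : ℝ) :
    chirp s f ξ = 𝓕 (fun x => phase (s • sqMap) x * fn f x) ξ := by
  show Real.Lp.fourierTransformCLM ℝ ℂ (phaseMul (s • sqMap) (posL1 f)) ξ = _
  rw [Real.Lp.fourierTransformCLM_apply, Real.Lp.fourierTransform_apply]
  refine Real.fourier_congr_ae ?_ ξ
  filter_upwards [coeFn_phaseMul (s • sqMap) (posL1 f), coeFn_posL1 f] with x h1 h2
  rw [h1, h2]

theorem evol_apply (r : ℝ) (f : H11) (x : ℝ) :
    evol r f x = 𝓕⁻ (fun ξ => phase (r • lapSymbol) ξ * 𝓕 (fn f : ℝ → ℂ) ξ) x := by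
  show Real.Lp.fourierTransformInvCLM ℝ ℂ (phaseMul (r • lapSymbol) (freqL1 f)) x = _
  rw [Real.Lp.fourierTransformInvCLM_apply, Real.Lp.fourierTransformInv_apply]
  refine Real.fourierInv_congr_ae ?_ x
  filter_upwards [coeFn_phaseMul (r • lapSymbol) (freqL1 f), coeFn_freqL1 f,
    coeFn_fourier_of_integrable _ (integrable_fn f)] with x h1 h2 h3
  rw [h1, h2, h3]

/-- Interpolates between the bound |θ| for small angles and the bound 2 for large ones. -/
theorem norm_exp_sub_one_le_rpow (θ : ℝ) :
    ‖Complex.exp (θ * Complex.I) - 1‖ ≤ 2 * |θ| ^ (1 / 8 : ℝ) := by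
  rcases le_total |θ| 1 with h | h
  · have h1 := Real.norm_exp_I_mul_ofReal_sub_one_le (x := θ)
    rw [mul_comm] at h1
    refine h1.trans ?_
    rw [Real.norm_eq_abs]
    have : |θ| ^ (1 : ℝ) ≤ |θ| ^ (1 / 8 : ℝ) :=
      Real.rpow_le_rpow_of_exponent_ge' (abs_nonneg _) h (by norm_num) (by norm_num)
    rw [Real.rpow_one] at this
    linarith [Real.rpow_nonneg (abs_nonneg θ) (1 / 8)]
  · refine (norm_sub_le _ _).trans ?_
    rw [Complex.norm_exp_ofReal_mul_I, norm_one]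
    linarith [Real.one_le_rpow h (show (0 : ℝ) ≤ 1 / 8 by norm_num)]

/-- The weighted L² bound on xf leaves room for |x|^{1/4} f in L¹, and |e^{isx²} - 1| ≤
2|s|^{1/8}|x|^{1/4} spends it. With s = 1/(4r), this is the only error made in passing from the
exact chirped picture to the Fourier transform. -/
theorem norm_chirp_sub_le (s : ℝ) (f : H11) :
    ‖chirp s f - chirp 0 f‖ ≤ 4 * ‖rpowWeight‖ * |s| ^ (1 / 8 : ℝ) * ‖f‖ := by
  have h0 : chirp s f - chirp 0 f
      = Real.Lp.fourierTransformCLM ℝ ℂ (phaseMul (s • sqMap) (posL1 f) - posL1 f) := by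
    rw [map_sub]
    congr 1
    show Real.Lp.fourierTransformCLM ℝ ℂ (phaseMul ((0 : ℝ) • sqMap) (posL1 f)) = _
    rw [phaseMul_zero_smul]
  rw [h0]
  refine (norm_fourierTransform_le _).trans ?_
  have h1 : ‖phaseMul (s • sqMap) (posL1 f) - posL1 f‖
      ≤ (2 * |s| ^ (1 / 8 : ℝ)) * ‖mulL1 rpowWeight (fn f + mx f)‖ := by
    refine Lp.norm_le_mul_norm_of_ae_le_mul ?_
    filter_upwards [Lp.coeFn_sub (phaseMul (s • sqMap) (posL1 f)) (posL1 f),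
      coeFn_phaseMul (s • sqMap) (posL1 f), coeFn_mulL1 weight (fn f + mx f),
      coeFn_mulL1 rpowWeight (fn f + mx f), memLp_weight.coeFn_toLp,
      memLp_rpow_mul_weight.coeFn_toLp] with x h1 h2 h3 h4 h5 h6
    have h3' : posL1 f x = (1 + Complex.I * x : ℂ)⁻¹ * (fn f + mx f) x := by
      have : posL1 f = mulL1 weight (fn f + mx f) := rfl
      rw [this, h3, weight, h5]
    rw [h1, Pi.sub_apply, h2, h3', h4, rpowWeight, h6, ← sub_one_mul, norm_mul, norm_mul, norm_mul,
      norm_mul, Complex.norm_real, Real.norm_eq_abs,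
      abs_of_nonneg (Real.rpow_nonneg (abs_nonneg x) _)]
    have h7 := norm_exp_sub_one_le_rpow (s * x ^ 2)
    have h8 : |s * x ^ 2| ^ (1 / 8 : ℝ) = |s| ^ (1 / 8 : ℝ) * |x| ^ (1 / 4 : ℝ) := by
      rw [abs_mul, Real.mul_rpow (abs_nonneg _) (abs_nonneg _), abs_pow, ← Real.rpow_natCast,
        ← Real.rpow_mul (abs_nonneg _)]
      norm_num
    rw [h8] at h7
    have h9 : ‖phase (s • sqMap) x - 1‖ ≤ 2 * (|s| ^ (1 / 8 : ℝ) * |x| ^ (1 / 4 : ℝ)) := by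
      simpa [phase] using h7
    calc ‖phase (s • sqMap) x - 1‖ * (‖(1 + Complex.I * x : ℂ)⁻¹‖ * ‖(fn f + mx f) x‖)
        ≤ (2 * (|s| ^ (1 / 8 : ℝ) * |x| ^ (1 / 4 : ℝ)))
          * (‖(1 + Complex.I * x : ℂ)⁻¹‖ * ‖(fn f + mx f) x‖) := by gcongr
      _ = _ := by ring
  have h2 : ‖fn f + mx f‖ ≤ 2 * ‖f‖ := by
    refine (norm_add_le _ _).trans ?_
    linarith [norm_fn_le f, norm_mx_le f]
  calc _ ≤ (2 * |s| ^ (1 / 8 : ℝ)) * (‖rpowWeight‖ * ‖fn f + mx f‖) := by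
        refine h1.trans ?_
        gcongr
        exact norm_mulL1_le _ _
    _ ≤ (2 * |s| ^ (1 / 8 : ℝ)) * (‖rpowWeight‖ * (2 * ‖f‖)) := by gcongr
    _ = _ := by ring

end H11
end DMNLS

namespace DMNLS

open Filter Topology
open scoped BoundedContinuousFunction

/-! ### The integral kernel of the propagator -/

/-- The amplitude `(4 π i r)^{-1/2}` of the Schrödinger kernel. -/
def amp (r : ℝ) : ℂ := (((4 * Real.pi * r : ℝ) : ℂ) * Complex.I) ^ (-(1 / 2) : ℂ)

theorem norm_amp_sq {r : ℝ} (hr : 0 < r) : ‖amp r‖ ^ 2 = (4 * Real.pi * r)⁻¹ := by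
  have hpos : 0 < 4 * Real.pi * r := by positivity
  have h0 : ((4 * Real.pi * r : ℝ) : ℂ) * Complex.I ≠ 0 := by
    simp [Complex.I_ne_zero, hr.ne', Real.pi_ne_zero]
  have : ‖amp r‖ = (4 * Real.pi * r) ^ (-(1 / 2) : ℝ) := by
    have h1 : (-(1 / 2) : ℂ) = ((-(1 / 2) : ℝ) : ℂ) := by push_cast; ring
    rw [amp, h1, Complex.norm_cpow_real, norm_mul, Complex.norm_I, mul_one, Complex.norm_real,
      Real.norm_eq_abs, abs_of_pos hpos]
  rw [this, ← Real.rpow_natCast, ← Real.rpow_mul hpos.le]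
  norm_num [Real.rpow_neg_one]

theorem norm_amp {r : ℝ} (hr : 0 < r) : ‖amp r‖ = (4 * Real.pi * r) ^ (-(1 / 2) : ℝ) := by
  have h1 : (-(1 / 2) : ℂ) = ((-(1 / 2) : ℝ) : ℂ) := by push_cast; ring
  rw [amp, h1, Complex.norm_cpow_real, norm_mul, Complex.norm_I, mul_one, Complex.norm_real,
    Real.norm_eq_abs, abs_of_pos (by positivity)]

/-- The regularisation `4π(δ + ir)` of the exponent `4πir`. -/
def regExp (r δ : ℝ) : ℂ := ((4 * Real.pi * δ : ℝ) : ℂ) + ((4 * Real.pi * r : ℝ) : ℂ) * Complex.I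

theorem regExp_re (r δ : ℝ) : (regExp r δ).re = 4 * Real.pi * δ := by simp [regExp]

theorem regExp_im (r δ : ℝ) : (regExp r δ).im = 4 * Real.pi * r := by simp [regExp]

theorem continuous_regExp (r : ℝ) : Continuous (regExp r) := by unfold regExp; fun_prop

theorem norm_exp_le_one {z : ℂ} (hz : z.re ≤ 0) : ‖Complex.exp z‖ ≤ 1 := by
  rw [Complex.norm_exp]; exact Real.exp_le_one_iff.mpr hz

/-- The multiplication formula moves the Fourier transform from f onto the Gaussian, where it is
explicit. -/
theorem integral_fourier_mul_gaussian {f : ℝ → ℂ} (hf : Integrable f) {b : ℂ} (hb : 0 < b.re)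
    (x : ℝ) :
    ∫ ξ : ℝ, 𝓕 f ξ * Complex.exp (-Real.pi * b * ξ ^ 2 + 2 * Real.pi * (Complex.I * x) * ξ)
      = 1 / b ^ (1 / 2 : ℂ) * ∫ y : ℝ, f y * Complex.exp (-Real.pi / b * (y - x) ^ 2) := by
  have hg : Integrable fun ξ : ℝ =>
      Complex.exp (-Real.pi * b * ξ ^ 2 + 2 * Real.pi * (Complex.I * x) * ξ) := by
    have := integrable_cexp_quadratic (b := Real.pi * b) (by
      simpa using mul_pos Real.pi_pos hb) (2 * Real.pi * (Complex.I * x)) 0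
    refine this.congr (Eventually.of_forall fun ξ => ?_)
    simp
  rw [integral_fourier_mul_eq hf hg, fourier_gaussian_pi' hb, ← integral_const_mul]
  refine integral_congr_ae (Eventually.of_forall fun y => ?_)
  simp only
  have : (y : ℂ) + Complex.I * (Complex.I * x) = y - x := by
    rw [← mul_assoc, Complex.I_mul_I]; ring
  rw [this]; ring

/-- The limit δ → 0⁺ of the Gaussian identity with b = 4π(δ + ir). Both exponents have nonpositive
real part, so |f̂| and |f| dominate, and r > 0 keeps 4πir in the slit plane, where the square root
is continuous. -/
theorem integral_fourier_mul_chirp {f : ℝ → ℂ} (hf : Integrable f) (hf' : Integrable (𝓕 f))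
    {r : ℝ} (hr : 0 < r) (x : ℝ) :
    ∫ ξ : ℝ, 𝓕 f ξ * Complex.exp (-Real.pi * regExp r 0 * ξ ^ 2
        + 2 * Real.pi * (Complex.I * x) * ξ)
      = 1 / regExp r 0 ^ (1 / 2 : ℂ)
        * ∫ y : ℝ, f y * Complex.exp (-Real.pi / regExp r 0 * (y - x) ^ 2) := by
  have hslit : regExp r 0 ∈ Complex.slitPlane := by
    refine Or.inr ?_
    rw [regExp_im]; positivity
  have hne : regExp r 0 ≠ 0 := Complex.slitPlane_ne_zero hslit
  have hc0 : Tendsto (regExp r) (𝓝[>] 0) (𝓝 (regExp r 0)) :=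
    ((continuous_regExp r).tendsto 0).mono_left nhdsWithin_le_nhds
  have hL : Tendsto (fun δ => ∫ ξ : ℝ, 𝓕 f ξ * Complex.exp (-Real.pi * regExp r δ * ξ ^ 2
        + 2 * Real.pi * (Complex.I * x) * ξ)) (𝓝[>] 0)
      (𝓝 (∫ ξ : ℝ, 𝓕 f ξ * Complex.exp (-Real.pi * regExp r 0 * ξ ^ 2
        + 2 * Real.pi * (Complex.I * x) * ξ))) := by
    refine tendsto_integral_filter_of_dominated_convergence (fun ξ => ‖𝓕 f ξ‖)
      (Eventually.of_forall fun δ => ?_) ?_ hf'.norm (Eventually.of_forall fun ξ => ?_)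
    · exact hf'.1.mul (Continuous.aestronglyMeasurable (by fun_prop))
    · filter_upwards [self_mem_nhdsWithin] with δ hδ
      refine Eventually.of_forall fun ξ => ?_
      rw [norm_mul]
      refine mul_le_of_le_one_right (norm_nonneg _) (norm_exp_le_one ?_)
      have e : (-Real.pi * regExp r δ * ξ ^ 2 + 2 * Real.pi * (Complex.I * x) * ξ : ℂ).re
          = -(4 * Real.pi ^ 2 * δ * ξ ^ 2) := by
        rw [regExp]
        simp only [pow_two, Complex.add_re, Complex.mul_re, Complex.neg_re, Complex.ofReal_re,
          Complex.neg_im, Complex.ofReal_im, Complex.I_re, Complex.I_im, Complex.add_im,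
          Complex.mul_im, Complex.re_ofNat, Complex.im_ofNat]
        ring
      rw [e, neg_nonpos]
      have : (0 : ℝ) < δ := hδ
      positivity
    · refine Tendsto.const_mul _ ?_
      refine (Complex.continuous_exp.tendsto _).comp ?_
      exact ((hc0.const_mul _).mul_const _).add_const _
  have hR : Tendsto (fun δ => 1 / regExp r δ ^ (1 / 2 : ℂ)
        * ∫ y : ℝ, f y * Complex.exp (-Real.pi / regExp r δ * (y - x) ^ 2)) (𝓝[>] 0)
      (𝓝 (1 / regExp r 0 ^ (1 / 2 : ℂ)
        * ∫ y : ℝ, f y * Complex.exp (-Real.pi / regExp r 0 * (y - x) ^ 2))) := by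
    refine Tendsto.mul ?_ ?_
    · refine Tendsto.div tendsto_const_nhds ?_ ?_
      · exact (continuousAt_cpow_const hslit).tendsto.comp hc0
      · simp [Complex.cpow_eq_zero_iff, hne]
    · refine tendsto_integral_filter_of_dominated_convergence (fun y => ‖f y‖)
        (Eventually.of_forall fun δ => ?_) ?_ hf.norm (Eventually.of_forall fun y => ?_)
      · exact hf.1.mul (Continuous.aestronglyMeasurable (by fun_prop))
      · filter_upwards [self_mem_nhdsWithin] with δ hδ
        refine Eventually.of_forall fun y => ?_
        rw [norm_mul]
        refine mul_le_of_le_one_right (norm_nonneg _) (norm_exp_le_one ?_)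
        have e : (-Real.pi / regExp r δ * (y - x) ^ 2 : ℂ).re
            = -(Real.pi * (y - x) ^ 2 * ((regExp r δ)⁻¹).re) := by
          have : (-Real.pi / regExp r δ * (y - x) ^ 2 : ℂ)
              = ((-(Real.pi * (y - x) ^ 2) : ℝ) : ℂ) * (regExp r δ)⁻¹ := by
            push_cast; ring
          rw [this, Complex.re_ofReal_mul]; ring
        rw [e, neg_nonpos, Complex.inv_re, regExp_re]
        have : (0 : ℝ) < δ := hδ
        have := Complex.normSq_nonneg (regExp r δ)
        positivity
      · refine Tendsto.const_mul _ ?_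
        refine (Complex.continuous_exp.tendsto _).comp ?_
        exact (Tendsto.div tendsto_const_nhds hc0 hne).mul_const _
  refine tendsto_nhds_unique hL (hR.congr' ?_)
  filter_upwards [self_mem_nhdsWithin] with δ hδ
  refine (integral_fourier_mul_gaussian hf ?_ x).symm
  rw [regExp_re]
  have : (0 : ℝ) < δ := hδ
  positivity

namespace H11

/-- The kernel representation of the propagator, `e^{irΔ} = M D 𝓕 M`. -/
theorem evol_eq_chirp {r : ℝ} (hr : 0 < r) (f : H11) (x : ℝ) :
    evol r f x = amp r * phase ((4 * r)⁻¹ • sqMap) x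
      * chirp (4 * r)⁻¹ f (x / (4 * Real.pi * r)) := by
  have hf := integrable_fn f
  have hf' : Integrable (𝓕 (fn f : ℝ → ℂ)) :=
    (integrable_fourier_fn f).congr (coeFn_fourier_of_integrable _ hf)
  have hreg : regExp r 0 = ((4 * Real.pi * r : ℝ) : ℂ) * Complex.I := by simp [regExp]
  have hpi : (Real.pi : ℂ) ≠ 0 := by exact_mod_cast Real.pi_ne_zero
  have hrc : (r : ℂ) ≠ 0 := by exact_mod_cast hr.ne'
  have h := integral_fourier_mul_chirp hf hf' hr x
  have hL : evol r f x = ∫ ξ : ℝ, 𝓕 (fn f : ℝ → ℂ) ξ * Complex.exp (-Real.pi * regExp r 0 * ξ ^ 2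
        + 2 * Real.pi * (Complex.I * x) * ξ) := by
    rw [evol_apply, Real.fourierInv_eq']
    refine integral_congr_ae (Eventually.of_forall fun ξ => ?_)
    simp only [phase, smul_eq_mul, ContinuousMap.smul_apply, lapSymbol_apply]
    rw [← mul_assoc, ← Complex.exp_add, mul_comm]
    congr 2
    rw [hreg]
    simp
    ring
  -- Expanding (y - x)² in the kernel, the two squares give the chirps in x and y, and the cross
  -- term is the Fourier character at frequency x/(4πr).
  have hR : ∀ y : ℝ, fn f y * Complex.exp (-Real.pi / regExp r 0 * (y - x) ^ 2)
      = phase ((4 * r)⁻¹ • sqMap) x * (Complex.exp (↑(-2 * Real.pi * y * (x / (4 * Real.pi * r)))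
        * Complex.I) * (phase ((4 * r)⁻¹ • sqMap) y * fn f y)) := by
    intro y
    simp only [phase, smul_eq_mul, ContinuousMap.smul_apply, sqMap_apply]
    rw [mul_comm (fn f y), ← mul_assoc, ← mul_assoc, ← Complex.exp_add, ← Complex.exp_add]
    congr 2
    rw [hreg]
    push_cast
    field_simp
    rw [Complex.I_sq]
    ring
  rw [hL, h, chirp_apply, Real.fourier_real_eq_integral_exp_smul]
  simp only [hR, smul_eq_mul]
  rw [integral_const_mul, hreg, amp, Complex.cpow_neg, one_div, ← mul_assoc]

theorem norm_evol_apply_le {r : ℝ} (hr : 0 < r) (f : H11) :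
    ‖evol r f‖ ≤ (4 * Real.pi * r) ^ (-(1 / 2) : ℝ) * ‖chirp (4 * r)⁻¹ f‖ := by
  refine (BoundedContinuousFunction.norm_le (by positivity)).mpr fun x => ?_
  rw [evol_eq_chirp hr, norm_mul, norm_mul, norm_amp hr, norm_phase, mul_one]
  gcongr
  exact BoundedContinuousFunction.norm_coe_le_norm _ _

end H11
end DMNLS

namespace DMNLS

open Filter Topology
open scoped BoundedContinuousFunction

/-! ### The cubic nonlinearity on `H^{1,1}` -/

theorem memLp_bdd_mul (b : ℝ →ᵇ ℂ) (c : L2) : MemLp (fun x => b x * c x) 2 volume := by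
  refine MemLp.of_le_mul (c := ‖b‖) (Lp.memLp c)
    (b.continuous.aestronglyMeasurable.mul (Lp.aestronglyMeasurable c))
    (Eventually.of_forall fun x => ?_)
  rw [norm_mul]
  gcongr
  exact b.norm_coe_le_norm x

/-- Multiplication of an `L²` function by a bounded continuous function. -/
def bmul : (ℝ →ᵇ ℂ) →L[ℂ] L2 →L[ℂ] L2 :=
  LinearMap.mkContinuous₂
    (LinearMap.mk₂ ℂ (fun b c => (memLp_bdd_mul b c).toLp _)
      (fun b b' c => by
        rw [← MemLp.toLp_add]
        refine MemLp.toLp_congr _ _ (Eventually.of_forall fun x => ?_)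
        simp [add_mul])
      (fun z b c => by
        rw [← MemLp.toLp_const_smul]
        refine MemLp.toLp_congr _ _ (Eventually.of_forall fun x => ?_)
        simp [mul_assoc])
      (fun b c c' => by
        rw [← MemLp.toLp_add]
        refine MemLp.toLp_congr _ _ ?_
        filter_upwards [Lp.coeFn_add c c'] with x hx
        rw [hx, Pi.add_apply, Pi.add_apply, mul_add])
      (fun z b c => by
        rw [← MemLp.toLp_const_smul]
        refine MemLp.toLp_congr _ _ ?_
        filter_upwards [Lp.coeFn_smul z c] with x hx
        rw [hx, Pi.smul_apply, Pi.smul_apply, smul_eq_mul, smul_eq_mul]; ring))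
    1 (fun b c => by
      rw [one_mul]
      refine Lp.norm_le_mul_norm_of_ae_le_mul ?_
      filter_upwards [(memLp_bdd_mul b c).coeFn_toLp] with x hx
      simp only [LinearMap.mk₂_apply]
      rw [hx, norm_mul]
      gcongr
      exact b.norm_coe_le_norm x)

theorem coeFn_bmul (b : ℝ →ᵇ ℂ) (c : L2) : bmul b c =ᵐ[volume] fun x => b x * c x :=
  (memLp_bdd_mul b c).coeFn_toLp

theorem norm_bmul_le (b : ℝ →ᵇ ℂ) (c : L2) : ‖bmul b c‖ ≤ ‖b‖ * ‖c‖ := by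
  refine Lp.norm_le_mul_norm_of_ae_le_mul ?_
  filter_upwards [coeFn_bmul b c] with x hx
  rw [hx, norm_mul]
  gcongr
  exact b.norm_coe_le_norm x

/-- Complex conjugation on `L²`. -/
def conjL : L2 →L[ℝ] L2 := (Complex.conjCLE : ℂ →L[ℝ] ℂ).compLpL 2 volume

theorem coeFn_conjL (c : L2) : conjL c =ᵐ[volume] fun x => star (c x) :=
  (Complex.conjCLE : ℂ →L[ℝ] ℂ).coeFn_compLpL c

theorem norm_conjL_le (c : L2) : ‖conjL c‖ ≤ ‖c‖ := by
  refine Lp.norm_le_norm_of_ae_le ?_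
  filter_upwards [coeFn_conjL c] with x hx
  rw [hx, norm_star]

/-- The derivative `2|E|² c + E² c̄` of the cubic nonlinearity. -/
def cubicDeriv (E : ℝ →ᵇ ℂ) (c : L2) : L2 :=
  (2 : ℂ) • bmul (E * star E) c + bmul (E * E) (conjL c)

theorem continuous_bmul_uncurry : Continuous fun z : (ℝ →ᵇ ℂ) × L2 => bmul z.1 z.2 :=
  bmul.continuous₂

theorem tendsto_bmul {T : Type*} {l : Filter T} {b : T → ℝ →ᵇ ℂ} {c : T → L2} {b₀ : ℝ →ᵇ ℂ}
    {c₀ : L2} (hb : Tendsto b l (𝓝 b₀)) (hc : Tendsto c l (𝓝 c₀)) :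
    Tendsto (fun t => bmul (b t) (c t)) l (𝓝 (bmul b₀ c₀)) := by
  have h1 : Tendsto (fun t => (b t, c t)) l (𝓝 (b₀, c₀)) := hb.prodMk_nhds hc
  have h2 : Tendsto (fun z : (ℝ →ᵇ ℂ) × L2 => bmul z.1 z.2) (𝓝 (b₀, c₀)) (𝓝 (bmul b₀ c₀)) :=
    continuous_bmul_uncurry.tendsto (b₀, c₀)
  have h3 := h2.comp h1
  simpa only [Function.comp_def] using h3

theorem continuous_cubicDeriv : Continuous fun z : (ℝ →ᵇ ℂ) × L2 => cubicDeriv z.1 z.2 := by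
  have h1 : Continuous fun z : (ℝ →ᵇ ℂ) × L2 => bmul (z.1 * star z.1) z.2 :=
    continuous_bmul_uncurry.comp₂ (continuous_fst.mul (continuous_star.comp continuous_fst))
      continuous_snd
  have h2 : Continuous fun z : (ℝ →ᵇ ℂ) × L2 => bmul (z.1 * z.1) (conjL z.2) :=
    continuous_bmul_uncurry.comp₂ (continuous_fst.mul continuous_fst)
      (conjL.continuous.comp continuous_snd)
  exact (h1.const_smul (2 : ℂ)).add h2

theorem norm_mul_star_le (a b : ℝ →ᵇ ℂ) : ‖a * star b‖ ≤ ‖a‖ * ‖b‖ :=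
  (norm_mul_le _ _).trans_eq (by rw [norm_star])

theorem norm_cubicDeriv_le (E : ℝ →ᵇ ℂ) (c : L2) : ‖cubicDeriv E c‖ ≤ 3 * ‖E‖ ^ 2 * ‖c‖ := by
  have h1 : ‖bmul (E * star E) c‖ ≤ ‖E‖ * ‖E‖ * ‖c‖ :=
    (norm_bmul_le _ _).trans (by gcongr; exact norm_mul_star_le E E)
  have h2 : ‖bmul (E * E) (conjL c)‖ ≤ ‖E‖ * ‖E‖ * ‖c‖ :=
    (norm_bmul_le _ _).trans (by gcongr; exacts [norm_mul_le E E, norm_conjL_le c])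
  calc ‖cubicDeriv E c‖ ≤ ‖(2 : ℂ) • bmul (E * star E) c‖ + ‖bmul (E * E) (conjL c)‖ :=
        norm_add_le _ _
    _ ≤ 2 * (‖E‖ * ‖E‖ * ‖c‖) + ‖E‖ * ‖E‖ * ‖c‖ := by
        rw [norm_smul]
        gcongr
        simp
    _ = _ := by ring

theorem norm_cubicDeriv_sub_le (E E' : ℝ →ᵇ ℂ) (c c' : L2) :
    ‖cubicDeriv E c - cubicDeriv E' c'‖
      ≤ 3 * ‖E‖ ^ 2 * ‖c - c'‖ + 3 * ((‖E‖ + ‖E'‖) * ‖E - E'‖) * ‖c'‖ := by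
  -- Telescoping: the increment is put in L² once, and otherwise into the coefficients |E|² and E²,
  -- which are measured in the sup norm.
  have e : cubicDeriv E c - cubicDeriv E' c' = cubicDeriv E (c - c')
      + ((2 : ℂ) • bmul (E * star (E - E') + (E - E') * star E') c'
        + bmul (E * (E - E') + (E - E') * E') (conjL c')) := by
    have e1 : E * star (E - E') + (E - E') * star E' = E * star E - E' * star E' := by
      rw [star_sub]; ring
    have e2 : E * (E - E') + (E - E') * E' = E * E - E' * E' := by ring
    rw [e1, e2]
    simp only [cubicDeriv, map_sub, sub_apply, smul_sub]
    abel
  rw [e]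
  have h1 : ‖bmul (E * star (E - E') + (E - E') * star E') c'‖
      ≤ ((‖E‖ + ‖E'‖) * ‖E - E'‖) * ‖c'‖ := by
    refine (norm_bmul_le _ _).trans ?_
    gcongr
    refine (norm_add_le _ _).trans ?_
    linarith [norm_mul_star_le E (E - E'), norm_mul_star_le (E - E') E']
  have h2 : ‖bmul (E * (E - E') + (E - E') * E') (conjL c')‖
      ≤ ((‖E‖ + ‖E'‖) * ‖E - E'‖) * ‖c'‖ := by
    refine (norm_bmul_le _ _).trans ?_
    gcongr
    · refine (norm_add_le _ _).trans ?_
      linarith [norm_mul_le E (E - E'), norm_mul_le (E - E') E']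
    · exact norm_conjL_le c'
  refine (norm_add_le _ _).trans (add_le_add (norm_cubicDeriv_le _ _) ((norm_add_le _ _).trans ?_))
  rw [norm_smul, Complex.norm_ofNat]
  linarith

namespace H11

/-- The cubic expression `|v|² v` for `v = e^{irΔ} f`. -/
def cub (r : ℝ) (f : H11) : L2 := bmul (evol r f * star (evol r f)) (prop r (fn f))

theorem coeFn_cub (r : ℝ) (f : H11) :
    cub r f =ᵐ[volume] fun x => (prop r (fn f)) x * star ((prop r (fn f)) x) * (prop r (fn f)) x := by
  filter_upwards [coeFn_bmul (evol r f * star (evol r f)) (prop r (fn f)), coeFn_evol r f]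
    with x h1 h2
  rw [cub, h1]
  simp [h2]

/-- Euler's identity for the map |v|²v, which is homogeneous of degree 3 over ℝ. The function, its
derivative and its weight are thereby all governed by the single operator `cubicDeriv`. -/
theorem cub_eq_cubicDeriv (r : ℝ) (f : H11) :
    cub r f = (1 / 3 : ℂ) • cubicDeriv (evol r f) (prop r (fn f)) := by
  refine Lp.ext ?_
  filter_upwards [coeFn_bmul (evol r f * star (evol r f)) (prop r (fn f)), coeFn_evol r f,
    coeFn_bmul (evol r f * evol r f) (conjL (prop r (fn f))), coeFn_conjL (prop r (fn f)),
    Lp.coeFn_smul (1 / 3 : ℂ) (cubicDeriv (evol r f) (prop r (fn f))),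
    Lp.coeFn_add ((2 : ℂ) • bmul (evol r f * star (evol r f)) (prop r (fn f)))
      (bmul (evol r f * evol r f) (conjL (prop r (fn f)))),
    Lp.coeFn_smul (2 : ℂ) (bmul (evol r f * star (evol r f)) (prop r (fn f)))]
    with x h1 h2 h3 h4 h5 h6 h7
  rw [cub, h5, Pi.smul_apply, cubicDeriv, h6, Pi.add_apply, h7, Pi.smul_apply, h1, h3, h4]
  simp only [BoundedContinuousFunction.coe_mul, Pi.mul_apply, BoundedContinuousFunction.coe_star,
    Pi.star_apply, smul_eq_mul, h2]
  ring

/-- The cubic expression conjugated by the propagator. -/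
def cubProfile (r : ℝ) (f : H11) : L2 := prop (-r) (cub r f)

/-- The derivative of `cubProfile`. -/
def cubProfileDeriv (r : ℝ) (f : H11) (c : L2) : L2 :=
  prop (-r) (cubicDeriv (evol r f) (prop r c))

theorem cubProfile_eq (r : ℝ) (f : H11) :
    cubProfile r f = (1 / 3 : ℂ) • cubProfileDeriv r f (fn f) := by
  rw [cubProfile, cub_eq_cubicDeriv, map_smul, cubProfileDeriv]

theorem continuous_cubProfileDeriv {T : Type*} [TopologicalSpace T] {r : T → ℝ} {f : T → H11}
    {c : T → L2} (hr : Continuous r) (hf : Continuous f) (hc : Continuous c) :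
    Continuous fun t => cubProfileDeriv (r t) (f t) (c t) := by
  have h1 : Continuous fun t => evol (r t) (f t) := continuous_evol_uncurry.comp₂ hr hf
  have h2 : Continuous fun t => prop (r t) (c t) := continuous_prop_uncurry.comp₂ hr hc
  have h3 : Continuous fun t => cubicDeriv (evol (r t) (f t)) (prop (r t) (c t)) :=
    continuous_cubicDeriv.comp₂ h1 h2
  exact continuous_prop_uncurry.comp₂ hr.neg h3

theorem norm_cubProfileDeriv_le (r : ℝ) (f : H11) (c : L2) :
    ‖cubProfileDeriv r f c‖ ≤ 3 * ‖evol r f‖ ^ 2 * ‖c‖ := by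
  rw [cubProfileDeriv, LinearIsometry.norm_map]
  refine (norm_cubicDeriv_le _ _).trans_eq ?_
  rw [LinearIsometry.norm_map]

theorem norm_cubProfileDeriv_sub_le (r : ℝ) (f f' : H11) (c c' : L2) :
    ‖cubProfileDeriv r f c - cubProfileDeriv r f' c'‖
      ≤ 3 * ‖evol r f‖ ^ 2 * ‖c - c'‖
        + 3 * ((‖evol r f‖ + ‖evol r f'‖) * ‖evol r (f - f')‖) * ‖c'‖ := by
  rw [cubProfileDeriv, cubProfileDeriv, ← map_sub, LinearIsometry.norm_map, map_sub]
  refine (norm_cubicDeriv_sub_le _ _ _ _).trans_eq ?_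
  rw [← map_sub, LinearIsometry.norm_map, LinearIsometry.norm_map]

/-- The curve is only assumed continuous in H^{1,1} and differentiable in L². This suffices because
the coefficients |v|² and v² need only converge uniformly, while the difference quotient enters
linearly in L². Orbits of translations and boosts have exactly this regularity. -/
theorem hasDerivAt_cubProfile (r : ℝ) {F : ℝ → H11} {h : L2}
    (hF : Tendsto F (𝓝 0) (𝓝 (F 0))) (hd : HasDerivAt (fun t => fn (F t)) h 0) :
    HasDerivAt (fun t => cubProfile r (F t)) (cubProfileDeriv r (F 0) h) 0 := by
  -- Pointwise this is |z|²z - |w|²w = (|z|² + |w|²)(z - w) + wz(z̄ - w̄), in which every term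
  -- contains the increment exactly once.
  have key : ∀ t, cub r (F t) - cub r (F 0)
      = bmul (evol r (F t) * star (evol r (F t)) + evol r (F 0) * star (evol r (F 0)))
          (prop r (fn (F t) - fn (F 0)))
        + bmul (evol r (F 0) * evol r (F t)) (conjL (prop r (fn (F t) - fn (F 0)))) := by
    intro t
    refine Lp.ext ?_
    filter_upwards [Lp.coeFn_sub (cub r (F t)) (cub r (F 0)), coeFn_cub r (F t), coeFn_cub r (F 0),
      coeFn_evol r (F t), coeFn_evol r (F 0),
      Lp.coeFn_add (bmul (evol r (F t) * star (evol r (F t)) + evol r (F 0) * star (evol r (F 0)))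
          (prop r (fn (F t) - fn (F 0))))
        (bmul (evol r (F 0) * evol r (F t)) (conjL (prop r (fn (F t) - fn (F 0))))),
      coeFn_bmul (evol r (F t) * star (evol r (F t)) + evol r (F 0) * star (evol r (F 0)))
          (prop r (fn (F t) - fn (F 0))),
      coeFn_bmul (evol r (F 0) * evol r (F t)) (conjL (prop r (fn (F t) - fn (F 0)))),
      coeFn_conjL (prop r (fn (F t) - fn (F 0))),
      Lp.coeFn_sub (prop r (fn (F t))) (prop r (fn (F 0)))] with x h1 h2 h3 h4 h5 h6 h7 h8 h9 h10
    rw [h1, Pi.sub_apply, h2, h3, h6, Pi.add_apply, h7, h8, h9, map_sub, h10]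
    simp only [BoundedContinuousFunction.coe_mul, Pi.mul_apply, BoundedContinuousFunction.coe_star,
      BoundedContinuousFunction.coe_add, Pi.add_apply, Pi.sub_apply, star_sub,
      Pi.star_apply, h4, h5]
    ring
  have hE : Tendsto (fun t => evol r (F t)) (𝓝[≠] 0) (𝓝 (evol r (F 0))) :=
    (((evol r).continuous.tendsto _).comp hF).mono_left nhdsWithin_le_nhds
  have hsl := hasDerivAt_iff_tendsto_slope_zero.mp hd
  have hps : Tendsto (fun t : ℝ => prop r (t⁻¹ • (fn (F (0 + t)) - fn (F 0)))) (𝓝[≠] 0)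
      (𝓝 (prop r h)) := ((prop r).continuous.tendsto _).comp hsl
  have hcub : HasDerivAt (fun t => cub r (F t)) (cubicDeriv (evol r (F 0)) (prop r h)) 0 := by
    rw [hasDerivAt_iff_tendsto_slope_zero]
    have e : ∀ t : ℝ, t⁻¹ • (cub r (F (0 + t)) - cub r (F 0))
        = bmul (evol r (F t) * star (evol r (F t)) + evol r (F 0) * star (evol r (F 0)))
            (prop r (t⁻¹ • (fn (F (0 + t)) - fn (F 0))))
          + bmul (evol r (F 0) * evol r (F t))
            (conjL (prop r (t⁻¹ • (fn (F (0 + t)) - fn (F 0))))) := by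
      intro t
      have hs : prop r (t⁻¹ • (fn (F (0 + t)) - fn (F 0)))
          = t⁻¹ • prop r (fn (F (0 + t)) - fn (F 0)) :=
        (prop r).toContinuousLinearMap.map_smul_of_tower t⁻¹ _
      have hs2 : ∀ (b : ℝ →ᵇ ℂ) (c : L2), bmul b (t⁻¹ • c) = t⁻¹ • bmul b c := fun b c =>
        (bmul b).map_smul_of_tower t⁻¹ c
      rw [hs, map_smul conjL, hs2, hs2, zero_add, key, smul_add]
    simp only [e]
    have e2 : cubicDeriv (evol r (F 0)) (prop r h)
        = bmul (evol r (F 0) * star (evol r (F 0)) + evol r (F 0) * star (evol r (F 0))) (prop r h)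
          + bmul (evol r (F 0) * evol r (F 0)) (conjL (prop r h)) := by
      rw [cubicDeriv, map_add, add_apply, two_smul]
    rw [e2]
    have hEs : Tendsto (fun t => star (evol r (F t))) (𝓝[≠] 0) (𝓝 (star (evol r (F 0)))) :=
      (continuous_star.tendsto _).comp hE
    have hc : Tendsto (fun t : ℝ => conjL (prop r (t⁻¹ • (fn (F (0 + t)) - fn (F 0))))) (𝓝[≠] 0)
      (𝓝 (conjL (prop r h))) := (conjL.continuous.tendsto _).comp hps
    exact (tendsto_bmul ((hE.mul hEs).add tendsto_const_nhds) hps).add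
      (tendsto_bmul (tendsto_const_nhds.mul hE) hc)
  exact ((prop (-r)).toContinuousLinearMap.restrictScalars ℝ).hasFDerivAt.comp_hasDerivAt
    (f := fun t => cub r (F t)) 0 hcub

/-- The cubic nonlinearity commutes with translations and modulations. -/
theorem cub_of_prop_eq {r a : ℝ} {p : C(ℝ, ℝ)} {f f' : H11}
    (h : prop r (fn f') = phaseMul p (shift a (prop r (fn f)))) :
    cub r f' = phaseMul p (shift a (cub r f)) := by
  refine Lp.ext ?_
  filter_upwards [coeFn_cub r f', coeFn_phaseMul p (shift a (prop r (fn f))),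
    coeFn_shift a (prop r (fn f)), coeFn_phaseMul p (shift a (cub r f)), coeFn_shift a (cub r f),
    ae_shift (coeFn_cub r f) a] with x h1 h2 h3 h4 h5 h6
  rw [h1, h, h2, h3, h4, h5, h6]
  have hp : phase p x * star (phase p x) = 1 := by
    have := Complex.mul_conj (phase p x)
    rw [Complex.normSq_eq_norm_sq, norm_phase] at this
    simpa using this
  rw [star_mul']
  linear_combination (phase p x * (prop r (fn f)) (x + a) * star ((prop r (fn f)) (x + a))
    * (prop r (fn f)) (x + a)) * hp

/-! ### Boosts and translations, and the Leibniz rules they generate -/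

theorem two_pi_mul_div (t : ℝ) : 2 * Real.pi * (t / (2 * Real.pi)) = t := by
  field_simp

/-- Modulation by `e^{itx}` on `H^{1,1}`. -/
def boost (t : ℝ) (f : H11) : H11 :=
  mk (phaseMul (t • idMap) (fn f))
    -- The second component stands for (2π)⁻¹∂ₓ, so differentiating e^{itx} contributes it/(2π).
    (phaseMul (t • idMap) (dx f) + (Complex.I * (t / (2 * Real.pi) : ℝ)) •
      phaseMul (t • idMap) (fn f))
    (phaseMul (t • idMap) (mx f))
    (by
      rw [← two_pi_mul_div t]
      rw [FourierTransform.fourier_add, FourierTransform.fourier_smul, fourier_phaseMul,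
        fourier_phaseMul, two_pi_mul_div]
      filter_upwards [coeFn_shift (-(t / (2 * Real.pi))) (𝓕 (fn f) : L2),
        coeFn_shift (-(t / (2 * Real.pi))) (𝓕 (dx f) : L2),
        ae_shift (isMul_fourier f) (-(t / (2 * Real.pi))),
        Lp.coeFn_add (shift (-(t / (2 * Real.pi))) (𝓕 (dx f) : L2))
          ((Complex.I * (t / (2 * Real.pi) : ℝ)) • shift (-(t / (2 * Real.pi))) (𝓕 (fn f) : L2)),
        Lp.coeFn_smul (Complex.I * (t / (2 * Real.pi) : ℝ))
          (shift (-(t / (2 * Real.pi))) (𝓕 (fn f) : L2))] with x h1 h2 h3 h4 h5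
      rw [h4, Pi.add_apply, h5, Pi.smul_apply, h1, h2, h3, smul_eq_mul]
      push_cast
      ring)
    (by
      filter_upwards [coeFn_phaseMul (t • idMap) (fn f), coeFn_phaseMul (t • idMap) (mx f),
        isMul_mx f] with x h1 h2 h3
      rw [h1, h2, h3]; ring)

theorem fn_boost (t : ℝ) (f : H11) : fn (boost t f) = phaseMul (t • idMap) (fn f) := rfl

theorem boost_zero (f : H11) : boost 0 f = f := ext_fn (by rw [fn_boost, phaseMul_zero_smul])

/-- Translation on `H^{1,1}`. -/
def trans (t : ℝ) (f : H11) : H11 :=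
  mk (shift (t / (2 * Real.pi)) (fn f)) (shift (t / (2 * Real.pi)) (dx f))
    (shift (t / (2 * Real.pi)) (mx f) - (Complex.I * (t / (2 * Real.pi) : ℝ)) •
      shift (t / (2 * Real.pi)) (fn f))
    (by
      rw [fourier_shift, fourier_shift]
      filter_upwards [coeFn_phaseMul ((2 * Real.pi * (t / (2 * Real.pi))) • idMap) (𝓕 (fn f) : L2),
        coeFn_phaseMul ((2 * Real.pi * (t / (2 * Real.pi))) • idMap) (𝓕 (dx f) : L2),
        isMul_fourier f] with x h1 h2 h3
      rw [h1, h2, h3]; ring)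
    (by
      filter_upwards [coeFn_shift (t / (2 * Real.pi)) (fn f),
        coeFn_shift (t / (2 * Real.pi)) (mx f), ae_shift (isMul_mx f) (t / (2 * Real.pi)),
        Lp.coeFn_sub (shift (t / (2 * Real.pi)) (mx f))
          ((Complex.I * (t / (2 * Real.pi) : ℝ)) • shift (t / (2 * Real.pi)) (fn f)),
        Lp.coeFn_smul (Complex.I * (t / (2 * Real.pi) : ℝ)) (shift (t / (2 * Real.pi)) (fn f))]
        with x h1 h2 h3 h4 h5
      rw [h4, Pi.sub_apply, h5, Pi.smul_apply, h1, h2, h3, smul_eq_mul]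
      push_cast
      ring)

theorem fn_trans (t : ℝ) (f : H11) : fn (trans t f) = shift (t / (2 * Real.pi)) (fn f) := rfl

theorem trans_zero (f : H11) : trans 0 f = f := ext_fn (by rw [fn_trans]; simp)

/-- The length t/(2π) is chosen so that translation becomes multiplication by e^{itξ}, whose
generator on the Fourier side is the relation `IsMul` used in the definition of `H11`. -/
theorem fourier_shift_div (t : ℝ) (c : L2) :
    (𝓕 (shift (t / (2 * Real.pi)) c) : L2) = phaseMul (t • idMap) (𝓕 c) := by
  rw [fourier_shift, two_pi_mul_div]

theorem shift_div_eq (t : ℝ) (c : L2) :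
    shift (t / (2 * Real.pi)) c = 𝓕⁻ (phaseMul (t • idMap) (𝓕 c) : L2) := by
  rw [← fourier_shift_div, FourierTransform.fourierInv_fourier_eq]

theorem continuous_shift_div (c : L2) : Continuous fun t : ℝ => shift (t / (2 * Real.pi)) c := by
  simp only [shift_div_eq]
  exact (Lp.fourierTransformₗᵢ ℝ ℂ).symm.continuous.comp (continuous_phaseMul (by norm_num) _ _)

theorem continuous_boost (f : H11) : Continuous fun t => boost t f := by
  have h : ∀ c : L2, Continuous fun t : ℝ => phaseMul (t • idMap) c :=
    continuous_phaseMul (by norm_num) idMap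
  have hc : Continuous fun t : ℝ => Complex.I * ((t / (2 * Real.pi) : ℝ) : ℂ) := by fun_prop
  exact continuous_mk (h _) ((h (dx f)).add (hc.smul (h (fn f)))) (h _)

theorem continuous_trans (f : H11) : Continuous fun t => trans t f := by
  have hc : Continuous fun t : ℝ => Complex.I * ((t / (2 * Real.pi) : ℝ) : ℂ) := by fun_prop
  exact continuous_mk (continuous_shift_div _) (continuous_shift_div _)
    ((continuous_shift_div (mx f)).sub (hc.smul (continuous_shift_div (fn f))))

theorem cubProfile_trans (r t : ℝ) (f : H11) :
    cubProfile r (trans t f) = shift (t / (2 * Real.pi)) (cubProfile r f) := by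
  have h : prop r (fn (trans t f))
      = phaseMul 0 (shift (t / (2 * Real.pi)) (prop r (fn f))) := by
    rw [fn_trans, prop_shift, phaseMul_zero]
  rw [cubProfile, cub_of_prop_eq h, phaseMul_zero, prop_shift, ← cubProfile]

/-- After e^{irΔ} a boost is a translation times a unimodular function. The pointwise cubic commutes
with both, and the same Galilean identity, now for the cubic profile, undoes the transformation. -/
theorem cubProfile_boost (r t : ℝ) (f : H11) :
    cubProfile r (boost t f) = phaseMul (t • idMap) (cubProfile r f) := by
  have h := prop_phaseMul r (t / (2 * Real.pi)) (fn f)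
  have h' := prop_phaseMul r (t / (2 * Real.pi)) (cubProfile r f)
  rw [two_pi_mul_div] at h h'
  rw [cubProfile, cub_of_prop_eq (f := f) (f' := boost t f) h]
  rw [cubProfile, prop_prop_neg] at h'
  rw [← h', prop_neg_prop, ← cubProfile]

/-- Equivariance under boosts says that the orbit of N_r(f) is the image of the orbit of f.
Differentiating at 0, by the chain rule on one side and by the generator on the other, identifies
the weight ix N_r(f). This replaces the usual Leibniz rule for the vector field x + 2ir∂ₓ. -/
theorem isMul_cubProfile (r : ℝ) (f : H11) :
    IsMul (cubProfile r f) (cubProfileDeriv r f (mx f)) := by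
  refine isMul_of_hasDerivAt ?_
  have h := hasDerivAt_cubProfile r (F := fun t => boost t f) (h := mx f)
    ((continuous_boost f).tendsto 0) ((isMul_mx f).hasDerivAt)
  simpa only [cubProfile_boost, boost_zero] using h

theorem hasDerivAt_shift_div {c d : L2} (h : IsMul (𝓕 c) (𝓕 d)) :
    HasDerivAt (fun t : ℝ => shift (t / (2 * Real.pi)) c) d 0 := by
  simp only [shift_div_eq]
  have h1 := (((Lp.fourierTransformₗᵢ ℝ ℂ).symm.toContinuousLinearEquiv :
    L2 →L[ℂ] L2).restrictScalars ℝ).hasFDerivAt.comp_hasDerivAt 0 h.hasDerivAt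
  have h2 : (𝓕⁻ (𝓕 d : L2) : L2) = d := FourierTransform.fourierInv_fourier_eq d
  have h3 : (((Lp.fourierTransformₗᵢ ℝ ℂ).symm.toContinuousLinearEquiv :
    L2 →L[ℂ] L2).restrictScalars ℝ) (𝓕 d) = d := h2
  rw [h3] at h1
  exact h1

/-- The same argument along the translation orbit, giving the derivative of N_r(f). -/
theorem isMul_fourier_cubProfile (r : ℝ) (f : H11) :
    IsMul (𝓕 (cubProfile r f)) (𝓕 (cubProfileDeriv r f (dx f))) := by
  refine isMul_of_hasDerivAt ?_
  have h := hasDerivAt_cubProfile r (F := fun t => trans t f) (h := dx f)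
    ((continuous_trans f).tendsto 0) (hasDerivAt_shift_div (isMul_fourier f))
  simp only [cubProfile_trans, trans_zero] at h
  have h1 := (((Lp.fourierTransformₗᵢ ℝ ℂ).toContinuousLinearEquiv :
    L2 →L[ℂ] L2).restrictScalars ℝ).hasFDerivAt.comp_hasDerivAt 0 h
  simp only [← fourier_shift_div]
  exact h1

/-- The nonlinear vector field `e^{-irΔ} (|e^{irΔ} f|² e^{irΔ} f)` on `H^{1,1}`. -/
def cubicField (r : ℝ) (f : H11) : H11 :=
  mk (cubProfile r f) (cubProfileDeriv r f (dx f)) (cubProfileDeriv r f (mx f))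
    (isMul_fourier_cubProfile r f) (isMul_cubProfile r f)

theorem fn_cubicField (r : ℝ) (f : H11) : fn (cubicField r f) = cubProfile r f := rfl

theorem norm_cubicField_le (r : ℝ) (f : H11) : ‖cubicField r f‖ ≤ 3 * ‖evol r f‖ ^ 2 * ‖f‖ := by
  have h : ∀ c : L2, ‖c‖ ≤ ‖f‖ → ‖cubProfileDeriv r f c‖ ≤ 3 * ‖evol r f‖ ^ 2 * ‖f‖ :=
    fun c hc => (norm_cubProfileDeriv_le r f c).trans (by gcongr)
  refine norm_le ?_ (h _ (norm_dx_le f)) (h _ (norm_mx_le f))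
  rw [fn_cubicField, cubProfile_eq, norm_smul]
  refine (mul_le_of_le_one_left (norm_nonneg _) (by norm_num)).trans (h _ (norm_fn_le f))

theorem continuous_cubicField : Continuous fun z : ℝ × H11 => cubicField z.1 z.2 := by
  have h : ∀ L : H11 →L[ℂ] L2, Continuous fun z : ℝ × H11 => cubProfileDeriv z.1 z.2 (L z.2) :=
    fun L => continuous_cubProfileDeriv continuous_fst continuous_snd
      (L.continuous.comp continuous_snd)
  refine continuous_mk ?_ (h dx) (h mx)
  simp only [fn_cubicField, cubProfile_eq]
  exact (h fn).const_smul (1 / 3 : ℂ)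

/-- Only the r-independent embedding bound on e^{irΔ}f is used, so the Lipschitz constant on balls
is uniform in r; the time decay plays no part in existence and uniqueness. -/
theorem norm_cubicField_sub_le (r : ℝ) {f g : H11} {M : ℝ} (hf : ‖f‖ ≤ M) (hg : ‖g‖ ≤ M) :
    ‖cubicField r f - cubicField r g‖ ≤ 9 * (2 * ‖weight‖) ^ 2 * M ^ 2 * ‖f - g‖ := by
  have hM : 0 ≤ M := (norm_nonneg _).trans hf
  have hw := norm_nonneg weight
  have hEf : ‖evol r f‖ ≤ 2 * ‖weight‖ * M := (norm_evol_le r f).trans (by gcongr)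
  have hEg : ‖evol r g‖ ≤ 2 * ‖weight‖ * M := (norm_evol_le r g).trans (by gcongr)
  have h : ∀ L : H11 →L[ℂ] L2, (∀ x, ‖L x‖ ≤ ‖x‖) →
      ‖cubProfileDeriv r f (L f) - cubProfileDeriv r g (L g)‖
        ≤ 9 * (2 * ‖weight‖) ^ 2 * M ^ 2 * ‖f - g‖ := by
    intro L hL
    refine (norm_cubProfileDeriv_sub_le _ _ _ _ _).trans ?_
    rw [← map_sub]
    calc _ ≤ 3 * (2 * ‖weight‖ * M) ^ 2 * ‖f - g‖
          + 3 * ((2 * ‖weight‖ * M + 2 * ‖weight‖ * M) * (2 * ‖weight‖ * ‖f - g‖)) * M := by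
          gcongr
          exacts [hL _, norm_evol_le _ _, (hL g).trans hg]
      _ = _ := by ring
  refine norm_le ?_ ?_ ?_
  · rw [map_sub, fn_cubicField, fn_cubicField, cubProfile_eq, cubProfile_eq, ← smul_sub, norm_smul]
    exact (mul_le_of_le_one_left (norm_nonneg _) (by norm_num)).trans (h fn norm_fn_le)
  · rw [map_sub]; exact h dx norm_dx_le
  · rw [map_sub]; exact h mx norm_mx_le

theorem evol_cubicField (r : ℝ) (f : H11) :
    evol r (cubicField r f) = evol r f * star (evol r f) * evol r f := by
  have h : (evol r (cubicField r f) : ℝ → ℂ) =ᵐ[volume]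
      (evol r f * star (evol r f) * evol r f : ℝ →ᵇ ℂ) := by
    filter_upwards [coeFn_evol r (cubicField r f), coeFn_evol r f, coeFn_cub r f] with x h1 h2 h3
    rw [h1, fn_cubicField, cubProfile, prop_prop_neg, h3]
    simp [h2]
  exact DFunLike.coe_injective ((Continuous.ae_eq_iff_eq volume (BoundedContinuousFunction.continuous _)
    (BoundedContinuousFunction.continuous _)).mp h)

/-! ### The cubic term on the chirped Fourier side -/

theorem amp_ne_zero {r : ℝ} (hr : 0 < r) : amp r ≠ 0 := by
  have h := norm_amp_sq hr
  intro h0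
  rw [h0] at h
  have : 0 < (4 * Real.pi * r)⁻¹ := by positivity
  simp at h
  exact hr.ne' h

/-- In e^{irΔ} = M D 𝓕 M, the outer factors are a scalar, a unimodular function and a dilation. They
pass through the pointwise cubic, leaving only |amp|² = (4πr)⁻¹. The identity is exact, with no
stationary phase remainder. -/
theorem chirp_cubicField {r : ℝ} (hr : 0 < r) (f : H11) (y : ℝ) :
    chirp (4 * r)⁻¹ (cubicField r f) y
      = ((4 * Real.pi * r)⁻¹ * ‖chirp (4 * r)⁻¹ f y‖ ^ 2 : ℝ) * chirp (4 * r)⁻¹ f y := by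
  have hpos : 4 * Real.pi * r ≠ 0 := by positivity
  set x := 4 * Real.pi * r * y with hx
  have hxy : x / (4 * Real.pi * r) = y := by rw [hx]; field_simp
  have h1 := evol_eq_chirp hr (cubicField r f) x
  have h2 := evol_eq_chirp hr f x
  rw [evol_cubicField] at h1
  simp only [BoundedContinuousFunction.coe_mul, Pi.mul_apply, BoundedContinuousFunction.coe_star,
    Pi.star_apply, h2, hxy] at h1
  have hp : phase ((4 * r)⁻¹ • sqMap) x ≠ 0 := by
    intro h0
    have := norm_phase ((4 * r)⁻¹ • sqMap) x
    rw [h0] at this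
    simp at this
  have hm : ∀ z : ℂ, z * star z = ((‖z‖ ^ 2 : ℝ) : ℂ) := fun z => by
    rw [← Complex.normSq_eq_norm_sq]; exact Complex.mul_conj z
  rw [hm, norm_mul, norm_mul, norm_phase, mul_one, mul_pow, norm_amp_sq hr] at h1
  refine mul_left_cancel₀ (mul_ne_zero (amp_ne_zero hr) hp) ?_
  rw [← h1]; ring

end H11
end DMNLS

namespace DMNLS

open Filter Topology
open scoped BoundedContinuousFunction

/-! ### The propagator on `H^{1,1}` -/

/-- Product rule for a unitary group acting on a moving vector. The group is only strongly
continuous, so the term with the moving quotient uses the joint continuity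
`continuous_phaseMul_uncurry`. -/
theorem hasDerivAt_phaseMul_comp {c : ℝ → L2} {c' ψ : L2} (hψ : IsMul (c 0) ψ)
    (hc : HasDerivAt c c' 0) :
    HasDerivAt (fun s : ℝ => phaseMul (s • idMap) (c s)) (ψ + c') 0 := by
  have h1 := hasDerivAt_iff_tendsto_slope_zero.mp hψ.hasDerivAt
  have h2 := hasDerivAt_iff_tendsto_slope_zero.mp hc
  rw [hasDerivAt_iff_tendsto_slope_zero]
  have h3 : Tendsto (fun t : ℝ => phaseMul (t • idMap) (t⁻¹ • (c (0 + t) - c 0))) (𝓝[≠] 0)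
      (𝓝 c') := by
    have e : c' = phaseMul ((0 : ℝ) • idMap) c' := (phaseMul_zero_smul _ _).symm
    have h4 : Tendsto (fun t : ℝ => (t, t⁻¹ • (c (0 + t) - c 0))) (𝓝[≠] 0) (𝓝 (0, c')) :=
      (tendsto_id.mono_left nhdsWithin_le_nhds).prodMk_nhds h2
    have h5 := ((continuous_phaseMul_uncurry (q := 2) (by norm_num) idMap).tendsto (0, c')).comp h4
    rw [e]
    simpa only [Function.comp_def] using h5
  refine (h1.add h3).congr fun t => ?_
  have e : phaseMul (t • idMap) (t⁻¹ • (c (0 + t) - c 0))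
      = t⁻¹ • phaseMul (t • idMap) (c (0 + t) - c 0) :=
    (phaseMul (t • idMap)).toContinuousLinearMap.map_smul_of_tower t⁻¹ _
  rw [e, map_sub, phaseMul_zero_smul, ← smul_add, zero_add]
  congr 1
  abel

theorem phaseMul_const (a : ℝ) (g : L2) :
    phaseMul (ContinuousMap.const ℝ a) g = Complex.exp (a * Complex.I) • g := by
  refine Lp.ext ?_
  filter_upwards [coeFn_phaseMul (ContinuousMap.const ℝ a) g,
    Lp.coeFn_smul (Complex.exp (a * Complex.I)) g] with x h1 h2
  rw [h1, h2]
  simp [phase]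

namespace H11

theorem phaseMul_prop (t s : ℝ) (f : L2) :
    phaseMul (s • idMap) (prop t f)
      = prop t (Complex.exp ((t * s ^ 2 : ℝ) * Complex.I) •
          phaseMul (s • idMap) (shift ((4 * Real.pi * t * s) / (2 * Real.pi)) f)) := by
  have h := prop_phaseMul (-t) (s / (2 * Real.pi)) (prop t f)
  rw [two_pi_mul_div, prop_neg_prop] at h
  have e1 : -(4 * Real.pi * -t * (s / (2 * Real.pi))) = 4 * Real.pi * t * s / (2 * Real.pi) := by
    ring
  have e2 : -(-t * s ^ 2) = t * s ^ 2 := by ring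
  rw [e1, e2, add_comm, phaseMul_add, phaseMul_const] at h
  rw [← h, prop_prop_neg]

/-- The commutation x e^{itΔ} = e^{itΔ}(x - 2it∂ₓ), obtained by differentiating the Galilean
identity at s = 0. The scalar phase e^{its²} is stationary there, and 4πt times (2π)⁻¹∂ₓ is 2t∂ₓ. -/
theorem isMul_prop (t : ℝ) (f : H11) :
    IsMul (prop t (fn f)) (prop t (mx f + (4 * Real.pi * t : ℝ) • dx f)) := by
  refine isMul_of_hasDerivAt ?_
  simp only [phaseMul_prop]
  have h1 : HasDerivAt (fun s : ℝ => 4 * Real.pi * t * s) (4 * Real.pi * t) 0 := by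
    simpa using (hasDerivAt_id (0 : ℝ)).const_mul (4 * Real.pi * t)
  have h2 : HasDerivAt (fun s : ℝ => shift ((4 * Real.pi * t * s) / (2 * Real.pi)) (fn f))
      ((4 * Real.pi * t) • dx f) 0 := by
    have h0 : HasDerivAt (fun t : ℝ => shift (t / (2 * Real.pi)) (fn f)) (dx f)
        (4 * Real.pi * t * 0) := by
      rw [mul_zero]; exact hasDerivAt_shift_div (isMul_fourier f)
    exact h0.scomp (0 : ℝ) h1
  have h3 := hasDerivAt_phaseMul_comp
    (c := fun s : ℝ => shift ((4 * Real.pi * t * s) / (2 * Real.pi)) (fn f)) (ψ := mx f)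
    (by simpa using isMul_mx f) h2
  have h4 : HasDerivAt (fun s : ℝ => Complex.exp ((t * s ^ 2 : ℝ) * Complex.I)) 0 0 := by
    have h5 : HasDerivAt (fun s : ℝ => t * s ^ 2) 0 0 := by
      simpa using ((hasDerivAt_id (0 : ℝ)).pow 2).const_mul t
    have h6 := (h5.ofReal_comp.mul_const Complex.I).cexp
    simpa using h6
  have h7 := (h4.smul h3).congr_deriv (g' := mx f + (4 * Real.pi * t) • dx f) (by simp)
  have h8 := ((prop t).toContinuousLinearMap.restrictScalars ℝ).hasFDerivAt.comp_hasDerivAt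
    (f := fun s : ℝ => Complex.exp ((t * s ^ 2 : ℝ) * Complex.I) •
      phaseMul (s • idMap) (shift ((4 * Real.pi * t * s) / (2 * Real.pi)) (fn f))) 0 h7
  exact h8

theorem isMul_fourier_prop (t : ℝ) (f : H11) :
    IsMul (𝓕 (prop t (fn f))) (𝓕 (prop t (dx f))) := by
  rw [fourier_prop, fourier_prop]
  filter_upwards [coeFn_phaseMul (t • lapSymbol) (𝓕 (fn f) : L2),
    coeFn_phaseMul (t • lapSymbol) (𝓕 (dx f) : L2), isMul_fourier f] with x h1 h2 h3
  rw [h1, h2, h3]; ring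

/-- The free propagator on `H^{1,1}`. -/
def propH (t : ℝ) (f : H11) : H11 :=
  mk (prop t (fn f)) (prop t (dx f)) (prop t (mx f + (4 * Real.pi * t : ℝ) • dx f))
    (isMul_fourier_prop t f) (isMul_prop t f)

@[simp] theorem fn_propH (t : ℝ) (f : H11) : fn (propH t f) = prop t (fn f) := rfl

theorem continuous_propH : Continuous fun z : ℝ × H11 => propH z.1 z.2 := by
  have h : ∀ {c : ℝ × H11 → L2}, Continuous c → Continuous fun z : ℝ × H11 => prop z.1 (c z) :=
    fun hc => continuous_prop_uncurry.comp₂ continuous_fst hc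
  have h1 : Continuous fun z : ℝ × H11 => fn z.2 := fn.continuous.comp continuous_snd
  have h2 : Continuous fun z : ℝ × H11 => dx z.2 := dx.continuous.comp continuous_snd
  have h3 : Continuous fun z : ℝ × H11 => mx z.2 := mx.continuous.comp continuous_snd
  have h5 : Continuous fun z : ℝ × H11 => (4 * Real.pi * z.1 : ℝ) :=
    continuous_const.mul continuous_fst
  have h4 : Continuous fun z : ℝ × H11 => (4 * Real.pi * z.1 : ℝ) • dx z.2 := h5.smul h2
  exact continuous_mk (h h1) (h h2) (h (h3.add h4))

theorem evol_propH (r t : ℝ) (f : H11) : evol r (propH t f) = evol (r + t) f := by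
  have h : (evol r (propH t f) : ℝ → ℂ) =ᵐ[volume] evol (r + t) f := by
    filter_upwards [coeFn_evol r (propH t f), coeFn_evol (r + t) f] with x h1 h2
    rw [h1, h2, prop_add, fn_propH]
  exact DFunLike.coe_injective ((Continuous.ae_eq_iff_eq volume
    (BoundedContinuousFunction.continuous _) (BoundedContinuousFunction.continuous _)).mp h)

/-- The group law turns the map frequency r acting on u = e^{itΔ}f into the parameter r + t acting
on f. Hence the profile equation contains the times t + D(τ). -/
theorem cubProfile_propH (r t : ℝ) (f : H11) :
    cubProfile r (propH t f) = prop t (cubProfile (r + t) f) := by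
  rw [cubProfile, cubProfile, cub, cub, evol_propH, fn_propH, ← prop_add, ← prop_add]
  congr 2
  ring

/-! ### Comparison with `normH11` -/

theorem enorm_eq_eLpNorm (v : L2) : ‖v‖ₑ = eLpNorm v 2 volume := Lp.enorm_def v

theorem norm_sqrt_weight_le (ξ : ℝ) :
    ‖((Real.sqrt (1 + (2 * Real.pi * ξ) ^ 2) : ℝ) : ℂ)‖ ≤ 2 * Real.pi * ‖1 + Complex.I * (ξ : ℂ)‖ := by
  rw [Complex.norm_real, Real.norm_eq_abs, abs_of_nonneg (Real.sqrt_nonneg _)]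
  refine Real.sqrt_le_iff.mpr ⟨by positivity, ?_⟩
  have e : (2 * Real.pi * ‖1 + Complex.I * (ξ : ℂ)‖) ^ 2 = (2 * Real.pi) ^ 2 * (1 + ξ ^ 2) := by
    rw [mul_pow, norm_one_add_I_mul_sq]
  rw [e]
  nlinarith [Real.pi_gt_three]

theorem normH11_fn_le (f : H11) : normH11 (fn f) ≤ ENNReal.ofReal (30 * ‖f‖) := by
  have h1 : eLpNorm (fun ξ : ℝ => (Real.sqrt (1 + (2 * Real.pi * ξ) ^ 2) : ℂ)
      * (𝓕 (fn f) : L2) ξ) 2 volume ≤ ENNReal.ofReal (2 * Real.pi)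
        * eLpNorm (𝓕 (fn f) + 𝓕 (dx f) : L2) 2 volume := by
    refine eLpNorm_le_mul_eLpNorm_of_ae_le_mul ?_ 2
    filter_upwards [isMul_fourier f, Lp.coeFn_add (𝓕 (fn f) : L2) (𝓕 (dx f) : L2)] with ξ h1 h2
    rw [h2, Pi.add_apply, h1]
    have e : (𝓕 (fn f) : L2) ξ + Complex.I * ξ * (𝓕 (fn f) : L2) ξ
        = (1 + Complex.I * ξ) * (𝓕 (fn f) : L2) ξ := by ring
    rw [e, norm_mul, norm_mul, ← mul_assoc]
    gcongr
    exact norm_sqrt_weight_le ξ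
  have h2 : eLpNorm (fun x : ℝ => (x : ℂ) * fn f x) 2 volume = ‖mx f‖ₑ := by
    rw [enorm_eq_eLpNorm]
    refine eLpNorm_congr_norm_ae ?_
    filter_upwards [isMul_mx f] with x hx
    rw [hx]; simp
  have h3 : ‖(𝓕 (fn f) + 𝓕 (dx f) : L2)‖ ≤ 2 * ‖f‖ := by
    refine (norm_add_le _ _).trans ?_
    rw [Lp.norm_fourier_eq, Lp.norm_fourier_eq]
    linarith [norm_fn_le f, norm_dx_le f]
  rw [normH11, h2]
  rw [← enorm_eq_eLpNorm, ← ofReal_norm, ← ENNReal.ofReal_mul (by positivity)] at h1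
  refine (add_le_add h1 le_rfl).trans ?_
  rw [← ofReal_norm, ← ENNReal.ofReal_add (by positivity) (by positivity)]
  refine ENNReal.ofReal_le_ofReal ?_
  -- The sum of the two parts is at most (4π + 1)‖f‖; the constant 30 is a loose upper bound.
  have h4 : 2 * Real.pi * ‖(𝓕 (fn f) + 𝓕 (dx f) : L2)‖ ≤ 2 * Real.pi * (2 * ‖f‖) := by gcongr
  nlinarith [norm_mx_le f, Real.pi_lt_d2, norm_nonneg f]

theorem one_le_norm_sqrt (ξ : ℝ) :
    1 ≤ ‖((Real.sqrt (1 + (2 * Real.pi * ξ) ^ 2) : ℝ) : ℂ)‖ := by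
  rw [Complex.norm_real, Real.norm_eq_abs, abs_of_nonneg (Real.sqrt_nonneg _)]
  exact Real.one_le_sqrt.mpr (by nlinarith [sq_nonneg (2 * Real.pi * ξ)])

theorem abs_le_norm_sqrt (ξ : ℝ) :
    |ξ| ≤ ‖((Real.sqrt (1 + (2 * Real.pi * ξ) ^ 2) : ℝ) : ℂ)‖ := by
  rw [Complex.norm_real, Real.norm_eq_abs, abs_of_nonneg (Real.sqrt_nonneg _)]
  refine Real.abs_le_sqrt ?_
  have h : 1 ≤ (2 * Real.pi) ^ 2 := by nlinarith [Real.pi_gt_three]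
  rw [mul_pow]
  nlinarith [mul_le_mul_of_nonneg_right h (sq_nonneg ξ)]

/-- Each of the three components is dominated separately, and `H11` carries the maximum norm. The
constant is one, so data of size ε gives ‖f₀‖ ≤ ε without loss. -/
theorem enorm_le_normH11 (f : H11) : ENNReal.ofReal ‖f‖ ≤ normH11 (fn f) := by
  have h1 : ∀ v : L2, (∀ᵐ ξ, ‖(𝓕 v : L2) ξ‖ ≤ ‖(Real.sqrt (1 + (2 * Real.pi * ξ) ^ 2) : ℂ)
      * (𝓕 (fn f) : L2) ξ‖) → ‖v‖ₑ ≤ normH11 (fn f) := by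
    intro v hv
    have : ‖v‖ₑ = ‖(𝓕 v : L2)‖ₑ := by rw [← ofReal_norm, ← ofReal_norm, Lp.norm_fourier_eq]
    rw [this, enorm_eq_eLpNorm]
    exact (eLpNorm_mono_ae hv).trans le_self_add
  have h2 : ‖fn f‖ₑ ≤ normH11 (fn f) := h1 _ (Eventually.of_forall fun ξ => by
    rw [norm_mul]
    exact le_mul_of_one_le_left (norm_nonneg _) (one_le_norm_sqrt ξ))
  have h3 : ‖dx f‖ₑ ≤ normH11 (fn f) := h1 _ (by
    filter_upwards [isMul_fourier f] with ξ h1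
    rw [h1, norm_mul, norm_mul, norm_mul, Complex.norm_I, one_mul, Complex.norm_real,
      Real.norm_eq_abs]
    gcongr
    exact abs_le_norm_sqrt ξ)
  have h4 : ‖mx f‖ₑ ≤ normH11 (fn f) := by
    rw [enorm_eq_eLpNorm]
    refine le_trans (le_of_eq (eLpNorm_congr_norm_ae ?_)) le_add_self
    filter_upwards [isMul_mx f] with x hx
    rw [hx]; simp
  rcases eq_or_ne (normH11 (fn f)) ∞ with h | h
  · rw [h]; exact le_top
  · have e : ∀ v : L2, ‖v‖ₑ ≤ normH11 (fn f) → ‖v‖ ≤ (normH11 (fn f)).toReal := fun v hv => by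
      have := ENNReal.toReal_mono h hv
      rwa [toReal_enorm] at this
    exact ENNReal.ofReal_le_of_le_toReal (norm_le (e _ h2) (e _ h3) (e _ h4))

theorem exists_fn_eq {v : L2} (hv : normH11 v < ∞) : ∃ f : H11, fn f = v := by
  obtain ⟨hv1, hv2⟩ := ENNReal.add_lt_top.mp hv
  have hm : MemLp (fun x : ℝ => Complex.I * x * v x) 2 volume := by
    refine ⟨(Continuous.aestronglyMeasurable (by fun_prop)).mul (Lp.aestronglyMeasurable v), ?_⟩
    refine lt_of_le_of_lt (le_of_eq (eLpNorm_congr_norm_ae (Eventually.of_forall fun x => ?_))) hv2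
    simp
  have hd : MemLp (fun ξ : ℝ => Complex.I * ξ * (𝓕 v : L2) ξ) 2 volume := by
    refine ⟨(Continuous.aestronglyMeasurable (by fun_prop)).mul (Lp.aestronglyMeasurable _), ?_⟩
    refine lt_of_le_of_lt (eLpNorm_mono_ae (Eventually.of_forall fun ξ => ?_)) hv1
    rw [norm_mul, norm_mul, norm_mul, Complex.norm_I, one_mul, Complex.norm_real, Real.norm_eq_abs]
    gcongr
    exact abs_le_norm_sqrt ξ
  refine ⟨mk v (𝓕⁻ (hd.toLp _)) (hm.toLp _) ?_ hm.coeFn_toLp, rfl⟩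
  rw [FourierTransform.fourier_fourierInv_eq]
  exact hd.coeFn_toLp

/-! ### The averaged nonlinearity -/

theorem memLp_cubic (r : ℝ) (f : H11) :
    MemLp (fun x : ℝ => (‖(prop r (fn f)) x‖ ^ 2 : ℂ) * (prop r (fn f)) x) 2 volume := by
  refine (memLp_congr_ae ?_).mp (Lp.memLp (cub r f))
  filter_upwards [coeFn_cub r f] with x hx
  rw [hx]
  congr 1
  have := Complex.mul_conj ((prop r (fn f)) x)
  rw [Complex.normSq_eq_norm_sq] at this
  push_cast at this
  exact this

theorem cubic_prop (r : ℝ) (f : H11) : cubic (prop r (fn f)) = cub r f := by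
  rw [cubic, dif_pos (memLp_cubic r f)]
  refine Lp.ext ?_
  filter_upwards [coeFn_cub r f, (memLp_cubic r f).coeFn_toLp] with x h1 h2
  rw [h2, h1]
  congr 1
  have := Complex.mul_conj ((prop r (fn f)) x)
  rw [Complex.normSq_eq_norm_sq] at this
  push_cast at this
  exact this.symm

section Field

variable (dp dm tp : ℝ)

theorem integrand_fn (f : H11) (τ : ℝ) :
    integrand dp dm tp (fn f) τ = fn (cubicField (cumDispersion dp dm tp τ) f) := by
  rw [integrand, propagator_eq_prop, propagator_eq_prop, cubic_prop, fn_cubicField, cubProfile]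

theorem measurable_dispersion : Measurable (dispersion dp dm tp) := by
  unfold dispersion
  exact Measurable.ite (measurableSet_lt measurable_fract measurable_const) measurable_const
    measurable_const

theorem continuous_cumDispersion : Continuous (cumDispersion dp dm tp) := by
  unfold cumDispersion
  refine intervalIntegral.continuous_primitive (fun a b => ?_) 0
  refine (intervalIntegrable_const (c := |dp| + |dm| + |avgDispersion dp dm tp|)).mono_fun
    ((measurable_dispersion dp dm tp).sub_const _).aestronglyMeasurable
    (Eventually.of_forall fun x => ?_)
  beta_reduce
  rw [Real.norm_eq_abs, Real.norm_eq_abs, abs_of_nonneg (a := |dp| + _ + _) (by positivity)]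
  refine (abs_sub _ _).trans ?_
  gcongr
  unfold dispersion
  split_ifs
  · linarith [abs_nonneg dm]
  · rw [abs_neg]; linarith [abs_nonneg dp]

theorem exists_cumDispersion_bound :
    ∃ B : ℝ, 0 ≤ B ∧ ∀ τ ∈ Set.Icc (0 : ℝ) 1, |cumDispersion dp dm tp τ| ≤ B := by
  obtain ⟨B, hB⟩ := isCompact_Icc.exists_bound_of_continuousOn
    ((continuous_cumDispersion dp dm tp).continuousOn (s := Set.Icc (0 : ℝ) 1))
  exact ⟨B, (norm_nonneg _).trans (hB 0 (by simp)), fun τ hτ => hB τ hτ⟩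

/-- The vector field of the profile equation. -/
def field (t : ℝ) (f : H11) : H11 :=
  -Complex.I • ∫ τ in (0 : ℝ)..1, cubicField (t + cumDispersion dp dm tp τ) f

theorem continuous_cubicField_shift :
    Continuous fun z : (ℝ × H11) × ℝ => cubicField (z.1.1 + cumDispersion dp dm tp z.2) z.1.2 := by
  have h1 : Continuous fun z : (ℝ × H11) × ℝ => z.1.1 + cumDispersion dp dm tp z.2 :=
    (continuous_fst.comp continuous_fst).add
      ((continuous_cumDispersion dp dm tp).comp continuous_snd)
  exact continuous_cubicField.comp₂ h1 (continuous_snd.comp continuous_fst)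

theorem continuous_cubicField_tau (t : ℝ) (f : H11) :
    Continuous fun τ => cubicField (t + cumDispersion dp dm tp τ) f :=
  continuous_cubicField.comp₂ (continuous_const.add (continuous_cumDispersion dp dm tp))
    continuous_const

theorem continuous_field : Continuous fun z : ℝ × H11 => field dp dm tp z.1 z.2 := by
  have h := intervalIntegral.continuous_parametric_intervalIntegral_of_continuous'
    (μ := volume) (f := fun z : ℝ × H11 => fun τ => cubicField (z.1 + cumDispersion dp dm tp τ) z.2)
    (continuous_cubicField_shift dp dm tp) 0 1
  exact h.const_smul (-Complex.I)

theorem norm_field_le {t B : ℝ} {f : H11} (hB : ∀ τ ∈ Set.Icc (0 : ℝ) 1,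
    ‖evol (t + cumDispersion dp dm tp τ) f‖ ≤ B) : ‖field dp dm tp t f‖ ≤ 3 * B ^ 2 * ‖f‖ := by
  rw [field, norm_smul, norm_neg, Complex.norm_I, one_mul]
  have := intervalIntegral.norm_integral_le_of_norm_le_const (a := (0 : ℝ)) (b := 1)
    (f := fun τ => cubicField (t + cumDispersion dp dm tp τ) f) (C := 3 * B ^ 2 * ‖f‖) ?_
  · simpa using this
  · intro τ hτ
    rw [Set.uIoc_of_le zero_le_one] at hτ
    refine (norm_cubicField_le _ _).trans ?_
    gcongr
    exact hB τ (Set.Ioc_subset_Icc_self hτ)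

theorem norm_field_sub_le (t : ℝ) {f g : H11} {M : ℝ} (hf : ‖f‖ ≤ M) (hg : ‖g‖ ≤ M) :
    ‖field dp dm tp t f - field dp dm tp t g‖ ≤ 9 * (2 * ‖weight‖) ^ 2 * M ^ 2 * ‖f - g‖ := by
  have e : field dp dm tp t f - field dp dm tp t g
      = -Complex.I • ((∫ τ in (0 : ℝ)..1, cubicField (t + cumDispersion dp dm tp τ) f)
        - ∫ τ in (0 : ℝ)..1, cubicField (t + cumDispersion dp dm tp τ) g) :=
    (smul_sub _ _ _).symm
  rw [e, norm_smul, norm_neg, Complex.norm_I, one_mul,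
    ← intervalIntegral.integral_sub
      ((continuous_cubicField_tau dp dm tp t f).intervalIntegrable 0 1)
      ((continuous_cubicField_tau dp dm tp t g).intervalIntegrable 0 1)]
  have := intervalIntegral.norm_integral_le_of_norm_le_const (a := (0 : ℝ)) (b := 1)
    (f := fun τ => cubicField (t + cumDispersion dp dm tp τ) f
      - cubicField (t + cumDispersion dp dm tp τ) g)
    (C := 9 * (2 * ‖weight‖) ^ 2 * M ^ 2 * ‖f - g‖)
    (fun τ _ => norm_cubicField_sub_le _ hf hg)
  simpa using this

/-- Identifies `field` with the equation conjugated by the free flow. The Laplacian has disappeared,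
so that Duhamel's formula becomes an integrated ordinary differential equation. -/
theorem fn_field (t : ℝ) (f : H11) :
    fn (field dp dm tp t f)
      = -Complex.I • prop (-t) (nonlinearity dp dm tp (prop t (fn f))) := by
  have h1 : nonlinearity dp dm tp (prop t (fn f))
      = ∫ τ in (0 : ℝ)..1, prop t (fn (cubicField (t + cumDispersion dp dm tp τ) f)) := by
    rw [nonlinearity, ← fn_propH]
    refine intervalIntegral.integral_congr fun τ _ => ?_
    simp only [integrand_fn, fn_cubicField, cubProfile_propH, add_comm t]
  have h2 := ((prop t).toContinuousLinearMap.comp fn).intervalIntegral_comp_comm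
    ((continuous_cubicField_tau dp dm tp t f).intervalIntegrable (μ := volume) 0 1)
  rw [h1, field, map_smul]
  congr 1
  have h3 : (∫ τ in (0 : ℝ)..1, prop t (fn (cubicField (t + cumDispersion dp dm tp τ) f)))
      = prop t (fn (∫ τ in (0 : ℝ)..1, cubicField (t + cumDispersion dp dm tp τ) f)) := h2
  rw [h3, prop_neg_prop]

end Field

end H11
end DMNLS

namespace DMNLS

open Filter Topology
open scoped BoundedContinuousFunction NNReal

/-! ### Global solutions of ordinary differential equations -/

section Ode

variable {E : Type*} [NormedAddCommGroup E] [NormedSpace ℝ E]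

/-- A continuous curve on `[0, ∞)` solving `f' = V(t, f)`. -/
structure IsCurve (V : ℝ → E → E) (x₀ : E) (f : ℝ → E) : Prop where
  continuous : Continuous f
  zero : f 0 = x₀
  deriv : ∀ t : ℝ, 0 ≤ t → HasDerivWithinAt f (V t (f t)) (Set.Ici t) t

theorem HasDerivWithinAt.Ici_of_Icc {f : ℝ → E} {f' : E} {a b t : ℝ} (hat : a ≤ t) (htb : t < b)
    (h : HasDerivWithinAt f f' (Set.Icc a b) t) : HasDerivWithinAt f f' (Set.Ici t) t := by
  refine h.mono_of_mem_nhdsWithin ?_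
  filter_upwards [self_mem_nhdsWithin, mem_nhdsWithin_of_mem_nhds (Iio_mem_nhds htb)] with s h1 h2
  exact ⟨hat.trans h1, le_of_lt h2⟩

/-- The bounds are global in x, so Picard–Lindelöf applies on all of [0, n] at once; uniqueness
glues the solutions for different n. -/
theorem exists_isCurve [CompleteSpace E] {V : ℝ → E → E}
    (hc : ∀ x, Continuous fun t => V t x)
    (hlip : ∀ T : ℝ, ∃ K : ℝ≥0, ∀ t ∈ Set.Icc 0 T, LipschitzWith K (V t))
    (hbd : ∀ T : ℝ, ∃ L : ℝ≥0, ∀ t ∈ Set.Icc 0 T, ∀ x, ‖V t x‖ ≤ L) (x₀ : E) :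
    ∃ f : ℝ → E, IsCurve V x₀ f := by
  have hex : ∀ n : ℕ, ∃ α : ℝ → E, α 0 = x₀ ∧ ∀ t ∈ Set.Icc (0 : ℝ) n,
      HasDerivWithinAt α (V t (α t)) (Set.Icc (0 : ℝ) n) t := by
    intro n
    obtain ⟨K, hK⟩ := hlip n
    obtain ⟨L, hL⟩ := hbd n
    -- With speed at most L, a curve cannot leave the ball of radius Ln before time n, so the time
    -- interval need not shrink.
    have hp : IsPicardLindelof V (⟨0, by simp⟩ : Set.Icc (0 : ℝ) n) x₀ (L * n) 0 L K :=
      { lipschitzOnWith := fun t ht => (hK t ht).lipschitzOnWith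
        continuousOn := fun x _ => (hc x).continuousOn
        norm_le := fun t ht x _ => hL t ht x
        mul_max_le := by simp }
    exact hp.exists_eq_forall_mem_Icc_hasDerivWithinAt₀
  choose α hα0 hα using hex
  have huniq : ∀ m n : ℕ, ∀ t : ℝ, 0 ≤ t → t ≤ m → t ≤ n → α m t = α n t := by
    intro m n t ht hm hn
    obtain ⟨K, hK⟩ := hlip t
    have hcont : ∀ k : ℕ, t ≤ k → ContinuousOn (α k) (Set.Icc 0 t) := fun k hk s hs =>
      ((hα k s ⟨hs.1, hs.2.trans hk⟩).continuousWithinAt).mono (Set.Icc_subset_Icc_right hk)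
    have hder : ∀ k : ℕ, t ≤ k → ∀ s ∈ Set.Ico 0 t,
        HasDerivWithinAt (α k) (V s (α k s)) (Set.Ici s) s := fun k hk s hs =>
      HasDerivWithinAt.Ici_of_Icc hs.1 (hs.2.trans_le hk) (hα k s ⟨hs.1, hs.2.le.trans hk⟩)
    exact ODE_solution_unique_of_mem_Icc_right (s := fun _ => Set.univ)
      (fun s hs => (hK s ⟨hs.1, hs.2.le⟩).lipschitzOnWith) (hcont m hm) (hder m hm)
      (fun _ _ => Set.mem_univ _) (hcont n hn) (hder n hn) (fun _ _ => Set.mem_univ _)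
      (by rw [hα0, hα0]) ⟨ht, le_rfl⟩
  -- The curve is frozen at its initial value for negative times, which makes it continuous on the
  -- whole line.
  let f : ℝ → E := fun t => α (⌈t⌉₊ + 1) (max t 0)
  have hf : ∀ n : ℕ, ∀ t : ℝ, t ≤ n → f t = α n (max t 0) := by
    intro n t ht
    refine huniq _ _ _ (le_max_right _ _) (max_le ?_ (by positivity)) (max_le ht (by positivity))
    push_cast
    linarith [Nat.le_ceil t]
  refine ⟨f, ?_, ?_, ?_⟩
  · rw [continuous_iff_continuousAt]
    intro t
    obtain ⟨n, hn⟩ := exists_nat_gt t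
    have h1 : ContinuousOn (fun s => α n (max s 0)) (Set.Iio (n : ℝ)) := by
      refine ContinuousOn.comp (t := Set.Icc 0 (n : ℝ))
        (fun s hs => (hα n s hs).continuousWithinAt) (by fun_prop) (fun s hs => ?_)
      exact ⟨le_max_right _ _, max_le (le_of_lt hs) (by positivity)⟩
    refine (h1.continuousAt (Iio_mem_nhds hn)).congr ?_
    filter_upwards [Iio_mem_nhds hn] with s hs
    exact (hf n s (le_of_lt hs)).symm
  · rw [hf 0 0 (by simp)]; simp [hα0]
  · intro t ht
    obtain ⟨n, hn⟩ := exists_nat_gt t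
    have h1 := HasDerivWithinAt.Ici_of_Icc ht hn (hα n t ⟨ht, hn.le⟩)
    have h2 : f t = α n t := by rw [hf n t hn.le, max_eq_left ht]
    rw [h2]
    refine h1.congr_of_eventuallyEq ?_ h2
    filter_upwards [self_mem_nhdsWithin, mem_nhdsWithin_of_mem_nhds (Iio_mem_nhds hn)] with s h3 h4
    rw [hf n s (le_of_lt h4), max_eq_left (ht.trans h3)]

theorem IsCurve.eq_add_integral [CompleteSpace E] {V : ℝ → E → E} {x₀ : E} {f : ℝ → E}
    (h : IsCurve V x₀ f) (hc : Continuous fun t => V t (f t)) {t : ℝ} (ht : 0 ≤ t) :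
    f t = x₀ + ∫ s in (0 : ℝ)..t, V s (f s) := by
  have := intervalIntegral.integral_eq_sub_of_hasDeriv_right (a := 0) (b := t) (f := f)
    (f' := fun s => V s (f s)) h.continuous.continuousOn (fun s hs => ?_)
    (hc.intervalIntegrable 0 t)
  · rw [this, h.zero]; abel
  · rw [min_eq_left ht] at hs
    exact (h.deriv s hs.1.le).mono Set.Ioi_subset_Ici_self

theorem IsCurve.of_eq_add_integral {V : ℝ → E → E} [CompleteSpace E] {x₀ : E} {f : ℝ → E}
    (hf : Continuous f) (hc : Continuous fun t => V t (f t))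
    (h : ∀ t : ℝ, 0 ≤ t → f t = x₀ + ∫ s in (0 : ℝ)..t, V s (f s)) : IsCurve V x₀ f where
  continuous := hf
  zero := by rw [h 0 le_rfl]; simp
  deriv t ht := by
    have h1 : HasDerivAt (fun t => x₀ + ∫ s in (0 : ℝ)..t, V s (f s)) (V t (f t)) t :=
      (intervalIntegral.integral_hasDerivAt_right (hc.intervalIntegrable 0 t)
        hc.aestronglyMeasurable.stronglyMeasurableAtFilter hc.continuousAt).const_add x₀
    exact h1.hasDerivWithinAt.congr (fun s hs => h s (ht.trans hs)) (h t ht)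

/-- The radial retraction onto the closed ball of radius `R`. -/
def retract (R : ℝ) (x : E) : E := (R / max R ‖x‖) • x

theorem norm_retract_le {R : ℝ} (hR : 0 < R) (x : E) : ‖retract R x‖ ≤ R := by
  have h : 0 < max R ‖x‖ := hR.trans_le (le_max_left _ _)
  rw [retract, norm_smul, Real.norm_eq_abs, abs_of_pos (div_pos hR h), div_mul_eq_mul_div,
    div_le_iff₀ h]
  gcongr
  exact le_max_right _ _

theorem retract_of_norm_le {R : ℝ} (hR : 0 < R) {x : E} (hx : ‖x‖ ≤ R) : retract R x = x := by
  rw [retract, max_eq_left hx, div_self hR.ne', one_smul]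

theorem div_max_mem_unitInterval {R : ℝ} (hR : 0 < R) (r : ℝ) :
    0 ≤ R / max R r ∧ R / max R r ≤ 1 := by
  have h : 0 < max R r := hR.trans_le (le_max_left _ _)
  exact ⟨(div_pos hR h).le, (div_le_one h).mpr (le_max_left _ _)⟩

/-- In a general normed space the radial retraction is 2-Lipschitz: one factor comes from the vector
and one from the change of the scaling. `H11` carries a maximum norm, so a Hilbert space projection
argument is unavailable. -/
theorem norm_retract_sub_le {R : ℝ} (hR : 0 < R) (x y : E) :
    ‖retract R x - retract R y‖ ≤ 2 * ‖x - y‖ := by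
  set a := max R ‖x‖ with ha
  set b := max R ‖y‖ with hb
  have ha0 : 0 < a := hR.trans_le (le_max_left _ _)
  have hb0 : 0 < b := hR.trans_le (le_max_left _ _)
  have hab : |b - a| ≤ ‖x - y‖ := by
    refine (abs_max_sub_max_le_max R ‖y‖ R ‖x‖).trans ?_
    rw [sub_self, abs_zero, max_eq_right (abs_nonneg _)]
    rw [norm_sub_rev]
    exact abs_norm_sub_norm_le y x
  have e : retract R x - retract R y = (R / a) • (x - y) + (R / a * ((b - a) / b)) • y := by
    have : R / a * ((b - a) / b) = R / a - R / b := by field_simp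
    rw [this, retract, retract, ← ha, ← hb, smul_sub, sub_smul]
    abel
  have h1 : R / a ≤ 1 := (div_le_one ha0).mpr (le_max_left _ _)
  have h2 : ‖y‖ ≤ b := le_max_right _ _
  rw [e]
  refine (norm_add_le _ _).trans ?_
  rw [norm_smul, norm_smul, norm_mul, norm_div, Real.norm_eq_abs, Real.norm_eq_abs,
    norm_div, Real.norm_eq_abs, Real.norm_eq_abs, abs_of_pos hR, abs_of_pos ha0, abs_of_pos hb0]
  have h3 : |b - a| / b * ‖y‖ ≤ ‖x - y‖ := by
    rw [div_mul_eq_mul_div, div_le_iff₀ hb0]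
    gcongr
  have h4 : R / a * ‖x - y‖ ≤ 1 * ‖x - y‖ := by gcongr
  have h5 : R / a * (|b - a| / b) * ‖y‖ ≤ 1 * ‖x - y‖ := by
    rw [mul_assoc]
    have : 0 ≤ |b - a| / b * ‖y‖ := by positivity
    exact mul_le_mul h1 h3 this zero_le_one
  linarith

theorem continuous_retract {R : ℝ → ℝ} (hR : Continuous R) (hR0 : ∀ t, 0 < R t) {f : ℝ → E}
    (hf : Continuous f) : Continuous fun t => retract (R t) (f t) := by
  unfold retract
  refine Continuous.smul (hR.div (hR.max hf.norm) fun t => ?_) hf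
  exact ((hR0 t).trans_le (le_max_left _ _)).ne'

end Ode

/-- A differential inequality for the modulus of a complex valued function. -/
theorem norm_le_of_inner_deriv_lt {φ φ' : ℝ → ℂ} {b b' : ℝ → ℝ} {a T : ℝ}
    (hφ : ContinuousOn φ (Set.Icc a T))
    (hφ' : ∀ t ∈ Set.Ico a T, HasDerivWithinAt φ (φ' t) (Set.Ici t) t)
    (hb : ContinuousOn b (Set.Icc a T))
    (hb' : ∀ t ∈ Set.Ico a T, HasDerivWithinAt b (b' t) (Set.Ici t) t)
    (hpos : ∀ t ∈ Set.Icc a T, 0 < b t) (ha : ‖φ a‖ ≤ b a)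
    (bound : ∀ t ∈ Set.Ico a T, inner ℝ (φ t) (φ' t) < ‖φ t‖ * b' t ∨ φ t = 0) :
    ∀ t ∈ Set.Icc a T, ‖φ t‖ ≤ b t := by
  intro t ht
  -- The squared modulus is used because ‖φ‖ need not be differentiable at zeros. Contact with the
  -- barrier at a zero of φ is excluded by b > 0.
  have h := image_le_of_deriv_right_lt_deriv_boundary' (f := fun t => ‖φ t‖ ^ 2)
    (f' := fun t => 2 * inner ℝ (φ t) (φ' t)) (B := fun t => b t ^ 2)
    (B' := fun t => 2 * (b t * b' t)) (hφ.norm.pow 2) (fun s hs => (hφ' s hs).norm_sq)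
    (by gcongr) (hb.pow 2) (fun s hs => ?_) (fun s hs heq => ?_) ht
  · exact (sq_le_sq₀ (norm_nonneg _) (hpos t ht).le).mp h
  · have := (hb' s hs).pow 2
    exact this.congr_deriv (by push_cast; ring)
  · have hbs := hpos s ⟨hs.1, hs.2.le⟩
    have he : ‖φ s‖ = b s := by
      have := heq
      exact (sq_eq_sq₀ (norm_nonneg _) hbs.le).mp this
    rcases bound s hs with h1 | h1
    · rw [he] at h1
      linarith
    · rw [h1, norm_zero] at he
      linarith

end DMNLS

namespace DMNLS

open Filter Topology
open scoped BoundedContinuousFunction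

/-! ### The evolution of the Fourier transform of the profile -/

theorem norm_cubic_sub_le {A φ : ℂ} {K : ℝ} (hA : ‖A‖ ≤ K) (hφ : ‖φ‖ ≤ K) :
    ‖((‖A‖ ^ 2 : ℝ) : ℂ) * A - ((‖φ‖ ^ 2 : ℝ) : ℂ) * φ‖ ≤ 3 * K ^ 2 * ‖A - φ‖ := by
  have e : ((‖A‖ ^ 2 : ℝ) : ℂ) * A - ((‖φ‖ ^ 2 : ℝ) : ℂ) * φ
      = ((‖A‖ ^ 2 : ℝ) : ℂ) * (A - φ) + (((‖A‖ - ‖φ‖) * (‖A‖ + ‖φ‖) : ℝ) : ℂ) * φ := by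
    push_cast; ring
  have hK : 0 ≤ K := (norm_nonneg _).trans hA
  rw [e]
  refine (norm_add_le _ _).trans ?_
  rw [norm_mul, norm_mul, Complex.norm_real, Complex.norm_real, norm_mul, norm_pow, norm_norm,
    Real.norm_eq_abs, Real.norm_eq_abs, abs_of_nonneg (by positivity : 0 ≤ ‖A‖ + ‖φ‖)]
  have h1 : ‖A‖ ^ 2 * ‖A - φ‖ ≤ K ^ 2 * ‖A - φ‖ := by gcongr
  have h2 : |‖A‖ - ‖φ‖| * (‖A‖ + ‖φ‖) * ‖φ‖ ≤ ‖A - φ‖ * (K + K) * K := by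
    gcongr
    exact abs_norm_sub_norm_le A φ
  calc _ ≤ K ^ 2 * ‖A - φ‖ + ‖A - φ‖ * (K + K) * K := add_le_add h1 h2
    _ = _ := by ring

namespace H11

theorem norm_chirp_apply_le (s : ℝ) (f : H11) (y : ℝ) : ‖chirp s f y‖ ≤ 2 * ‖weight‖ * ‖f‖ :=
  ((chirp s f).norm_coe_le_norm y).trans (norm_chirp_le s f)

theorem norm_chirp_apply_sub_le (s : ℝ) (f : H11) (y : ℝ) :
    ‖chirp s f y - chirp 0 f y‖ ≤ 4 * ‖rpowWeight‖ * |s| ^ (1 / 8 : ℝ) * ‖f‖ :=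
  ((chirp s f - chirp 0 f).norm_coe_le_norm y).trans (norm_chirp_sub_le s f)

theorem norm_evol_sq_le {r : ℝ} (hr : 0 < r) (f : H11) :
    ‖evol r f‖ ^ 2 ≤ (4 * Real.pi * r)⁻¹ * (2 * ‖weight‖ * ‖f‖) ^ 2 := by
  have h0 : 0 ≤ 4 * Real.pi * r := by positivity
  have h1 : ‖evol r f‖ ≤ (4 * Real.pi * r) ^ (-(1 / 2) : ℝ) * (2 * ‖weight‖ * ‖f‖) :=
    (norm_evol_apply_le hr f).trans (by gcongr; exact norm_chirp_le _ _)
  calc ‖evol r f‖ ^ 2 ≤ ((4 * Real.pi * r) ^ (-(1 / 2) : ℝ) * (2 * ‖weight‖ * ‖f‖)) ^ 2 := by gcongr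
    _ = _ := by
      rw [mul_pow, ← Real.rpow_natCast, ← Real.rpow_mul h0]
      norm_num [Real.rpow_neg_one]

/-- The chirp is removed once from N_r(f), whose norm carries r⁻¹ by the dispersive bound, and once
inside the exact cubic expression, which has prefactor (4πr)⁻¹. Each removal costs r^{-1/8}, for a
total of r^{-9/8}. -/
theorem norm_chirp_cubicField_sub_le {r : ℝ} (hr : 0 < r) (f : H11) (y : ℝ) :
    ‖chirp 0 (cubicField r f) y - (((4 * Real.pi * r)⁻¹ * ‖chirp 0 f y‖ ^ 2 : ℝ) : ℂ) * chirp 0 f y‖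
      ≤ 24 * ‖rpowWeight‖ * (2 * ‖weight‖) ^ 2 * r ^ (-(9 / 8) : ℝ) * ‖f‖ ^ 3 := by
  set s := (4 * r)⁻¹ with hs
  set c := 2 * ‖weight‖ with hc
  set w := ‖rpowWeight‖ with hw
  have hs0 : 0 < s := by positivity
  have hpi := Real.pi_gt_three
  have hR : (4 * Real.pi * r)⁻¹ ≤ r⁻¹ := by
    apply inv_anti₀ hr
    nlinarith
  have hS : |s| ^ (1 / 8 : ℝ) ≤ r ^ (-(1 / 8) : ℝ) := by
    rw [abs_of_pos hs0, Real.rpow_neg hr.le, ← Real.inv_rpow hr.le]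
    apply Real.rpow_le_rpow hs0.le _ (by norm_num)
    apply inv_anti₀ hr
    linarith
  have hG : ‖cubicField r f‖ ≤ 3 * (r⁻¹ * (c * ‖f‖) ^ 2) * ‖f‖ := by
    refine (norm_cubicField_le r f).trans ?_
    gcongr
    exact (norm_evol_sq_le hr f).trans (by gcongr)
  have h1 : ‖chirp s (cubicField r f) y - chirp 0 (cubicField r f) y‖
      ≤ 4 * w * r ^ (-(1 / 8) : ℝ) * (3 * (r⁻¹ * (c * ‖f‖) ^ 2) * ‖f‖) :=
    (norm_chirp_apply_sub_le s _ y).trans (by gcongr)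
  have h2 : ‖chirp s f y - chirp 0 f y‖ ≤ 4 * w * r ^ (-(1 / 8) : ℝ) * ‖f‖ :=
    (norm_chirp_apply_sub_le s f y).trans (by gcongr)
  have h3 := norm_cubic_sub_le (norm_chirp_apply_le s f y) (norm_chirp_apply_le 0 f y)
  rw [← hc] at h3
  have h4 : ‖chirp s (cubicField r f) y
      - (((4 * Real.pi * r)⁻¹ * ‖chirp 0 f y‖ ^ 2 : ℝ) : ℂ) * chirp 0 f y‖
      ≤ r⁻¹ * (3 * (c * ‖f‖) ^ 2 * (4 * w * r ^ (-(1 / 8) : ℝ) * ‖f‖)) := by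
    rw [hs, chirp_cubicField hr, ← hs]
    have e : ((((4 * Real.pi * r)⁻¹ * ‖chirp s f y‖ ^ 2 : ℝ) : ℂ) * chirp s f y
        - (((4 * Real.pi * r)⁻¹ * ‖chirp 0 f y‖ ^ 2 : ℝ) : ℂ) * chirp 0 f y)
        = (((4 * Real.pi * r)⁻¹ : ℝ) : ℂ) * (((‖chirp s f y‖ ^ 2 : ℝ) : ℂ) * chirp s f y
          - ((‖chirp 0 f y‖ ^ 2 : ℝ) : ℂ) * chirp 0 f y) := by
      push_cast; ring
    rw [e, norm_mul, Complex.norm_real, Real.norm_eq_abs,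
      abs_of_pos (by positivity : 0 < (4 * Real.pi * r)⁻¹)]
    gcongr
    exact h3.trans (by gcongr)
  have hexp : r ^ (-(9 / 8) : ℝ) = r ^ (-(1 / 8) : ℝ) * r⁻¹ := by
    rw [← Real.rpow_neg_one r, ← Real.rpow_add hr]
    norm_num
  rw [norm_sub_rev] at h1
  calc _ ≤ _ := norm_sub_le_norm_sub_add_norm_sub _ (chirp s (cubicField r f) y) _
    _ ≤ _ := add_le_add h1 h4
    _ = _ := by rw [hexp]; ring

/-- For t ≥ 2B + 1 the time t + D is at least t/2, so powers of the two are comparable, and the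
coefficients (4πt)⁻¹ and (4π(t + D))⁻¹ differ by O(Bt⁻²), which is below t^{-9/8}. -/
theorem norm_chirp_cubicField_shift_le {B t D : ℝ} (ht : 2 * B + 1 ≤ t) (hD : |D| ≤ B)
    (f : H11) (y : ℝ) :
    ‖chirp 0 (cubicField (t + D) f) y
        - (((4 * Real.pi * t)⁻¹ * ‖chirp 0 f y‖ ^ 2 : ℝ) : ℂ) * chirp 0 f y‖
      ≤ (96 * ‖rpowWeight‖ * (2 * ‖weight‖) ^ 2 + B * (2 * ‖weight‖) ^ 3)
          * t ^ (-(9 / 8) : ℝ) * ‖f‖ ^ 3 := by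
  have hB : 0 ≤ B := (abs_nonneg D).trans hD
  have ht1 : 1 ≤ t := by linarith
  have ht0 : 0 < t := by linarith
  have hD' := abs_le.mp hD
  have hr : t / 2 ≤ t + D := by linarith
  have hr0 : 0 < t + D := by linarith
  set c := 2 * ‖weight‖ with hc
  have hpi := Real.pi_gt_three
  have h1 := norm_chirp_cubicField_sub_le hr0 f y
  have h2 : (t + D) ^ (-(9 / 8) : ℝ) ≤ 4 * t ^ (-(9 / 8) : ℝ) := by
    calc (t + D) ^ (-(9 / 8) : ℝ) ≤ (t / 2) ^ (-(9 / 8) : ℝ) :=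
          Real.rpow_le_rpow_of_nonpos (by positivity) hr (by norm_num)
      _ = t ^ (-(9 / 8) : ℝ) * 2 ^ (9 / 8 : ℝ) := by
          rw [Real.div_rpow ht0.le (by norm_num), Real.rpow_neg (by norm_num : (0 : ℝ) ≤ 2),
            div_inv_eq_mul]
      _ ≤ t ^ (-(9 / 8) : ℝ) * 2 ^ (2 : ℝ) := by
          gcongr
          · norm_num
          · norm_num
      _ = _ := by norm_num; ring
  have h3 : |(4 * Real.pi * (t + D))⁻¹ - (4 * Real.pi * t)⁻¹| ≤ B * t ^ (-(9 / 8) : ℝ) := by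
    have e : (4 * Real.pi * (t + D))⁻¹ - (4 * Real.pi * t)⁻¹
        = -D * (4 * Real.pi * (t + D) * t)⁻¹ := by
      field_simp; ring
    rw [e, abs_mul, abs_neg, abs_of_pos (by positivity : 0 < (4 * Real.pi * (t + D) * t)⁻¹)]
    gcongr
    calc (4 * Real.pi * (t + D) * t)⁻¹ ≤ (t ^ 2)⁻¹ := by
          apply inv_anti₀ (by positivity)
          have h5 : t ≤ 4 * Real.pi * (t + D) := by nlinarith
          nlinarith
      _ = t ^ (-2 : ℝ) := by
          rw [Real.rpow_neg ht0.le]; norm_num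
      _ ≤ t ^ (-(9 / 8) : ℝ) := Real.rpow_le_rpow_of_exponent_le ht1 (by norm_num)
  have h4 : ‖(((4 * Real.pi * (t + D))⁻¹ * ‖chirp 0 f y‖ ^ 2 : ℝ) : ℂ) * chirp 0 f y
      - (((4 * Real.pi * t)⁻¹ * ‖chirp 0 f y‖ ^ 2 : ℝ) : ℂ) * chirp 0 f y‖
      ≤ B * t ^ (-(9 / 8) : ℝ) * (c * ‖f‖) ^ 2 * (c * ‖f‖) := by
    rw [← sub_mul, ← Complex.ofReal_sub, ← sub_mul, norm_mul, Complex.norm_real, norm_mul,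
      Real.norm_eq_abs, norm_pow, norm_norm]
    have := norm_chirp_apply_le 0 f y
    rw [← hc] at this
    gcongr
  calc _ ≤ _ := norm_sub_le_norm_sub_add_norm_sub _
            ((((4 * Real.pi * (t + D))⁻¹ * ‖chirp 0 f y‖ ^ 2 : ℝ) : ℂ) * chirp 0 f y) _
    _ ≤ _ := add_le_add h1 h4
    _ ≤ 24 * ‖rpowWeight‖ * c ^ 2 * (4 * t ^ (-(9 / 8) : ℝ)) * ‖f‖ ^ 3
        + B * t ^ (-(9 / 8) : ℝ) * (c * ‖f‖) ^ 2 * (c * ‖f‖) := by gcongr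
    _ = _ := by ring

/-- Evaluation at a point of the Fourier transform. -/
def hatEval (y : ℝ) : H11 →L[ℂ] ℂ := (BoundedContinuousFunction.evalCLM ℂ y).comp (chirp 0)

theorem hatEval_apply (y : ℝ) (f : H11) : hatEval y f = chirp 0 f y := rfl

/-- The leading term no longer depends on τ, so averaging over one period leaves it unchanged: to
leading order the dispersion map is invisible. -/
theorem norm_chirp_field_add_le (dp dm tp : ℝ) {B t : ℝ} (ht : 2 * B + 1 ≤ t)
    (hB : ∀ τ ∈ Set.Icc (0 : ℝ) 1, |cumDispersion dp dm tp τ| ≤ B) (f : H11) (y : ℝ) :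
    ‖chirp 0 (field dp dm tp t f) y
        + Complex.I * ((((4 * Real.pi * t)⁻¹ * ‖chirp 0 f y‖ ^ 2 : ℝ) : ℂ) * chirp 0 f y)‖
      ≤ (96 * ‖rpowWeight‖ * (2 * ‖weight‖) ^ 2 + B * (2 * ‖weight‖) ^ 3)
          * t ^ (-(9 / 8) : ℝ) * ‖f‖ ^ 3 := by
  set m : ℂ := (((4 * Real.pi * t)⁻¹ * ‖chirp 0 f y‖ ^ 2 : ℝ) : ℂ) * chirp 0 f y with hm
  have hi : IntervalIntegrable
      (fun τ => cubicField (t + cumDispersion dp dm tp τ) f) volume 0 1 :=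
    (continuous_cubicField_tau dp dm tp t f).intervalIntegrable 0 1
  have e1 : chirp 0 (field dp dm tp t f) y
      = -Complex.I * ∫ τ in (0 : ℝ)..1, hatEval y (cubicField (t + cumDispersion dp dm tp τ) f) := by
    rw [← hatEval_apply, field, map_smul, (hatEval y).intervalIntegral_comp_comm hi, smul_eq_mul]
  have hc : Continuous fun τ => hatEval y (cubicField (t + cumDispersion dp dm tp τ) f) :=
    (hatEval y).continuous.comp (continuous_cubicField_tau dp dm tp t f)
  have e2 : chirp 0 (field dp dm tp t f) y + Complex.I * m
      = -Complex.I *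
        ∫ τ in (0 : ℝ)..1, (hatEval y (cubicField (t + cumDispersion dp dm tp τ) f) - m) := by
    rw [e1, intervalIntegral.integral_sub (hc.intervalIntegrable 0 1) (by simp)]
    simp
    ring
  rw [e2, norm_mul, norm_neg, Complex.norm_I, one_mul]
  refine (intervalIntegral.norm_integral_le_of_norm_le_const (C := (96 * ‖rpowWeight‖ *
    (2 * ‖weight‖) ^ 2 + B * (2 * ‖weight‖) ^ 3) * t ^ (-(9 / 8) : ℝ) * ‖f‖ ^ 3)
    fun τ hτ => ?_).trans (by simp)
  rw [Set.uIoc_of_le zero_le_one] at hτ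
  exact norm_chirp_cubicField_shift_le ht (hB τ ⟨hτ.1.le, hτ.2⟩) f y

end H11

end DMNLS

namespace DMNLS

open Filter Topology
open scoped BoundedContinuousFunction NNReal

namespace H11

/-! ### A priori bounds and global existence for small data -/

variable {dp dm tp : ℝ}

/-- The slowly growing radius at which the vector field is cut off. -/
def growth (ε t : ℝ) : ℝ := 2 * ε * (1 + |t|) ^ (1 / 100 : ℝ)

theorem growth_pos {ε : ℝ} (hε : 0 < ε) (t : ℝ) : 0 < growth ε t := by
  unfold growth; positivity

theorem continuous_growth (ε : ℝ) : Continuous (growth ε) := by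
  unfold growth
  refine continuous_const.mul (Continuous.rpow_const (by fun_prop) fun t => Or.inr (by norm_num))

theorem growth_le {ε t T : ℝ} (hε : 0 < ε) (ht : 0 ≤ t) (htT : t ≤ T) :
    growth ε t ≤ 2 * ε * (1 + T) := by
  unfold growth
  rw [abs_of_nonneg ht]
  gcongr
  calc (1 + t) ^ (1 / 100 : ℝ) ≤ (1 + t) ^ (1 : ℝ) :=
        Real.rpow_le_rpow_of_exponent_le (by linarith) (by norm_num)
    _ ≤ 1 + T := by rw [Real.rpow_one]; linarith

theorem growth_le_rpow {ε t : ℝ} (hε : 0 < ε) (ht : 1 ≤ t) :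
    growth ε t ≤ 4 * ε * t ^ (1 / 100 : ℝ) := by
  have ht0 : 0 ≤ t := by linarith
  have h : (1 + |t|) ^ (1 / 100 : ℝ) ≤ 2 * t ^ (1 / 100 : ℝ) := by
    rw [abs_of_nonneg ht0]
    calc (1 + t) ^ (1 / 100 : ℝ) ≤ (2 * t) ^ (1 / 100 : ℝ) := by gcongr; linarith
      _ = 2 ^ (1 / 100 : ℝ) * t ^ (1 / 100 : ℝ) := Real.mul_rpow (by norm_num) ht0
      _ ≤ 2 ^ (1 : ℝ) * t ^ (1 / 100 : ℝ) := by gcongr <;> norm_num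
      _ = _ := by rw [Real.rpow_one]
  unfold growth
  nlinarith

/-- The vector field of the profile equation, cut off at radius `growth ε t`. -/
def cutField (dp dm tp ε t : ℝ) (f : H11) : H11 := field dp dm tp t (retract (growth ε t) f)

theorem norm_field_le_cube (t : ℝ) {f : H11} {M : ℝ} (hf : ‖f‖ ≤ M) :
    ‖field dp dm tp t f‖ ≤ 3 * (2 * ‖weight‖) ^ 2 * M ^ 3 := by
  have hM : 0 ≤ M := (norm_nonneg f).trans hf
  refine (norm_field_le dp dm tp (B := 2 * ‖weight‖ * M) fun τ _ => ?_).trans ?_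
  · exact (norm_evol_le _ _).trans (by gcongr)
  · calc 3 * (2 * ‖weight‖ * M) ^ 2 * ‖f‖ ≤ 3 * (2 * ‖weight‖ * M) ^ 2 * M := by gcongr
      _ = _ := by ring

/-- On each [0, T] the cutoff radius is bounded, so the cut-off field is globally Lipschitz and
bounded. Global existence thus precedes every a priori estimate. -/
theorem exists_isCurve_cutField (dp dm tp : ℝ) {ε : ℝ} (hε : 0 < ε) (f₀ : H11) :
    ∃ f : ℝ → H11, IsCurve (cutField dp dm tp ε) f₀ f := by
  refine exists_isCurve (fun x => ?_) (fun T => ?_) (fun T => ?_) f₀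
  · exact (continuous_field dp dm tp).comp₂ continuous_id
      (continuous_retract (continuous_growth ε) (growth_pos hε) continuous_const)
  · refine ⟨(9 * (2 * ‖weight‖) ^ 2 * (2 * ε * (1 + T)) ^ 2 * 2).toNNReal, fun t ht => ?_⟩
    refine LipschitzWith.of_dist_le_mul fun x y => ?_
    rw [Real.coe_toNNReal _ (by positivity), dist_eq_norm, dist_eq_norm]
    have hR := growth_le hε ht.1 ht.2
    refine (norm_field_sub_le dp dm tp t ((norm_retract_le (growth_pos hε t) x).trans hR)
      ((norm_retract_le (growth_pos hε t) y).trans hR)).trans ?_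
    have := norm_retract_sub_le (growth_pos hε t) x y
    rw [mul_assoc _ 2]
    gcongr
  · refine ⟨(3 * (2 * ‖weight‖) ^ 2 * (2 * ε * (1 + T)) ^ 3).toNNReal, fun t ht x => ?_⟩
    have hT : 0 ≤ T := ht.1.trans ht.2
    rw [Real.coe_toNNReal _ (by positivity)]
    exact norm_field_le_cube t ((norm_retract_le (growth_pos hε t) x).trans
      (growth_le hε ht.1 ht.2))

/-- Crude control for bounded times, before the asymptotic equation is usable: the cut-off field is
at most cubic in ε, and ε³ ≤ ε. -/
theorem norm_le_of_isCurve_cutField_of_le {ε T : ℝ} {f₀ : H11} {f : ℝ → H11} (hε : 0 < ε)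
    (hε1 : ε ≤ 1) (hf₀ : ‖f₀‖ ≤ ε) (h : IsCurve (cutField dp dm tp ε) f₀ f) {t : ℝ}
    (ht : t ∈ Set.Icc 0 T) :
    ‖f t‖ ≤ (1 + 24 * (2 * ‖weight‖) ^ 2 * (1 + T) ^ 3 * T) * ε := by
  have hT : 0 ≤ T := ht.1.trans ht.2
  have h1 := norm_image_sub_le_of_norm_deriv_right_le_segment (f := f) (a := 0) (b := T)
    (C := 3 * (2 * ‖weight‖) ^ 2 * (2 * ε * (1 + T)) ^ 3) h.continuous.continuousOn
    (fun s hs => h.deriv s hs.1) (fun s hs => norm_field_le_cube s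
      ((norm_retract_le (growth_pos hε s) _).trans (growth_le hε hs.1 hs.2.le))) t ht
  rw [h.zero, sub_zero] at h1
  have h2 : ‖f t‖ ≤ ‖f₀‖ + ‖f t - f₀‖ := by
    simpa using norm_add_le f₀ (f t - f₀)
  have h3 : ε ^ 3 ≤ ε := by
    have : ε ^ 3 ≤ ε ^ 1 := pow_le_pow_of_le_one hε.le hε1 (by norm_num)
    simpa using this
  calc ‖f t‖ ≤ ε + 3 * (2 * ‖weight‖) ^ 2 * (2 * ε * (1 + T)) ^ 3 * t := by linarith
    _ ≤ ε + 3 * (2 * ‖weight‖) ^ 2 * (2 * ε * (1 + T)) ^ 3 * T := by gcongr; exact ht.2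
    _ = ε + 24 * (2 * ‖weight‖) ^ 2 * (1 + T) ^ 3 * T * ε ^ 3 := by ring
    _ ≤ ε + 24 * (2 * ‖weight‖) ^ 2 * (1 + T) ^ 3 * T * ε := by gcongr
    _ = _ := by ring

theorem chirp_real_smul (s a : ℝ) (f : H11) (y : ℝ) : chirp s (a • f) y = a * chirp s f y := by
  rw [(chirp s).map_smul_of_tower a f]
  simp

theorem inner_I_mul_real_mul (a : ℝ) (z : ℂ) : inner ℝ z (Complex.I * (a * z)) = 0 := by
  rw [Complex.inner]
  simp
  ring

/-- The coefficient of the error terms in the equation for the Fourier transform. -/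
def errConst (B : ℝ) : ℝ := 96 * ‖rpowWeight‖ * (2 * ‖weight‖) ^ 2 + B * (2 * ‖weight‖) ^ 3

theorem errConst_nonneg {B : ℝ} (hB : 0 ≤ B) : 0 ≤ errConst B := by
  unfold errConst; positivity

/-- The retraction multiplies by a real number, so the leading term is still i times a real multiple
of φ and is orthogonal to φ. Only the error survives: 64 is the cube of the 4 in `growth_le_rpow`,
and -219/200 = -9/8 + 3/100. -/
theorem inner_chirp_cutField_le {B ε t : ℝ} (hB0 : 0 ≤ B) (ht : 2 * B + 1 ≤ t)
    (hB : ∀ τ ∈ Set.Icc (0 : ℝ) 1, |cumDispersion dp dm tp τ| ≤ B) (hε : 0 < ε) (f : H11) (y : ℝ) :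
    inner ℝ (chirp 0 f y) (chirp 0 (cutField dp dm tp ε t f) y)
      ≤ ‖chirp 0 f y‖ * (64 * errConst B * ε ^ 3 * t ^ (-(219 / 200) : ℝ)) := by
  set F := retract (growth ε t) f with hF
  set lam := growth ε t / max (growth ε t) ‖f‖ with hlam
  set φ := chirp 0 f y with hφ
  have ht1 : 1 ≤ t := by linarith
  have ht0 : 0 < t := by linarith
  have hFy : chirp 0 F y = lam * φ := chirp_real_smul 0 lam f y
  have h1 := norm_chirp_field_add_le dp dm tp ht hB F y
  rw [hFy] at h1
  set m : ℝ := (4 * Real.pi * t)⁻¹ * ‖(lam : ℂ) * φ‖ ^ 2 with hm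
  have e : chirp 0 (cutField dp dm tp ε t f) y
      = (chirp 0 (field dp dm tp t F) y + Complex.I * ((m : ℂ) * (lam * φ)))
        - Complex.I * (((m * lam : ℝ) : ℂ) * φ) := by
    rw [cutField, ← hF]; push_cast; ring
  rw [e, inner_sub_right, inner_I_mul_real_mul, sub_zero]
  refine (real_inner_le_norm _ _).trans ?_
  gcongr
  refine h1.trans ?_
  have hFn : ‖F‖ ≤ 4 * ε * t ^ (1 / 100 : ℝ) :=
    (norm_retract_le (growth_pos hε t) f).trans (growth_le_rpow hε ht1)
  have hc := errConst_nonneg hB0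
  change errConst B * t ^ (-(9 / 8) : ℝ) * ‖F‖ ^ 3 ≤ _
  calc errConst B * t ^ (-(9 / 8) : ℝ) * ‖F‖ ^ 3
      ≤ errConst B * t ^ (-(9 / 8) : ℝ) * (4 * ε * t ^ (1 / 100 : ℝ)) ^ 3 := by gcongr
    _ = 64 * errConst B * ε ^ 3 * (t ^ (-(9 / 8) : ℝ) * (t ^ (1 / 100 : ℝ)) ^ 3) := by ring
    _ = _ := by
      rw [← Real.rpow_mul_natCast ht0.le, ← Real.rpow_add ht0]
      norm_num

theorem norm_chirp_le_of_isCurve_cutField {B ε : ℝ} {f₀ : H11} {f : ℝ → H11} (hB0 : 0 ≤ B)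
    (hB : ∀ τ ∈ Set.Icc (0 : ℝ) 1, |cumDispersion dp dm tp τ| ≤ B) (hε : 0 < ε) (hε1 : ε ≤ 1)
    (h : IsCurve (cutField dp dm tp ε) f₀ f) {K : ℝ} (hK : 0 ≤ K)
    (hT : ‖f (2 * B + 1)‖ ≤ K * ε) {t : ℝ} (ht : 2 * B + 1 ≤ t) (y : ℝ) :
    ‖chirp 0 (f t) y‖ ≤ (2 * ‖weight‖ * K + 1 + 20 * (64 * errConst B + 1)) * ε := by
  set T := 2 * B + 1 with hTdef
  have hT1 : 1 ≤ T := by linarith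
  have hc := errConst_nonneg hB0
  -- The added 1 makes the barrier's slope strictly larger than the error; the extra +1 in the
  -- initial value below makes the barrier positive.
  set A := 64 * errConst B + 1 with hA
  have hA0 : 0 < A := by positivity
  have hε3 : ε ^ 3 ≤ ε := by
    have : ε ^ 3 ≤ ε ^ 1 := pow_le_pow_of_le_one hε.le hε1 (by norm_num)
    simpa using this
  -- The barrier integrates Aε³s^{-219/200}, with 200/19 the reciprocal of the exponent 19/200. It
  -- remains bounded, so the Fourier transform is O(ε) uniformly in time.
  have hder : ∀ s : ℝ, 1 ≤ s → HasDerivAt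
      (fun s : ℝ => (2 * ‖weight‖ * K + 1) * ε + 200 / 19 * A * ε ^ 3 * (1 - s ^ (-(19 / 200) : ℝ)))
      (A * ε ^ 3 * s ^ (-(219 / 200) : ℝ)) s := by
    intro s hs
    have h1 := (Real.hasDerivAt_rpow_const (p := (-(19 / 200) : ℝ))
      (Or.inl (by linarith : s ≠ 0))).const_sub 1
    have h2 := (h1.const_mul (200 / 19 * A * ε ^ 3)).const_add ((2 * ‖weight‖ * K + 1) * ε)
    refine h2.congr_deriv ?_
    norm_num
    ring
  have hle1 : ∀ s : ℝ, 1 ≤ s → s ^ (-(19 / 200) : ℝ) ≤ 1 := fun s hs =>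
    Real.rpow_le_one_of_one_le_of_nonpos hs (by norm_num)
  have key := norm_le_of_inner_deriv_lt (φ := fun s => chirp 0 (f s) y)
    (φ' := fun s => chirp 0 (cutField dp dm tp ε s (f s)) y) (a := T) (T := t)
    (b := fun s : ℝ => (2 * ‖weight‖ * K + 1) * ε
      + 200 / 19 * A * ε ^ 3 * (1 - s ^ (-(19 / 200) : ℝ)))
    (b' := fun s => A * ε ^ 3 * s ^ (-(219 / 200) : ℝ))
    ((hatEval y).continuous.comp h.continuous).continuousOn
    (fun s hs => ((hatEval y).restrictScalars ℝ).hasFDerivAt.comp_hasDerivWithinAt s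
      (h.deriv s (by linarith [hs.1])))
    (fun s hs => (hder s (by linarith [hs.1])).continuousAt.continuousWithinAt)
    (fun s hs => (hder s (by linarith [hs.1])).hasDerivWithinAt)
    (fun s hs => ?_) ?_ (fun s hs => ?_) t ⟨ht, le_rfl⟩
  · refine key.trans ?_
    have h0 : 0 ≤ t ^ (-(19 / 200) : ℝ) := by
      have : 0 ≤ t := by linarith
      positivity
    have h1 : 200 / 19 * A * ε ^ 3 * (1 - t ^ (-(19 / 200) : ℝ)) ≤ 20 * A * ε * 1 := by
      have := hle1 t (by linarith)
      have h2 : 0 ≤ 1 - t ^ (-(19 / 200) : ℝ) := by linarith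
      have h3 : 1 - t ^ (-(19 / 200) : ℝ) ≤ 1 := by linarith
      gcongr
      norm_num
    linarith
  · have := hle1 s (by linarith [hs.1])
    have h2 : 0 ≤ 1 - s ^ (-(19 / 200) : ℝ) := by linarith
    positivity
  · have := hle1 T hT1
    have h2 : 0 ≤ 1 - T ^ (-(19 / 200) : ℝ) := by linarith
    have h3 : 0 ≤ 200 / 19 * A * ε ^ 3 * (1 - T ^ (-(19 / 200) : ℝ)) := by positivity
    have h4 : 2 * ‖weight‖ * ‖f T‖ ≤ 2 * ‖weight‖ * (K * ε) := by gcongr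
    have h5 := norm_chirp_apply_le 0 (f T) y
    change ‖chirp 0 (f T) y‖ ≤ _
    linarith
  · by_cases h0 : chirp 0 (f s) y = 0
    · exact Or.inr h0
    · left
      refine (inner_chirp_cutField_le hB0 hs.1 hB hε (f s) y).trans_lt ?_
      have : 0 < s := by linarith [hs.1]
      have h1 : 0 < ‖chirp 0 (f s) y‖ := norm_pos_iff.mpr h0
      have h2 : 64 * errConst B < A := by rw [hA]; linarith
      gcongr

theorem norm_retract_le_norm {R : ℝ} (hR : 0 < R) (f : H11) : ‖retract R f‖ ≤ ‖f‖ := by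
  have h := div_max_mem_unitInterval hR ‖f‖
  rw [retract, norm_smul, Real.norm_eq_abs, abs_of_nonneg h.1]
  exact mul_le_of_le_one_left (norm_nonneg _) h.2

/-- The kernel formula reduces decay to the chirped transform, which differs from the Fourier
transform by at most t^{-1/8} t^{1/100} ≤ 1 times ε. Finally 4π(t + D) ≥ 2πt ≥ 1 + t. -/
theorem norm_evol_retract_le {B ε t D Q : ℝ} {f : H11} (hε : 0 < ε)
    (ht : 2 * B + 1 ≤ t) (hD : |D| ≤ B) (hQ : ∀ y, ‖chirp 0 f y‖ ≤ Q) :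
    ‖evol (t + D) (retract (growth ε t) f)‖
      ≤ (1 + t) ^ (-(1 / 2) : ℝ) * (Q + 32 * ‖rpowWeight‖ * ε) := by
  have hB0 : 0 ≤ B := (abs_nonneg D).trans hD
  have ht1 : 1 ≤ t := by linarith
  have ht0 : 0 < t := by linarith
  have hD' := abs_le.mp hD
  have hr : t / 2 ≤ t + D := by linarith
  have hr0 : 0 < t + D := by linarith
  have hQ0 : 0 ≤ Q := (norm_nonneg _).trans (hQ 0)
  have hpi := Real.pi_gt_three
  set F := retract (growth ε t) f with hF
  have hFn : ‖F‖ ≤ 4 * ε * t ^ (1 / 100 : ℝ) :=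
    (norm_retract_le (growth_pos hε t) f).trans (growth_le_rpow hε ht1)
  have h0 : ∀ y, ‖chirp 0 F y‖ ≤ Q := by
    intro y
    have h := div_max_mem_unitInterval (growth_pos hε t) ‖f‖
    rw [hF, retract, chirp_real_smul, norm_mul, Complex.norm_real, Real.norm_eq_abs,
      abs_of_nonneg h.1]
    exact (mul_le_of_le_one_left (norm_nonneg _) h.2).trans (hQ y)
  have hS : |(4 * (t + D))⁻¹| ^ (1 / 8 : ℝ) ≤ t ^ (-(1 / 8) : ℝ) := by
    rw [abs_of_pos (by positivity), Real.rpow_neg ht0.le, ← Real.inv_rpow ht0.le]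
    apply Real.rpow_le_rpow (by positivity) _ (by norm_num)
    apply inv_anti₀ ht0
    linarith
  have hone : t ^ (-(1 / 8) : ℝ) * t ^ (1 / 100 : ℝ) ≤ 1 := by
    rw [← Real.rpow_add ht0]
    exact Real.rpow_le_one_of_one_le_of_nonpos ht1 (by norm_num)
  have h1 : ‖chirp (4 * (t + D))⁻¹ F‖ ≤ Q + 32 * ‖rpowWeight‖ * ε := by
    refine (BoundedContinuousFunction.norm_le (by positivity)).mpr fun y => ?_
    have h2 := norm_chirp_apply_sub_le (4 * (t + D))⁻¹ F y
    have h3 : 4 * ‖rpowWeight‖ * |(4 * (t + D))⁻¹| ^ (1 / 8 : ℝ) * ‖F‖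
        ≤ 16 * ‖rpowWeight‖ * ε * 1 := by
      calc _ ≤ 4 * ‖rpowWeight‖ * t ^ (-(1 / 8) : ℝ) * (4 * ε * t ^ (1 / 100 : ℝ)) := by gcongr
        _ = 16 * ‖rpowWeight‖ * ε * (t ^ (-(1 / 8) : ℝ) * t ^ (1 / 100 : ℝ)) := by ring
        _ ≤ _ := by gcongr
    have h4 : ‖chirp (4 * (t + D))⁻¹ F y‖
        ≤ ‖chirp 0 F y‖ + ‖chirp (4 * (t + D))⁻¹ F y - chirp 0 F y‖ := by
      simpa using norm_add_le (chirp 0 F y) (chirp (4 * (t + D))⁻¹ F y - chirp 0 F y)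
    have h5 : 0 ≤ ‖rpowWeight‖ * ε := by positivity
    linarith [h0 y]
  refine (norm_evol_apply_le hr0 F).trans ?_
  gcongr ?_ * ?_
  · exact Real.rpow_le_rpow_of_nonpos (by linarith) (by nlinarith) (by norm_num)

end H11

end DMNLS

namespace DMNLS

open Filter Topology

/-! ### Closing the bootstrap: the cutoff is never active -/

namespace H11

/-- Global existence and the sharp dispersive decay for small data. -/
theorem exists_global_curve (dp dm tp : ℝ) : ∃ ε₀ : ℝ, 0 < ε₀ ∧ ∃ C : ℝ, 0 < C ∧
    ∀ (f₀ : H11) (ε : ℝ), 0 < ε → ε ≤ ε₀ → ‖f₀‖ ≤ ε → ∃ f : ℝ → H11,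
      IsCurve (field dp dm tp) f₀ f ∧ (∀ t, 0 ≤ t → ‖f t‖ ≤ growth ε t) ∧
      (∀ t, 0 ≤ t → ‖evol t (f t)‖ ≤ C * ε * (1 + t) ^ (-(1 / 2) : ℝ)) ∧
      ∀ t, 0 ≤ t → ∀ y, ‖chirp 0 (f t) y‖ ≤ C * ε := by
  obtain ⟨B, hB0, hB⟩ := exists_cumDispersion_bound dp dm tp
  set T := 2 * B + 1 with hTdef
  have hT1 : 1 ≤ T := by linarith
  set K := 1 + 24 * (2 * ‖weight‖) ^ 2 * (1 + T) ^ 3 * T with hK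
  have hK0 : 0 ≤ K := by positivity
  have hE := errConst_nonneg hB0
  set Q := 2 * ‖weight‖ * K + 1 + 20 * (64 * errConst B + 1) with hQ
  have hQ0 : 0 < Q := by positivity
  set C := 2 * ‖weight‖ * K * (1 + T) + Q + 32 * ‖rpowWeight‖ with hC
  -- The summands of C cover the bounded times t ≤ T, the Fourier bound, and the chirp error. The
  -- choice of ε₀ gives 25Cε ≤ 1, hence 600C²ε² ≤ 625C²ε² ≤ 1.
  have hC0 : 0 < C := by positivity
  refine ⟨min 1 (1 / (25 * (C + 1))), by positivity, C, hC0, fun f₀ ε hε hεle hf₀ => ?_⟩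
  have hε1 : ε ≤ 1 := hεle.trans (min_le_left _ _)
  have hεC : 600 * C ^ 2 * ε ^ 2 ≤ 1 := by
    have h1 : ε ≤ 1 / (25 * (C + 1)) := hεle.trans (min_le_right _ _)
    rw [le_div_iff₀ (by positivity)] at h1
    have h2 : 25 * (C * ε) ≤ 1 := by nlinarith
    have h3 : 0 ≤ C * ε := by positivity
    nlinarith
  obtain ⟨f, h⟩ := exists_isCurve_cutField dp dm tp hε f₀
  have hshort : ∀ t ∈ Set.Icc 0 T, ‖f t‖ ≤ K * ε := fun t ht =>
    norm_le_of_isCurve_cutField_of_le hε hε1 hf₀ h ht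
  have hhat : ∀ t, T ≤ t → ∀ y, ‖chirp 0 (f t) y‖ ≤ Q * ε := fun t ht y =>
    norm_chirp_le_of_isCurve_cutField hB0 hB hε hε1 h hK0 (hshort T ⟨by linarith, le_rfl⟩) ht y
  have hevol : ∀ t, 0 ≤ t → ∀ τ ∈ Set.Icc (0 : ℝ) 1,
      ‖evol (t + cumDispersion dp dm tp τ) (retract (growth ε t) (f t))‖
        ≤ C * ε * (1 + t) ^ (-(1 / 2) : ℝ) := by
    intro t ht τ hτ
    have hp : 0 < (1 + t) ^ (-(1 / 2) : ℝ) := by positivity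
    rcases le_total t T with htT | htT
    · have h1 : ‖retract (growth ε t) (f t)‖ ≤ K * ε :=
        (norm_retract_le_norm (growth_pos hε t) _).trans (hshort t ⟨ht, htT⟩)
      have h2 : 1 ≤ (1 + T) * (1 + t) ^ (-(1 / 2) : ℝ) := by
        calc (1 : ℝ) = (1 + T) * (1 + T)⁻¹ := (mul_inv_cancel₀ (by positivity)).symm
          _ ≤ (1 + T) * (1 + t)⁻¹ := by gcongr
          _ = (1 + T) * (1 + t) ^ (-1 : ℝ) := by rw [Real.rpow_neg_one]
          _ ≤ _ := by
            gcongr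
            · linarith
            · norm_num
      calc _ ≤ 2 * ‖weight‖ * ‖retract (growth ε t) (f t)‖ := norm_evol_le _ _
        _ ≤ 2 * ‖weight‖ * (K * ε) * 1 := by rw [mul_one]; gcongr
        _ ≤ 2 * ‖weight‖ * (K * ε) * ((1 + T) * (1 + t) ^ (-(1 / 2) : ℝ)) := by gcongr
        _ = 2 * ‖weight‖ * K * (1 + T) * ε * (1 + t) ^ (-(1 / 2) : ℝ) := by ring
        _ ≤ _ := by
          gcongr
          have : 0 ≤ ‖rpowWeight‖ := norm_nonneg _
          linarith
    · have h1 := norm_evol_retract_le hε htT (hB τ hτ) (hhat t htT)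
      calc _ ≤ _ := h1
        _ = (Q + 32 * ‖rpowWeight‖) * ε * (1 + t) ^ (-(1 / 2) : ℝ) := by ring
        _ ≤ _ := by
          gcongr
          have : 0 ≤ 2 * ‖weight‖ * K * (1 + T) := by positivity
          linarith
  have hfield : ∀ t, 0 ≤ t → ‖cutField dp dm tp ε t (f t)‖
      ≤ 6 * C ^ 2 * ε ^ 3 * (1 + t) ^ (-(99 / 100) : ℝ) := by
    intro t ht
    have ht' : 0 < 1 + t := by linarith
    have e1 : ((1 + t) ^ (-(1 / 2) : ℝ)) ^ 2 = (1 + t) ^ (-1 : ℝ) := by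
      rw [← Real.rpow_mul_natCast ht'.le]; norm_num
    have e2 : (1 + t) ^ (-(99 / 100) : ℝ) = (1 + t) ^ (-1 : ℝ) * (1 + t) ^ (1 / 100 : ℝ) := by
      rw [← Real.rpow_add ht']; norm_num
    refine (norm_field_le dp dm tp (hevol t ht)).trans ?_
    calc _ ≤ 3 * (C * ε * (1 + t) ^ (-(1 / 2) : ℝ)) ^ 2 * growth ε t := by
          gcongr
          exact norm_retract_le (growth_pos hε t) _
      _ = _ := by
          rw [growth, abs_of_nonneg ht, mul_pow, e1, e2]; ring
  -- Integrating `hfield` gives the factor 600 = 6 · 100. Since 600C²ε² ≤ 1, the result is ‖f‖ ≤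
  -- ε(1+t)^{1/100}, half the cutoff radius.
  have hgrow : ∀ t, 0 ≤ t → ‖f t‖ ≤ growth ε t := by
    intro t ht
    have hder : ∀ s : ℝ, 0 ≤ s → HasDerivAt
        (fun s : ℝ => ε + 600 * C ^ 2 * ε ^ 3 * ((1 + s) ^ (1 / 100 : ℝ) - 1))
        (6 * C ^ 2 * ε ^ 3 * (1 + s) ^ (-(99 / 100) : ℝ)) s := by
      intro s hs
      have h1 := ((hasDerivAt_id s).const_add 1).rpow_const (p := (1 / 100 : ℝ))
        (Or.inl (by simp; linarith))
      have h2 := ((h1.sub_const 1).const_mul (600 * C ^ 2 * ε ^ 3)).const_add ε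
      refine h2.congr_deriv ?_
      norm_num
      ring
    have h1 := image_norm_le_of_norm_deriv_right_le_deriv_boundary' (a := 0) (b := t)
      h.continuous.continuousOn (fun s hs => h.deriv s hs.1)
      (B := fun s : ℝ => ε + 600 * C ^ 2 * ε ^ 3 * ((1 + s) ^ (1 / 100 : ℝ) - 1))
      (by simpa [h.zero] using hf₀)
      (fun s hs => (hder s hs.1).continuousAt.continuousWithinAt)
      (fun s hs => (hder s hs.1).hasDerivWithinAt) (fun s hs => hfield s hs.1)
      (Set.right_mem_Icc.mpr ht)
    have h2 : 1 ≤ (1 + t) ^ (1 / 100 : ℝ) := Real.one_le_rpow (by linarith) (by norm_num)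
    have h3 : 600 * C ^ 2 * ε ^ 3 * ((1 + t) ^ (1 / 100 : ℝ) - 1)
        ≤ 1 * ε * ((1 + t) ^ (1 / 100 : ℝ) - 1) := by
      have : 0 ≤ (1 + t) ^ (1 / 100 : ℝ) - 1 := by linarith
      calc _ = 600 * C ^ 2 * ε ^ 2 * ε * ((1 + t) ^ (1 / 100 : ℝ) - 1) := by ring
        _ ≤ _ := by gcongr
    rw [growth, abs_of_nonneg ht]
    have h4 : ‖f t‖ ≤ ε * (1 + t) ^ (1 / 100 : ℝ) := by
      refine h1.trans ?_
      linarith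
    have h5 : 0 ≤ ε * (1 + t) ^ (1 / 100 : ℝ) := by positivity
    linarith
  have heq : ∀ t, 0 ≤ t → retract (growth ε t) (f t) = f t := fun t ht =>
    retract_of_norm_le (growth_pos hε t) (hgrow t ht)
  refine ⟨f, ⟨h.continuous, h.zero, fun t ht => ?_⟩, hgrow, fun t ht => ?_, fun t ht y => ?_⟩
  · have := h.deriv t ht
    rwa [cutField, heq t ht] at this
  · have := hevol t ht 0 (by simp)
    rwa [heq t ht, show cumDispersion dp dm tp 0 = 0 by simp [cumDispersion], add_zero] at this
  · rcases le_total t T with htT | htT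
    · calc _ ≤ 2 * ‖weight‖ * ‖f t‖ := norm_chirp_apply_le _ _ _
        _ ≤ 2 * ‖weight‖ * (K * ε) := by gcongr; exact hshort t ⟨ht, htT⟩
        _ = 2 * ‖weight‖ * K * 1 * ε := by ring
        _ ≤ (2 * ‖weight‖ * K * (1 + T) + Q + 32 * ‖rpowWeight‖) * ε := by
          gcongr ?_ * ε
          have h1 : 2 * ‖weight‖ * K * 1 ≤ 2 * ‖weight‖ * K * (1 + T) := by gcongr; linarith
          have : 0 ≤ ‖rpowWeight‖ := norm_nonneg _
          linarith
    · refine (hhat t htT y).trans ?_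
      gcongr
      have : 0 ≤ 2 * ‖weight‖ * K * (1 + T) := by positivity
      have : 0 ≤ ‖rpowWeight‖ := norm_nonneg _
      linarith

end H11

end DMNLS

namespace DMNLS

open Filter Topology

/-! ### Modified scattering -/

/-- Multiplication by the phase factor `exp (i a |z|²)`. -/
def twist (a : ℝ) (z : ℂ) : ℂ := Complex.exp (Complex.I * ((a * ‖z‖ ^ 2 : ℝ) : ℂ)) * z

theorem norm_exp_I_mul_real (a : ℝ) : ‖Complex.exp (Complex.I * (a : ℂ))‖ = 1 := by
  rw [mul_comm, Complex.norm_exp_ofReal_mul_I]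

theorem norm_twist (a : ℝ) (z : ℂ) : ‖twist a z‖ = ‖z‖ := by
  rw [twist, norm_mul, norm_exp_I_mul_real, one_mul]

theorem twist_neg_twist (a : ℝ) (z : ℂ) : twist (-a) (twist a z) = z := by
  rw [twist, norm_twist, twist, ← mul_assoc, ← Complex.exp_add]
  push_cast
  rw [show Complex.I * (-a * (‖z‖ : ℂ) ^ 2) + Complex.I * (a * (‖z‖ : ℂ) ^ 2) = 0 by ring,
    Complex.exp_zero, one_mul]

theorem continuous_twist (a : ℝ) : Continuous (twist a) := by
  unfold twist; fun_prop

/-- The phase depends on |z|², so the Lipschitz constant grows linearly in a. With a of size log t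
this is the loss absorbed later by t^{1/100}. -/
theorem norm_twist_sub_le {M : ℝ} (a : ℝ) {z w : ℂ} (hz : ‖z‖ ≤ M) (hw : ‖w‖ ≤ M) :
    ‖twist a z - twist a w‖ ≤ (1 + 2 * |a| * M ^ 2) * ‖z - w‖ := by
  have hM : 0 ≤ M := (norm_nonneg z).trans hz
  have e : twist a z - twist a w = Complex.exp (Complex.I * ((a * ‖z‖ ^ 2 : ℝ) : ℂ)) * (z - w)
      + Complex.exp (Complex.I * ((a * ‖w‖ ^ 2 : ℝ) : ℂ)) *
        (Complex.exp (Complex.I * ((a * (‖z‖ ^ 2 - ‖w‖ ^ 2) : ℝ) : ℂ)) - 1) * w := by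
    rw [mul_sub (Complex.exp (Complex.I * ((a * ‖w‖ ^ 2 : ℝ) : ℂ))), ← Complex.exp_add, twist, twist]
    rw [show Complex.I * ((a * ‖w‖ ^ 2 : ℝ) : ℂ) + Complex.I * ((a * (‖z‖ ^ 2 - ‖w‖ ^ 2) : ℝ) : ℂ)
      = Complex.I * ((a * ‖z‖ ^ 2 : ℝ) : ℂ) by push_cast; ring]
    ring
  rw [e]
  refine (norm_add_le _ _).trans ?_
  rw [norm_mul, norm_mul, norm_mul, norm_exp_I_mul_real, norm_exp_I_mul_real, one_mul, one_mul]
  have h1 : ‖Complex.exp (Complex.I * ((a * (‖z‖ ^ 2 - ‖w‖ ^ 2) : ℝ) : ℂ)) - 1‖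
      ≤ |a| * (‖z - w‖ * (M + M)) := by
    refine (Real.norm_exp_I_mul_ofReal_sub_one_le).trans ?_
    rw [Real.norm_eq_abs, abs_mul, sq_sub_sq, abs_mul, mul_comm |‖z‖ + ‖w‖|]
    rw [abs_of_nonneg (by positivity : 0 ≤ ‖z‖ + ‖w‖)]
    gcongr
    exact abs_norm_sub_norm_le z w
  have h2 : ‖Complex.exp (Complex.I * ((a * (‖z‖ ^ 2 - ‖w‖ ^ 2) : ℝ) : ℂ)) - 1‖ * ‖w‖
      ≤ |a| * (‖z - w‖ * (M + M)) * M := by gcongr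
  calc _ ≤ ‖z - w‖ + |a| * (‖z - w‖ * (M + M)) * M := by linarith
    _ = _ := by ring

/-- The a' part of the phase derivative cancels the resonant term. That term is orthogonal to φ, so
the derivative of |φ|² sees only the error e. -/
theorem hasDerivWithinAt_twist {φ : ℝ → ℂ} {φ' e : ℂ} {a : ℝ → ℝ} {a' t : ℝ} {s : Set ℝ}
    (ha : HasDerivWithinAt a a' s t) (hφ : HasDerivWithinAt φ φ' s t)
    (he : φ' = e - Complex.I * (((a' * ‖φ t‖ ^ 2 : ℝ) : ℂ) * φ t)) :
    HasDerivWithinAt (fun r => twist (a r) (φ r))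
      (Complex.exp (Complex.I * ((a t * ‖φ t‖ ^ 2 : ℝ) : ℂ))
        * (e + Complex.I * ((2 * a t * inner ℝ (φ t) e : ℝ) : ℂ) * φ t)) s t := by
  have hin : inner ℝ (φ t) φ' = inner ℝ (φ t) e := by
    rw [he, inner_sub_right, H11.inner_I_mul_real_mul, sub_zero]
  have h1 := (ha.mul hφ.norm_sq).ofReal_comp
  have h2 := ((h1.const_mul Complex.I).cexp).mul hφ
  refine h2.congr_deriv ?_
  rw [hin]
  simp only [Pi.mul_apply]
  rw [he]
  push_cast
  ring

theorem abs_log_div_le {t : ℝ} (ht : 1 ≤ t) :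
    |Real.log t / (4 * Real.pi)| ≤ 100 * t ^ (1 / 100 : ℝ) := by
  have h0 : 0 ≤ Real.log t := Real.log_nonneg ht
  have hpi := Real.pi_gt_three
  rw [abs_of_nonneg (by positivity)]
  have h1 := Real.log_le_rpow_div (by linarith : 0 ≤ t) (by norm_num : (0 : ℝ) < 1 / 100)
  calc Real.log t / (4 * Real.pi) ≤ Real.log t := div_le_self h0 (by linarith)
    _ ≤ t ^ (1 / 100 : ℝ) / (1 / 100) := h1
    _ = _ := by ring

theorem one_add_log_le {t M : ℝ} (ht : 1 ≤ t) :
    1 + 2 * |Real.log t / (4 * Real.pi)| * M ^ 2 ≤ (1 + 200 * M ^ 2) * t ^ (1 / 100 : ℝ) := by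
  have h1 := abs_log_div_le ht
  have h2 : 1 ≤ t ^ (1 / 100 : ℝ) := Real.one_le_rpow ht (by norm_num)
  have h3 : 2 * |Real.log t / (4 * Real.pi)| * M ^ 2 ≤ 2 * (100 * t ^ (1 / 100 : ℝ)) * M ^ 2 := by
    gcongr
  linarith

theorem norm_sub_le_of_deriv_le_rpow {w w' : ℝ → ℂ} {L s t : ℝ} (hs : 0 < s) (hst : s ≤ t)
    (hL : 0 ≤ L) (hc : ContinuousOn w (Set.Icc s t))
    (hw : ∀ r ∈ Set.Ico s t, HasDerivWithinAt w (w' r) (Set.Ici r) r)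
    (hw' : ∀ r ∈ Set.Ico s t, ‖w' r‖ ≤ L * r ^ (-(217 / 200) : ℝ)) :
    ‖w t - w s‖ ≤ 12 * L * s ^ (-(17 / 200) : ℝ) := by
  have hder : ∀ r : ℝ, s ≤ r → HasDerivAt
      (fun r : ℝ => 200 / 17 * L * (s ^ (-(17 / 200) : ℝ) - r ^ (-(17 / 200) : ℝ)))
      (L * r ^ (-(217 / 200) : ℝ)) r := by
    intro r hr
    have h1 := (Real.hasDerivAt_rpow_const (p := (-(17 / 200) : ℝ))
      (Or.inl (by linarith : r ≠ 0))).const_sub (s ^ (-(17 / 200) : ℝ))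
    refine (h1.const_mul (200 / 17 * L)).congr_deriv ?_
    norm_num
    ring
  have hcs : ContinuousOn (fun r => w r - w s) (Set.Icc s t) := hc.sub continuousOn_const
  have hds : ∀ r ∈ Set.Ico s t, HasDerivWithinAt (fun r => w r - w s) (w' r) (Set.Ici r) r :=
    fun r hr => (hw r hr).sub_const _
  -- The barrier integrates Lr^{-217/200}; its constant 200/17 is rounded up to 12.
  have key := image_norm_le_of_norm_deriv_right_le_deriv_boundary' hcs hds
    (B := fun r : ℝ => 200 / 17 * L * (s ^ (-(17 / 200) : ℝ) - r ^ (-(17 / 200) : ℝ)))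
    (by rw [sub_self, sub_self, norm_zero, mul_zero])
    (fun r hr => (hder r hr.1).continuousAt.continuousWithinAt)
    (fun r hr => (hder r hr.1).hasDerivWithinAt) hw' (Set.right_mem_Icc.mpr hst)
  refine key.trans ?_
  have h1 : 0 ≤ t ^ (-(17 / 200) : ℝ) := Real.rpow_nonneg (by linarith) _
  have h2 : 0 ≤ s ^ (-(17 / 200) : ℝ) := by positivity
  have h3 : 200 / 17 * L * (s ^ (-(17 / 200) : ℝ) - t ^ (-(17 / 200) : ℝ))
      ≤ 200 / 17 * L * s ^ (-(17 / 200) : ℝ) := by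
    gcongr
    linarith
  have h4 : 0 ≤ L * s ^ (-(17 / 200) : ℝ) := by positivity
  linarith

/-- The logarithm in the derivative of the phase costs t^{1/100}, so the rate becomes -219/200 +
1/100 = -217/200, still integrable. -/
theorem exists_deriv_twist_log {φ : ℝ → ℂ} {φ' : ℂ} {r M K : ℝ} (hr : 1 ≤ r)
    (hφ : HasDerivWithinAt φ φ' (Set.Ici r) r) (hM : ‖φ r‖ ≤ M)
    (hK : ‖φ' + Complex.I * ((((4 * Real.pi * r)⁻¹ * ‖φ r‖ ^ 2 : ℝ) : ℂ) * φ r)‖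
      ≤ K * r ^ (-(219 / 200) : ℝ)) :
    ∃ w' : ℂ, HasDerivWithinAt (fun r => twist (Real.log r / (4 * Real.pi)) (φ r)) w'
      (Set.Ici r) r ∧ ‖w'‖ ≤ K * (1 + 200 * M ^ 2) * r ^ (-(217 / 200) : ℝ) := by
  have hr0 : 0 < r := by linarith
  have hM0 : 0 ≤ M := (norm_nonneg _).trans hM
  have hlog : HasDerivWithinAt (fun r => Real.log r / (4 * Real.pi))
      (4 * Real.pi * r)⁻¹ (Set.Ici r) r := by
    have h1 := (Real.hasDerivAt_log hr0.ne').div_const (4 * Real.pi)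
    exact (h1.congr_deriv (by rw [mul_inv, div_eq_mul_inv, mul_comm])).hasDerivWithinAt
  set e := φ' + Complex.I * ((((4 * Real.pi * r)⁻¹ * ‖φ r‖ ^ 2 : ℝ) : ℂ) * φ r) with he
  refine ⟨_, hasDerivWithinAt_twist hlog hφ (e := e) (by rw [he]; ring), ?_⟩
  rw [norm_mul, norm_exp_I_mul_real, one_mul]
  have h1 : ‖Complex.I * ((2 * (Real.log r / (4 * Real.pi)) * inner ℝ (φ r) e : ℝ) : ℂ) * φ r‖
      ≤ 2 * |Real.log r / (4 * Real.pi)| * (M * ‖e‖) * M := by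
    rw [norm_mul, norm_mul, Complex.norm_I, one_mul, Complex.norm_real, Real.norm_eq_abs,
      abs_mul, abs_mul, abs_two]
    have h2 : |inner ℝ (φ r) e| ≤ M * ‖e‖ :=
      (abs_real_inner_le_norm _ _).trans (by gcongr)
    gcongr
  calc _ ≤ ‖e‖ + 2 * |Real.log r / (4 * Real.pi)| * (M * ‖e‖) * M :=
        (norm_add_le _ _).trans (by gcongr)
    _ = (1 + 2 * |Real.log r / (4 * Real.pi)| * M ^ 2) * ‖e‖ := by ring
    _ ≤ ((1 + 200 * M ^ 2) * r ^ (1 / 100 : ℝ)) * (K * r ^ (-(219 / 200) : ℝ)) := by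
      gcongr
      exact one_add_log_le hr
    _ = K * (1 + 200 * M ^ 2) * (r ^ (1 / 100 : ℝ) * r ^ (-(219 / 200) : ℝ)) := by ring
    _ = _ := by rw [← Real.rpow_add hr0]; norm_num

/-- The phase corrected solution of `φ' = -i |φ|² φ / (4πt) + O(t^{-219/200})` converges. -/
theorem norm_twist_sub_le_of_deriv {φ φ' : ℝ → ℂ} {T M K : ℝ} (hT : 1 ≤ T)
    (hc : Continuous φ) (hφ : ∀ t, T ≤ t → HasDerivWithinAt φ (φ' t) (Set.Ici t) t)
    (hM : ∀ t, T ≤ t → ‖φ t‖ ≤ M)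
    (hK : ∀ t, T ≤ t → ‖φ' t + Complex.I * ((((4 * Real.pi * t)⁻¹ * ‖φ t‖ ^ 2 : ℝ) : ℂ) * φ t)‖
      ≤ K * t ^ (-(219 / 200) : ℝ)) {s t : ℝ} (hs : T ≤ s) (hst : s ≤ t) :
    ‖twist (Real.log t / (4 * Real.pi)) (φ t) - twist (Real.log s / (4 * Real.pi)) (φ s)‖
      ≤ 12 * (K * (1 + 200 * M ^ 2)) * s ^ (-(17 / 200) : ℝ) := by
  have hs0 : 0 < s := by linarith
  have hK0 : 0 ≤ K :=
    nonneg_of_mul_nonneg_left ((norm_nonneg _).trans (hK s hs)) (by positivity)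
  have hwc : ContinuousOn (fun r => twist (Real.log r / (4 * Real.pi)) (φ r)) (Set.Icc s t) := by
    have h1 : ContinuousOn (fun r => Real.log r / (4 * Real.pi)) (Set.Icc s t) :=
      (Real.continuousOn_log.mono fun r hr => by
        have := hr.1
        simp only [Set.mem_compl_iff, Set.mem_singleton_iff]
        linarith).div_const _
    have h2 : ContinuousOn (fun r => Complex.I * ((Real.log r / (4 * Real.pi) * ‖φ r‖ ^ 2 : ℝ) : ℂ))
        (Set.Icc s t) :=
      continuousOn_const.mul (Complex.continuous_ofReal.comp_continuousOn
        (h1.mul (hc.norm.pow 2).continuousOn))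
    exact h2.cexp.mul hc.continuousOn
  have hwd : ∀ r : ℝ, T ≤ r → ∃ w' : ℂ,
      HasDerivWithinAt (fun r => twist (Real.log r / (4 * Real.pi)) (φ r)) w' (Set.Ici r) r ∧
      ‖w'‖ ≤ K * (1 + 200 * M ^ 2) * r ^ (-(217 / 200) : ℝ) := fun r hr =>
    exists_deriv_twist_log (hT.trans hr) (hφ r hr) (hM r hr) (hK r hr)
  choose! w' hw1 hw2 using hwd
  exact norm_sub_le_of_deriv_le_rpow hs0 hst (by positivity) hwc
    (fun r hr => hw1 r (hs.trans hr.1)) (fun r hr => hw2 r (hs.trans hr.1))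

namespace H11

variable {dp dm tp : ℝ}

/-- The phase-corrected transforms are Cauchy at rate t^{-17/200}, uniformly in the frequency.
Undoing the correction costs one more t^{1/100}, leaving t^{-3/40}. -/
theorem exists_scattering_limit {f₀ : H11} {f : ℝ → H11} {ε M : ℝ} (hε : 0 < ε)
    (h : IsCurve (field dp dm tp) f₀ f) (hgrow : ∀ t, 0 ≤ t → ‖f t‖ ≤ growth ε t)
    (hM : ∀ t, 0 ≤ t → ∀ y, ‖chirp 0 (f t) y‖ ≤ M) :
    ∃ W : ℝ → ℂ, Measurable W ∧ (∀ y, ‖W y‖ ≤ M) ∧ ∃ T K : ℝ, 1 ≤ T ∧ 0 ≤ K ∧ ∀ t, T ≤ t → ∀ y,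
      ‖chirp 0 (f t) y - twist (-(Real.log t / (4 * Real.pi))) (W y)‖ ≤ K * t ^ (-(3 / 40) : ℝ) := by
  obtain ⟨B, hB0, hB⟩ := exists_cumDispersion_bound dp dm tp
  set T := 2 * B + 1 with hTdef
  have hT1 : 1 ≤ T := by linarith
  have hE := errConst_nonneg hB0
  set K₀ := 64 * errConst B * ε ^ 3 with hK₀
  have hK₀0 : 0 ≤ K₀ := by positivity
  set w : ℝ → ℝ → ℂ := fun t y => twist (Real.log t / (4 * Real.pi)) (chirp 0 (f t) y) with hw
  set K₁ := 12 * (K₀ * (1 + 200 * M ^ 2)) with hK₁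
  have hK₁0 : 0 ≤ K₁ := by positivity
  have hcauchy : ∀ y s t, T ≤ s → s ≤ t → ‖w t y - w s y‖ ≤ K₁ * s ^ (-(17 / 200) : ℝ) := by
    intro y s t hs hst
    refine norm_twist_sub_le_of_deriv (φ := fun t => chirp 0 (f t) y)
      (φ' := fun t => chirp 0 (field dp dm tp t (f t)) y) hT1
      ((hatEval y).continuous.comp h.continuous)
      (fun r hr => ((hatEval y).restrictScalars ℝ).hasFDerivAt.comp_hasDerivWithinAt r
        (h.deriv r (by linarith)))
      (fun r hr => hM r (by linarith) y) (fun r hr => ?_) hs hst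
    have hr0 : 0 < r := by linarith
    refine (norm_chirp_field_add_le dp dm tp hr hB (f r) y).trans ?_
    have h1 : ‖f r‖ ≤ 4 * ε * r ^ (1 / 100 : ℝ) :=
      (hgrow r hr0.le).trans (growth_le_rpow hε (by linarith))
    change errConst B * r ^ (-(9 / 8) : ℝ) * ‖f r‖ ^ 3 ≤ _
    calc errConst B * r ^ (-(9 / 8) : ℝ) * ‖f r‖ ^ 3
        ≤ errConst B * r ^ (-(9 / 8) : ℝ) * (4 * ε * r ^ (1 / 100 : ℝ)) ^ 3 := by gcongr
      _ = K₀ * (r ^ (-(9 / 8) : ℝ) * (r ^ (1 / 100 : ℝ)) ^ 3) := by rw [hK₀]; ring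
      _ = _ := by
        rw [← Real.rpow_mul_natCast hr0.le, ← Real.rpow_add hr0]
        norm_num
  have htend : Tendsto (fun n : ℕ => T + (n : ℝ)) atTop atTop :=
    tendsto_atTop_add_const_left _ _ tendsto_natCast_atTop_atTop
  have hlim : ∀ y, ∃ L : ℂ, Tendsto (fun n : ℕ => w (T + n) y) atTop (𝓝 L) := by
    intro y
    refine cauchySeq_tendsto_of_complete (cauchySeq_of_le_tendsto_0'
      (fun n : ℕ => K₁ * (T + (n : ℝ)) ^ (-(17 / 200) : ℝ)) (fun n m hnm => ?_) ?_)
    · rw [dist_comm, dist_eq_norm]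
      exact hcauchy y _ _ (by linarith [n.cast_nonneg (α := ℝ)])
        (by gcongr)
    · have h1 := (tendsto_rpow_neg_atTop (by norm_num : (0 : ℝ) < 17 / 200)).comp htend
      simpa [Function.comp_def] using h1.const_mul K₁
  choose W hW using hlim
  have hWM : ∀ y, ‖W y‖ ≤ M := fun y =>
    le_of_tendsto (hW y).norm (Eventually.of_forall fun n => by
      rw [hw, norm_twist]
      exact hM _ (by positivity) y)
  have hrate : ∀ y t, T ≤ t → ‖w t y - W y‖ ≤ K₁ * t ^ (-(17 / 200) : ℝ) := by
    intro y t ht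
    refine le_of_tendsto ((hW y).const_sub (w t y)).norm ?_
    filter_upwards [htend.eventually_ge_atTop t] with n hn
    rw [norm_sub_rev]
    exact hcauchy y t _ ht hn
  -- The limit is taken along the integers, so W is a pointwise limit of a sequence of continuous
  -- functions.
  have hmeas : Measurable W := by
    refine measurable_of_tendsto_metrizable (f := fun (n : ℕ) y => w (T + n) y) (fun n => ?_)
      (tendsto_pi_nhds.mpr hW)
    exact ((continuous_twist _).comp (chirp 0 (f (T + n))).continuous).measurable
  refine ⟨W, hmeas, hWM, T, (1 + 200 * M ^ 2) * K₁, hT1, by positivity, fun t ht y => ?_⟩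
  have ht0 : 0 < t := by linarith
  have e : chirp 0 (f t) y = twist (-(Real.log t / (4 * Real.pi))) (w t y) :=
    (twist_neg_twist _ _).symm
  have hwM : ‖w t y‖ ≤ M := by
    rw [hw, norm_twist]
    exact hM t ht0.le y
  rw [e]
  refine (norm_twist_sub_le _ hwM (hWM y)).trans ?_
  rw [abs_neg]
  calc _ ≤ ((1 + 200 * M ^ 2) * t ^ (1 / 100 : ℝ)) * (K₁ * t ^ (-(17 / 200) : ℝ)) := by
        gcongr
        · exact one_add_log_le (by linarith)
        · exact hrate y t ht
    _ = (1 + 200 * M ^ 2) * K₁ * (t ^ (1 / 100 : ℝ) * t ^ (-(17 / 200) : ℝ)) := by ring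
    _ = _ := by rw [← Real.rpow_add ht0]; norm_num

end H11

end DMNLS

namespace DMNLS

open Filter Topology

/-! ### From the limit in frequency to the asymptotics in space -/

namespace H11

theorem amp_eq {t : ℝ} (ht : 0 < t) :
    amp t = (((2 * Real.pi) ^ (-(1 / 2) : ℝ) : ℝ) : ℂ) * (2 * Complex.I * t) ^ (-(1 / 2) : ℂ) := by
  have hpi : 0 < 2 * Real.pi := by positivity
  have h0 : 2 * Complex.I * (t : ℂ) ≠ 0 := by simp [ht.ne']
  have e : ((4 * Real.pi * t : ℝ) : ℂ) * Complex.I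
      = ((2 * Real.pi : ℝ) : ℂ) * (2 * Complex.I * t) := by push_cast; ring
  have hr : ((2 * Real.pi : ℝ) : ℂ) ≠ 0 := by exact_mod_cast hpi.ne'
  rw [amp, e, Complex.cpow_def_of_ne_zero (mul_ne_zero hr h0), Complex.log_ofReal_mul hpi h0,
    Complex.cpow_def_of_ne_zero h0, Complex.ofReal_cpow hpi.le, Complex.cpow_def_of_ne_zero hr,
    ← Complex.exp_add, ← Complex.ofReal_log hpi.le]
  congr 1
  push_cast
  ring

/-- The scattering profile of the solution in terms of the limit of the Fourier transform. -/
def scatteringProfile (W : ℝ → ℂ) (y : ℝ) : ℂ :=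
  (((2 * Real.pi) ^ (-(1 / 2) : ℝ) : ℝ) : ℂ) * W (y / (2 * Real.pi))

/-- Reconciles the Fourier conventions: frequency x/(4πt) corresponds to x/(2t), and the factor
(2π)^{-1/2} in the profile both turns (4πit)^{-1/2} into (2it)^{-1/2} and turns the phase
coefficient 1/(4π) into 1/2. -/
theorem profile_eq (W : ℝ → ℂ) {t : ℝ} (ht : 0 < t) (x : ℝ) :
    profile (scatteringProfile W) t x = amp t * phase ((4 * t)⁻¹ • sqMap) x
      * twist (-(Real.log t / (4 * Real.pi))) (W (x / (4 * Real.pi * t))) := by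
  have hpi : 0 < 2 * Real.pi := by positivity
  have e1 : x / (2 * t) / (2 * Real.pi) = x / (4 * Real.pi * t) := by
    field_simp; ring
  have hn : ‖scatteringProfile W (x / (2 * t))‖ ^ 2
      = (2 * Real.pi)⁻¹ * ‖W (x / (4 * Real.pi * t))‖ ^ 2 := by
    rw [scatteringProfile, e1, norm_mul, Complex.norm_real, Real.norm_eq_abs,
      abs_of_pos (by positivity), mul_pow, ← Real.rpow_mul_natCast hpi.le]
    norm_num [Real.rpow_neg_one]
  rw [profile, hn, scatteringProfile, e1, amp_eq ht, twist, phase]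
  have e2 : -(Complex.I / 2) * (((2 * Real.pi)⁻¹ * ‖W (x / (4 * Real.pi * t))‖ ^ 2
      * Real.log t : ℝ) : ℂ)
      = Complex.I * ((-(Real.log t / (4 * Real.pi)) * ‖W (x / (4 * Real.pi * t))‖ ^ 2 : ℝ) : ℂ) := by
    have : (Real.pi : ℂ) ≠ 0 := by exact_mod_cast Real.pi_ne_zero
    push_cast
    field_simp
    ring
  have e3 : Complex.I * ((x ^ 2 / (4 * t) : ℝ) : ℂ)
      = (((4 * t)⁻¹ • sqMap) x : ℂ) * Complex.I := by
    simp only [ContinuousMap.smul_apply, sqMap_apply, smul_eq_mul]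
    push_cast
    ring
  rw [e2, e3]
  ring

variable {dp dm tp : ℝ}

/-- The chirp error is t^{-1/8+1/100} and the limit error is t^{-3/40}. Both are below t^{-1/20},
and the kernel amplitude supplies the remaining t^{-1/2}. -/
theorem exists_modified_scattering {f₀ : H11} {f : ℝ → H11} {ε M : ℝ} (hε : 0 < ε)
    (h : IsCurve (field dp dm tp) f₀ f) (hgrow : ∀ t, 0 ≤ t → ‖f t‖ ≤ growth ε t)
    (hM : ∀ t, 0 ≤ t → ∀ y, ‖chirp 0 (f t) y‖ ≤ M) :
    ∃ W : ℝ → ℂ, MemLp W ∞ volume ∧ ∃ T K : ℝ, 0 < T ∧ 0 ≤ K ∧ ∀ t, T ≤ t → ∀ x,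
      ‖evol t (f t) x - profile W t x‖ ≤ K * t ^ (-(1 / 2) - 1 / 20 : ℝ) := by
  obtain ⟨W, hmeas, hWM, T, K, hT, hK, hrate⟩ := exists_scattering_limit hε h hgrow hM
  refine ⟨scatteringProfile W, ?_, T, 16 * ‖rpowWeight‖ * ε + K, by linarith, by positivity,
    fun t ht x => ?_⟩
  · have hm : Measurable (scatteringProfile W) :=
      measurable_const.mul (hmeas.comp (measurable_id.div_const _))
    refine memLp_top_of_bound hm.aestronglyMeasurable ((2 * Real.pi) ^ (-(1 / 2) : ℝ) * M)
      (Eventually.of_forall fun y => ?_)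
    rw [scatteringProfile, norm_mul, Complex.norm_real, Real.norm_eq_abs,
      abs_of_pos (by positivity)]
    gcongr
    exact hWM _
  · have ht1 : 1 ≤ t := hT.trans ht
    have ht0 : 0 < t := by linarith
    have hpi := Real.pi_gt_three
    set y := x / (4 * Real.pi * t) with hy
    have hF : ‖f t‖ ≤ 4 * ε * t ^ (1 / 100 : ℝ) := (hgrow t ht0.le).trans (growth_le_rpow hε ht1)
    have hS : |(4 * t)⁻¹| ^ (1 / 8 : ℝ) ≤ t ^ (-(1 / 8) : ℝ) := by
      rw [abs_of_pos (by positivity), Real.rpow_neg ht0.le, ← Real.inv_rpow ht0.le]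
      apply Real.rpow_le_rpow (by positivity) _ (by norm_num)
      apply inv_anti₀ ht0
      linarith
    have h1 : ‖chirp (4 * t)⁻¹ (f t) y - chirp 0 (f t) y‖
        ≤ 16 * ‖rpowWeight‖ * ε * t ^ (-(1 / 20) : ℝ) := by
      calc _ ≤ _ := norm_chirp_apply_sub_le _ _ _
        _ ≤ 4 * ‖rpowWeight‖ * t ^ (-(1 / 8) : ℝ) * (4 * ε * t ^ (1 / 100 : ℝ)) := by gcongr
        _ = 16 * ‖rpowWeight‖ * ε * (t ^ (-(1 / 8) : ℝ) * t ^ (1 / 100 : ℝ)) := by ring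
        _ = 16 * ‖rpowWeight‖ * ε * t ^ (-(23 / 200) : ℝ) := by
          rw [← Real.rpow_add ht0]; norm_num
        _ ≤ _ := mul_le_mul_of_nonneg_left
          (Real.rpow_le_rpow_of_exponent_le ht1 (by norm_num)) (by positivity)
    have h2 : ‖chirp 0 (f t) y - twist (-(Real.log t / (4 * Real.pi))) (W y)‖
        ≤ K * t ^ (-(1 / 20) : ℝ) := by
      exact (hrate t ht y).trans (mul_le_mul_of_nonneg_left
        (Real.rpow_le_rpow_of_exponent_le ht1 (by norm_num)) hK)
    have h3 : (4 * Real.pi * t) ^ (-(1 / 2) : ℝ) ≤ t ^ (-(1 / 2) : ℝ) :=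
      Real.rpow_le_rpow_of_nonpos ht0 (by nlinarith) (by norm_num)
    rw [profile_eq W ht0, evol_eq_chirp ht0, ← mul_sub, norm_mul, norm_mul, norm_amp ht0, norm_phase,
      mul_one]
    calc _ ≤ t ^ (-(1 / 2) : ℝ) * (16 * ‖rpowWeight‖ * ε * t ^ (-(1 / 20) : ℝ)
            + K * t ^ (-(1 / 20) : ℝ)) := by
          gcongr
          exact (norm_sub_le_norm_sub_add_norm_sub _ (chirp 0 (f t) y) _).trans (add_le_add h1 h2)
      _ = (16 * ‖rpowWeight‖ * ε + K) * (t ^ (-(1 / 2) : ℝ) * t ^ (-(1 / 20) : ℝ)) := by ring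
      _ = _ := by rw [← Real.rpow_add ht0]; congr 2

end H11

end DMNLS

namespace DMNLS

open Filter Topology
open scoped NNReal

namespace H11

/-! ### Solutions of the Duhamel formula -/

variable {dp dm tp : ℝ}

theorem continuousH11_fn {g : ℝ → H11} (hg : Continuous g) : ContinuousH11 fun t => fn (g t) := by
  refine fun t _ => ⟨(normH11_fn_le _).trans_lt ENNReal.ofReal_lt_top, ?_⟩
  have h1 : Tendsto (fun s => ENNReal.ofReal (30 * ‖g s - g t‖)) (𝓝[Set.Ici 0] t) (𝓝 0) := by
    have h2 : Continuous fun s => ENNReal.ofReal (30 * ‖g s - g t‖) :=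
      ENNReal.continuous_ofReal.comp (continuous_const.mul (hg.sub continuous_const).norm)
    have h3 := (h2.tendsto t).mono_left (nhdsWithin_le_nhds (s := Set.Ici (0 : ℝ)))
    simpa using h3
  refine tendsto_of_tendsto_of_tendsto_of_le_of_le tendsto_const_nhds h1 (fun _ => zero_le)
    fun s => ?_
  change normH11 (fn (g s) - fn (g t)) ≤ _
  rw [← map_sub]
  exact normH11_fn_le _

theorem nonlinearity_prop (t : ℝ) (f : H11) :
    nonlinearity dp dm tp (prop t (fn f)) = Complex.I • prop t (fn (field dp dm tp t f)) := by
  rw [fn_field, map_smul, prop_prop_neg, smul_smul]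
  simp

theorem propagator_nonlinearity (t s : ℝ) (f : H11) :
    propagator (t - s) (nonlinearity dp dm tp (prop s (fn f)))
      = Complex.I • prop t (fn (field dp dm tp s f)) := by
  rw [propagator_eq_prop, nonlinearity_prop, map_smul, ← prop_add, sub_add_cancel]

theorem continuous_field_comp {f : ℝ → H11} (hf : Continuous f) :
    Continuous fun s => field dp dm tp s (f s) :=
  (continuous_field dp dm tp).comp₂ continuous_id hf

/-- Duhamel's formula is the image under e^{itΔ} of the integrated profile equation. The integral
exists already in H^{1,1}, since the field is continuous along continuous curves there. -/
theorem duhamel_eq {f : ℝ → H11} (hf : Continuous f) (f₀ : H11) {v : ℝ → L2}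
    (hv : ∀ s, 0 ≤ s → v s = prop s (fn (f s))) {t : ℝ} (ht : 0 ≤ t) :
    propagator t (fn f₀)
      - Complex.I • ∫ s in (0 : ℝ)..t, propagator (t - s) (nonlinearity dp dm tp (v s))
      = prop t (fn (f₀ + ∫ s in (0 : ℝ)..t, field dp dm tp s (f s))) := by
  have h1 : ∫ s in (0 : ℝ)..t, propagator (t - s) (nonlinearity dp dm tp (v s))
      = ∫ s in (0 : ℝ)..t, Complex.I • prop t (fn (field dp dm tp s (f s))) := by
    refine intervalIntegral.integral_congr fun s hs => ?_
    rw [Set.uIcc_of_le ht] at hs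
    simp only [hv s hs.1]
    exact propagator_nonlinearity t s (f s)
  have h2 := ((prop t).toContinuousLinearMap.comp fn).intervalIntegral_comp_comm
    ((continuous_field_comp (dp := dp) (dm := dm) (tp := tp) hf).intervalIntegrable
      (μ := volume) 0 t)
  have h3 : ∫ s in (0 : ℝ)..t, prop t (fn (field dp dm tp s (f s)))
      = prop t (fn (∫ s in (0 : ℝ)..t, field dp dm tp s (f s))) := h2
  rw [h1, intervalIntegral.integral_smul, h3, propagator_eq_prop, smul_smul, Complex.I_mul_I,
    neg_one_smul, sub_neg_eq_add, map_add, map_add]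

theorem isSolution_of_isCurve {f₀ : H11} {f : ℝ → H11} (h : IsCurve (field dp dm tp) f₀ f) :
    IsSolution dp dm tp (fn f₀) fun t => prop t (fn (f t)) where
  continuousH11 := continuousH11_fn (g := fun t => propH t (f t))
    (continuous_propH.comp₂ continuous_id h.continuous)
  duhamel t ht := by
    rw [duhamel_eq h.continuous f₀ (fun _ _ => rfl) ht,
      ← h.eq_add_integral (continuous_field_comp h.continuous) ht]

theorem duhamelWellDefined {f : ℝ → H11} (hf : Continuous f) :
    DuhamelWellDefined dp dm tp fun t => prop t (fn (f t)) where
  cubic_memLp s _ τ _ := by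
    rw [propagator_eq_prop]
    exact memLp_cubic _ (propH s (f s))
  integrable_tau s _ := by
    have h1 : Continuous fun τ => fn (cubicField (0 + cumDispersion dp dm tp τ) (propH s (f s))) :=
      fn.continuous.comp (continuous_cubicField_tau dp dm tp 0 (propH s (f s)))
    refine (h1.intervalIntegrable 0 1).congr fun τ _ => ?_
    change _ = integrand dp dm tp (fn (propH s (f s))) τ
    rw [integrand_fn, zero_add]
  integrable_time t _ := by
    have h0 : Continuous fun s => prop t (fn (field dp dm tp s (f s))) :=
      (prop t).continuous.comp (fn.continuous.comp (continuous_field_comp hf))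
    have h1 : Continuous fun s => Complex.I • prop t (fn (field dp dm tp s (f s))) :=
      h0.const_smul Complex.I
    exact (h1.intervalIntegrable 0 t).congr fun s _ => (propagator_nonlinearity t s (f s)).symm

/-- Both curves are bounded on compact time intervals, and the field is Lipschitz on balls uniformly
in time, so Grönwall applies without any smallness. -/
theorem isCurve_unique {f₀ : H11} {f g : ℝ → H11} (hf : IsCurve (field dp dm tp) f₀ f)
    (hg : IsCurve (field dp dm tp) f₀ g) : Set.EqOn f g (Set.Ici 0) := by
  intro t ht
  obtain ⟨M₁, hM₁⟩ := isCompact_Icc.exists_bound_of_continuousOn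
    (hf.continuous.continuousOn (s := Set.Icc 0 t))
  obtain ⟨M₂, hM₂⟩ := isCompact_Icc.exists_bound_of_continuousOn
    (hg.continuous.continuousOn (s := Set.Icc 0 t))
  set M := max M₁ M₂
  refine ODE_solution_unique_of_mem_Icc_right (v := field dp dm tp)
    (s := fun _ => Metric.closedBall 0 M)
    (K := (9 * (2 * ‖weight‖) ^ 2 * M ^ 2).toNNReal) (a := 0) (b := t) (fun s _ => ?_)
    hf.continuous.continuousOn (fun s hs => hf.deriv s hs.1) (fun s hs => ?_)
    hg.continuous.continuousOn (fun s hs => hg.deriv s hs.1) (fun s hs => ?_)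
    (hf.zero.trans hg.zero.symm) (Set.right_mem_Icc.mpr ht)
  · refine LipschitzOnWith.of_dist_le_mul fun x hx y hy => ?_
    rw [Real.coe_toNNReal _ (by positivity), dist_eq_norm, dist_eq_norm]
    exact norm_field_sub_le dp dm tp s (mem_closedBall_zero_iff.mp hx) (mem_closedBall_zero_iff.mp hy)
  · exact mem_closedBall_zero_iff.mpr ((hM₁ s ⟨hs.1, hs.2.le⟩).trans (le_max_left _ _))
  · exact mem_closedBall_zero_iff.mpr ((hM₂ s ⟨hs.1, hs.2.le⟩).trans (le_max_right _ _))

/-- A curve that is continuous in `H^{1,1}` on `[0, ∞)` lifts to a continuous curve in `H11`. -/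
theorem exists_continuous_lift {v : ℝ → L2} (hv : ContinuousH11 v) :
    ∃ g : ℝ → H11, Continuous g ∧ ∀ t, 0 ≤ t → fn (g t) = v t := by
  -- Evaluating at max t 0 extends the curve to negative times and turns one-sided continuity into
  -- continuity on the line.
  choose g hg using fun t : ℝ => exists_fn_eq (hv (max t 0) (le_max_right t 0)).1
  refine ⟨g, continuous_iff_continuousAt.mpr fun t => ?_, fun t ht => by rw [hg, max_eq_left ht]⟩
  have h1 : Tendsto (fun s : ℝ => max s 0) (𝓝 t) (𝓝[Set.Ici 0] (max t 0)) :=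
    tendsto_nhdsWithin_iff.mpr ⟨(continuous_id.max continuous_const).tendsto t,
      Eventually.of_forall fun s => le_max_right s 0⟩
  have h2 := ((hv (max t 0) (le_max_right t 0)).2).comp h1
  refine tendsto_iff_edist_tendsto_0.mpr
    (tendsto_of_tendsto_of_tendsto_of_le_of_le tendsto_const_nhds h2 (fun _ => zero_le) fun s => ?_)
  rw [edist_dist, dist_eq_norm]
  refine (enorm_le_normH11 _).trans ?_
  rw [map_sub, hg, hg]
  rfl

/-- An arbitrary Duhamel solution is lifted to `H11` and pulled back by the free flow. The integral
equation, known in L², holds in `H11` by `ext_fn`, so the pulled-back curve solves the profile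
equation. -/
theorem eqOn_of_isSolution {f₀ : H11} {f : ℝ → H11} (hf : IsCurve (field dp dm tp) f₀ f)
    {v : ℝ → L2} (hv : IsSolution dp dm tp (fn f₀) v) :
    Set.EqOn v (fun t => prop t (fn (f t))) (Set.Ici 0) := by
  obtain ⟨g, hg, hgv⟩ := exists_continuous_lift hv.continuousH11
  have hw : Continuous fun t => propH (-t) (g t) := continuous_propH.comp₂ continuous_neg hg
  have hvw : ∀ s, 0 ≤ s → v s = prop s (fn (propH (-s) (g s))) := fun s hs => by
    rw [fn_propH, prop_prop_neg, hgv s hs]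
  have hcurve : IsCurve (field dp dm tp) f₀ fun t => propH (-t) (g t) := by
    refine IsCurve.of_eq_add_integral hw (continuous_field_comp hw) fun t ht => ext_fn ?_
    refine (prop t).injective ?_
    rw [← duhamel_eq hw f₀ hvw ht, ← hvw t ht]
    exact hv.duhamel t ht
  intro t ht
  rw [hvw t ht]
  exact congrArg (fun z => prop t (fn z)) (isCurve_unique hcurve hf ht)

theorem eLpNorm_prop_top_le {t a : ℝ} {f : H11} (h : ‖evol t f‖ ≤ a) :
    eLpNorm (prop t (fn f)) ∞ volume ≤ ENNReal.ofReal a := by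
  rw [eLpNorm_exponent_top]
  refine eLpNormEssSup_le_of_ae_bound ?_
  filter_upwards [coeFn_evol t f] with x hx
  rw [← hx]
  exact ((evol t f).norm_coe_le_norm x).trans h

theorem eLpNorm_prop_sub_top_le {t a : ℝ} {f : H11} {p : ℝ → ℂ}
    (h : ∀ x, ‖evol t f x - p x‖ ≤ a) :
    eLpNorm (fun x => prop t (fn f) x - p x) ∞ volume ≤ ENNReal.ofReal a := by
  rw [eLpNorm_exponent_top]
  refine eLpNormEssSup_le_of_ae_bound ?_
  filter_upwards [coeFn_evol t f] with x hx
  rw [← hx]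
  exact h x

end H11

end DMNLS

end

/-! ### Assembly of the main theorem -/

theorem theorem1 (dp dm tp : ℝ) (htp0 : 0 < tp) (htp1 : tp < 1)
    (hav : DMNLS.avgDispersion dp dm tp = 1) :
    ∃ ε₀ : ℝ, 0 < ε₀ ∧ ∃ C : ℝ, 0 < C ∧
      ∀ (u₀ : DMNLS.L2) (ε : ℝ), 0 < ε → ε ≤ ε₀ → DMNLS.normH11 u₀ = ENNReal.ofReal ε →
        ∃ u : ℝ → DMNLS.L2,
          -- existence
          DMNLS.IsSolution dp dm tp u₀ u ∧ DMNLS.DuhamelWellDefined dp dm tp u ∧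
          -- uniqueness
          (∀ v : ℝ → DMNLS.L2, DMNLS.IsSolution dp dm tp u₀ v → Set.EqOn v u (Set.Ici 0)) ∧
          -- decay
          (∀ t : ℝ, 0 ≤ t →
            eLpNorm (u t) ∞ volume ≤ ENNReal.ofReal (C * ε * (1 + |t|) ^ (-(1 / 2) : ℝ))) ∧
          -- modified scattering
          ∃ W : ℝ → ℂ, MemLp W ∞ volume ∧
            ∃ K : ℝ, ∀ᶠ t : ℝ in Filter.atTop,
              eLpNorm (fun x : ℝ => u t x - DMNLS.profile W t x) ∞ volume
                ≤ ENNReal.ofReal (K * t ^ (-(1 / 2) - 1 / 20 : ℝ)) := by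
  obtain ⟨ε₀, hε₀, C, hC, H⟩ := DMNLS.H11.exists_global_curve dp dm tp
  refine ⟨ε₀, hε₀, C, hC, fun u₀ ε hε hεle hu₀ => ?_⟩
  obtain ⟨f₀, rfl⟩ := DMNLS.H11.exists_fn_eq (hu₀.trans_lt ENNReal.ofReal_lt_top)
  have hf₀ : ‖f₀‖ ≤ ε :=
    (ENNReal.ofReal_le_ofReal_iff hε.le).mp ((DMNLS.H11.enorm_le_normH11 f₀).trans hu₀.le)
  obtain ⟨f, hf, hgrow, hdecay, hhat⟩ := H f₀ ε hε hεle hf₀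
  obtain ⟨W, hW, T, K, _, _, hscat⟩ := DMNLS.H11.exists_modified_scattering hε hf hgrow hhat
  refine ⟨fun t => DMNLS.prop t (DMNLS.H11.fn (f t)), DMNLS.H11.isSolution_of_isCurve hf,
    DMNLS.H11.duhamelWellDefined hf.continuous,
    fun v hv => DMNLS.H11.eqOn_of_isSolution hf hv, fun t ht => ?_, W, hW, K, ?_⟩
  · rw [abs_of_nonneg ht]
    exact DMNLS.H11.eLpNorm_prop_top_le (hdecay t ht)
  · filter_upwards [Filter.eventually_ge_atTop T] with t ht
    exact DMNLS.H11.eLpNorm_prop_sub_top_le (hscat t ht)
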